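/- Let $X$ be a (connected, finite-dimensional, boundaryless) smooth Riemannian manifold with Riemannian distance $d$, let $Y=\overline{\Omega}$ be the closure of a bounded open set $\Omega\subset X$ with smooth boundary (near each of its boundary points $\Omega$ is a strict sublevel set $\{f<0\}$ of a smooth function $f$ with $df\neq 0$ at that point), and let $\kappa\le 0$. Then the following are equivalent: (i) For each $\delta>0$ there is a function $V:X\to\mathbb R$ with $Y=\{x\in X: V(x)\le 0\}$ and an open neighbourhood $U$ of $\partial Y$ such that $V$ is smooth on $U$, $\operatorname{Hess}_V\ge \kappa-\delta$ on $U$ and $|\nabla V|\ge 1-\delta$ on $U$. (ii) For each $\kappa'<\kappa$ there is an open neighbourhood $U$ of $\partial Y$ on which the signed distance $V$ from the boundary, $V=-d(\cdot,\partial Y)$ on $Y$ and $V=d(\cdot,\partial Y)$ on $X\setminus Y$, is smooth and satisfies $\operatorname{Hess}_V\ge\kappa'$. (iii) The second fundamental form satisfies $\mathcal I_{\partial Y}\ge\kappa$, that is, $\mathcal I_{\partial Y}(u,u)\ge\kappa|u|^2$ for all $m\in\partial Y$ and $u\in T_m\partial Y$. Here $\mathcal I_{\partial Y}(u,w)=\langle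 n,\nabla_u W\rangle$ for $u,w\in T_m\partial Y$, where $n$ is the inward unit normal vector at $m$ and $W$ is any smooth vector field in a neighbourhood of $m$ that is tangent to $\partial Y$ at every point of $\partial Y$ and has value $w$ at $m$. Here $\nabla$ is the Levi-Civita connection, $\operatorname{Hess}_V(u,w)=\langle\nabla_u\nabla V,w\rangle$, and $\operatorname{Hess}_V\ge c$ on $U$ means $\operatorname{Hess}_V(u,u)\ge c|u|^2$ for all $x\in U$, $u\in T_xX$. -/

import Mathlib

open Bundle Set
open scoped Manifold ContDiff Topology

noncomputable section

namespace RiemannianHess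

section LeviCivita

variable {E : Type*} [NormedAddCommGroup E] [NormedSpace ℝ E]
  {H : Type*} [TopologicalSpace H] (I : ModelWithCorners ℝ E H)
  {M : Type*} [TopologicalSpace M] [ChartedSpace H M] [IsManifold I ∞ M]
  [RiemannianBundle (fun x : M ↦ TangentSpace I x)]

/-- The right-hand side of the Koszul formula, as an expression in three vector fields:
`X⟨Y,Z⟩ + Y⟨X,Z⟩ - Z⟨X,Y⟩ + ⟨[X,Y],Z⟩ - ⟨[X,Z],Y⟩ - ⟨[Y,Z],X⟩`. -/
def koszul (Y X Z : Π x : M, TangentSpace I x) (x : M) : ℝ :=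
  mvfderiv I (fun y ↦ inner ℝ (Y y) (Z y)) x (X x)
    + mvfderiv I (fun y ↦ inner ℝ (X y) (Z y)) x (Y x)
    - mvfderiv I (fun y ↦ inner ℝ (X y) (Y y)) x (Z x)
    + inner ℝ (VectorField.mlieBracket I X Y x) (Z x)
    - inner ℝ (VectorField.mlieBracket I X Z x) (Y x)
    - inner ℝ (VectorField.mlieBracket I Y Z x) (X x)

variable [IsContMDiffRiemannianBundle I ∞ E (fun x : M ↦ TangentSpace I x)]

variable {I} in
lemma mdiff_inner {X Y : Π x : M, TangentSpace I x} {x : M} (hX : MDiffAt (T% X) x)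
    (hY : MDiffAt (T% Y) x) : MDiffAt (fun y ↦ inner ℝ (X y) (Y y)) x :=
  MDifferentiableAt.inner_bundle (F := E) (E := fun x : M ↦ TangentSpace I x) (b := fun y ↦ y)
    hX hY

variable {I} in
lemma endomorphism_ext {x : M} {A B : TangentSpace I x →L[ℝ] TangentSpace I x}
    (h : ∀ X Z : Π x : M, TangentSpace I x, MDiffAt (T% X) x → MDiffAt (T% Z) x →
      inner ℝ (A (X x)) (Z x) = inner ℝ (B (X x)) (Z x)) : A = B := by
  refine ContinuousLinearMap.ext fun u ↦ ext_inner_right ℝ fun z ↦ ?_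
  simpa using h (FiberBundle.extend E u) (FiberBundle.extend E z)
    (FiberBundle.mdifferentiableAt_extend ..) (FiberBundle.mdifferentiableAt_extend ..)

variable [FiniteDimensional ℝ E]

variable {I} in
lemma koszul_tensorial_left {Y : Π x : M, TangentSpace I x} {x : M} (hY : MDiffAt (T% Y) x)
    (Z : Π x : M, TangentSpace I x) (hZ : MDiffAt (T% Z) x) :
    TensorialAt I E (fun X ↦ koszul I Y X Z x) x where
  smul {f X} hf hX := by
    have h1 := mvfderiv_fun_mul hf (mdiff_inner hX hZ)
    have h2 := mvfderiv_fun_mul hf (mdiff_inner hX hY)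
    simp only [koszul, Pi.smul_apply', VectorField.mlieBracket_smul_left hf hX,
      inner_smul_left, inner_smul_right, inner_add_left, map_smul, RCLike.conj_to_real]
    rw [h1, h2]
    simp [real_inner_comm]
    ring
  add {X X'} hX hX' := by
    have h1 := mvfderiv_fun_add (mdiff_inner hX hZ) (mdiff_inner hX' hZ)
    have h2 := mvfderiv_fun_add (mdiff_inner hX hY) (mdiff_inner hX' hY)
    simp only [koszul, Pi.add_apply, VectorField.mlieBracket_add_left hX hX',
      inner_add_left, inner_add_right, map_add]
    rw [h1, h2]
    simp
    ring

variable {I} in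
lemma koszul_tensorial_right {Y : Π x : M, TangentSpace I x} {x : M} (hY : MDiffAt (T% Y) x)
    (X : Π x : M, TangentSpace I x) (hX : MDiffAt (T% X) x) :
    TensorialAt I E (fun Z ↦ koszul I Y X Z x) x where
  smul {f Z} hf hZ := by
    have h1 := mvfderiv_fun_mul hf (mdiff_inner hY hZ)
    have h2 := mvfderiv_fun_mul hf (mdiff_inner hX hZ)
    simp only [koszul, Pi.smul_apply', VectorField.mlieBracket_smul_right hf hZ,
      inner_smul_left, inner_smul_right, inner_add_left, map_smul, RCLike.conj_to_real]
    rw [h1, h2]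
    simp [real_inner_comm]
    ring
  add {Z Z'} hZ hZ' := by
    have h1 := mvfderiv_fun_add (mdiff_inner hY hZ) (mdiff_inner hY hZ')
    have h2 := mvfderiv_fun_add (mdiff_inner hX hZ) (mdiff_inner hX hZ')
    simp only [koszul, Pi.add_apply, VectorField.mlieBracket_add_right hZ hZ',
      inner_add_left, inner_add_right, map_add]
    rw [h1, h2]
    simp
    ring

/-- The continuous bilinear form `(u, z) ↦ 2⟨∇_u Y, z⟩` on the tangent space at `x`, as given by
the Koszul formula. -/
def koszulHom {Y : Π x : M, TangentSpace I x} {x : M} (hY : MDiffAt (T% Y) x) :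
    TangentSpace I x →L[ℝ] TangentSpace I x →L[ℝ] ℝ :=
  TensorialAt.mkHom₂ (fun X Z ↦ koszul I Y X Z x) x
    (koszul_tensorial_left hY) (koszul_tensorial_right hY)

lemma koszulHom_apply {X Y Z : Π x : M, TangentSpace I x} {x : M} (hX : MDiffAt (T% X) x)
    (hY : MDiffAt (T% Y) x) (hZ : MDiffAt (T% Z) x) :
    koszulHom I hY (X x) (Z x) = koszul I Y X Z x :=
  TensorialAt.mkHom₂_apply _ _ hX hZ

instance instFiniteDimensionalTangentSpace (x : M) : FiniteDimensional ℝ (TangentSpace I x) :=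
  inferInstanceAs (FiniteDimensional ℝ E)

instance instCompleteSpaceTangentSpace (x : M) : CompleteSpace (TangentSpace I x) :=
  FiniteDimensional.complete ℝ _

open Classical in
/-- The vector `∇_u Y` at `x`: the one with `2⟨∇_u Y, z⟩` given by the Koszul formula
(and `0` if the vector field `Y` is not differentiable at `x`). -/
def leviCivitaFun (Y : Π x : M, TangentSpace I x) (x : M) :
    TangentSpace I x →L[ℝ] TangentSpace I x :=
  if hY : MDiffAt (T% Y) x then
    LinearMap.toContinuousLinearMap
      { toFun u := (InnerProductSpace.toDual ℝ (TangentSpace I x)).symm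
          ((1 / 2 : ℝ) • koszulHom I hY u)
        map_add' u v := by simp
        map_smul' c u := by
          rw [(koszulHom I hY).map_smul, smul_comm, map_smulₛₗ]
          rfl }
  else 0

lemma inner_leviCivitaFun {X Y Z : Π x : M, TangentSpace I x} {x : M} (hX : MDiffAt (T% X) x)
    (hY : MDiffAt (T% Y) x) (hZ : MDiffAt (T% Z) x) :
    inner ℝ (leviCivitaFun I Y x (X x)) (Z x) = 1 / 2 * koszul I Y X Z x := by
  rw [← koszulHom_apply I hX hY hZ]
  simp [leviCivitaFun, hY, inner_smul_left]

/-- The Levi-Civita connection of a Riemannian manifold. -/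
def leviCivita : CovariantDerivative I E (fun x : M ↦ TangentSpace I x) where
  toFun := leviCivitaFun I
  isCovariantDerivativeOnUniv :=
    { add := by
        intro Y Y' x hY hY' _
        refine endomorphism_ext fun X Z hX hZ ↦ ?_
        have hYY' : MDiffAt (T% (Y + Y')) x := mdifferentiableAt_add_section hY hY'
        have h1 := mvfderiv_fun_add (mdiff_inner hY hZ) (mdiff_inner hY' hZ)
        have h2 := mvfderiv_fun_add (mdiff_inner hX hY) (mdiff_inner hX hY')
        rw [inner_leviCivitaFun I hX hYY' hZ, add_apply, inner_add_left,
          inner_leviCivitaFun I hX hY hZ, inner_leviCivitaFun I hX hY' hZ]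
        simp only [koszul, Pi.add_apply, VectorField.mlieBracket_add_left hY hY',
          VectorField.mlieBracket_add_right hY hY', inner_add_left, inner_add_right, map_add]
        rw [h1, h2]
        simp
        ring
      leibniz := by
        intro Y f x hY hf _
        refine endomorphism_ext fun X Z hX hZ ↦ ?_
        have hfY : MDiffAt (T% (f • Y)) x := hf.smul_section hY
        have h1 := mvfderiv_fun_mul hf (mdiff_inner hY hZ)
        have h2 := mvfderiv_fun_mul hf (mdiff_inner hX hY)
        rw [inner_leviCivitaFun I hX hfY hZ, add_apply, inner_add_left,
          smul_apply, inner_smul_left, inner_leviCivitaFun I hX hY hZ]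
        simp only [koszul, Pi.smul_apply', VectorField.mlieBracket_smul_left hf hY,
          VectorField.mlieBracket_smul_right hf hY,
          inner_smul_left, inner_smul_right, inner_add_left, map_smul, RCLike.conj_to_real]
        rw [h1, h2]
        simp [real_inner_comm, inner_smul_left]
        ring }

/-- The Levi-Civita connection is compatible with the metric. -/
lemma mvfderiv_inner_eq_leviCivita {X Y Z : Π x : M, TangentSpace I x} {x : M}
    (hX : MDiffAt (T% X) x) (hY : MDiffAt (T% Y) x) (hZ : MDiffAt (T% Z) x) :
    mvfderiv I (fun y ↦ inner ℝ (Y y) (Z y)) x (X x)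
      = inner ℝ (leviCivita I Y x (X x)) (Z x) + inner ℝ (Y x) (leviCivita I Z x (X x)) := by
  rw [real_inner_comm (leviCivita I Z x (X x))]
  change _ = inner ℝ (leviCivitaFun I Y x (X x)) (Z x) + inner ℝ (leviCivitaFun I Z x (X x)) (Y x)
  rw [inner_leviCivitaFun I hX hY hZ, inner_leviCivitaFun I hX hZ hY]
  have h1 : (fun y ↦ inner ℝ (Z y) (Y y)) = fun y ↦ inner ℝ (Y y) (Z y) :=
    funext fun y ↦ real_inner_comm _ _
  have h2 := VectorField.mlieBracket_swap_apply (I := I) (V := Z) (W := Y) (x := x)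
  simp only [koszul, h1, h2, inner_neg_left]
  ring

/-- The Levi-Civita connection is torsion-free. -/
lemma leviCivita_torsion : (leviCivita I (M := M)).torsion = 0 := by
  rw [CovariantDerivative.torsion_eq_zero_iff]
  intro X Y x hX hY
  change leviCivitaFun I Y x (X x) - leviCivitaFun I X x (Y x) = _
  refine ext_inner_right ℝ fun z ↦ ?_
  have hZ := FiberBundle.mdifferentiableAt_extend I E z
  have h1 := inner_leviCivitaFun I hX hY hZ
  have h2 := inner_leviCivitaFun I hY hX hZ
  simp only [FiberBundle.extend_apply_self] at h1 h2
  rw [inner_sub_left, h1, h2]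
  have h3 : (fun y ↦ inner ℝ (Y y) (X y)) = fun y ↦ inner ℝ (X y) (Y y) :=
    funext fun y ↦ real_inner_comm _ _
  have h4 := VectorField.mlieBracket_swap_apply (I := I) (V := Y) (W := X) (x := x)
  simp only [koszul, h3, h4, inner_neg_left, FiberBundle.extend_apply_self]
  ring

/-- The Riemannian gradient, characterised by `⟨grad f, v⟩ = df(v)`. -/
def gradient (f : M → ℝ) (x : M) : TangentSpace I x :=
  (InnerProductSpace.toDual ℝ (TangentSpace I x)).symm (mvfderiv I f x)

/-- The Hessian `Hess f (u, w) = ⟨∇_u grad f, w⟩`. -/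
def hessian (f : M → ℝ) (x : M) (u w : TangentSpace I x) : ℝ :=
  inner ℝ (leviCivita I (gradient I f) x u) w

/-- `Hess f ≥ c` on `U`, in the sense of quadratic forms. -/
def HessianGE (f : M → ℝ) (c : ℝ) (U : Set M) : Prop :=
  ∀ x ∈ U, ∀ u : TangentSpace I x, c * ‖u‖ ^ 2 ≤ hessian I f x u u

end LeviCivita

section Boundary

variable {E : Type*} [NormedAddCommGroup E] [NormedSpace ℝ E]
  {H : Type*} [TopologicalSpace H] (I : ModelWithCorners ℝ E H)
  {M : Type*} [TopologicalSpace M] [ChartedSpace H M]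

/-- Near `x`, the interior of `D` is the strict sublevel set `{f < 0}` of the smooth function `f`,
and `df ≠ 0` and `f = 0` at `x`. -/
def IsLocalDefiningFunction (D : Set M) (x : M) (f : M → ℝ) : Prop :=
  f x = 0 ∧ mvfderiv I f x ≠ 0 ∧
    ∃ U : Set M, IsOpen U ∧ x ∈ U ∧ ContMDiffOn I 𝓘(ℝ, ℝ) ∞ f U ∧
      ∀ y ∈ U, (y ∈ interior D ↔ f y < 0)

/-- The open set `Ω` has smooth boundary: near each boundary point it is a regular strict sublevel
set of a smooth function. -/
def HasSmoothBoundary (Ω : Set M) : Prop :=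
  ∀ x ∈ frontier Ω, ∃ f : M → ℝ, IsLocalDefiningFunction I Ω x f

/-- `u ∈ T_x ∂D`: the kernel of the differential of any local defining function at `x`. -/
def IsTangentToBoundary (D : Set M) (x : M) (u : TangentSpace I x) : Prop :=
  ∀ f : M → ℝ, IsLocalDefiningFunction I D x f → mvfderiv I f x u = 0

variable [IsManifold I ∞ M] [RiemannianBundle (fun x : M ↦ TangentSpace I x)]

/-- `n` is the inward unit normal vector of `D` at the boundary point `x`. -/
def IsInwardUnitNormal (D : Set M) (x : M) (n : TangentSpace I x) : Prop :=
  ‖n‖ = 1 ∧ (∀ u : TangentSpace I x, IsTangentToBoundary I D x u → inner ℝ n u = (0 : ℝ)) ∧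
    ∀ f : M → ℝ, IsLocalDefiningFunction I D x f → mvfderiv I f x n < 0

/-- `W` is a smooth vector field in a neighbourhood of `x`, tangent to `∂D` at every point of
`∂D` in that neighbourhood, with value `w` at `x`. -/
def IsTangentExtension (D : Set M) (x : M) (w : TangentSpace I x)
    (W : Π y : M, TangentSpace I y) : Prop :=
  W x = w ∧ ∃ U : Set M, IsOpen U ∧ x ∈ U ∧ ContMDiffOn I I.tangent ∞ (T% W) U ∧
    ∀ y ∈ U ∩ frontier D, IsTangentToBoundary I D y (W y)

variable [FiniteDimensional ℝ E] [IsContMDiffRiemannianBundle I ∞ E (fun x : M ↦ TangentSpace I x)]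

/-- The real number `r` is the value at `(u, w)` of the second fundamental form of `∂D` at `x`:
`r = ⟨n, ∇_u W⟩` for the inward unit normal `n` and an extension `W` of `w` to a vector field that
is tangent to `∂D` along `∂D`. -/
def IsSecondFundamentalForm (D : Set M) (x : M) (u w : TangentSpace I x) (r : ℝ) : Prop :=
  ∃ (n : TangentSpace I x) (W : Π y : M, TangentSpace I y),
    IsInwardUnitNormal I D x n ∧ IsTangentExtension I D x w W ∧
      r = inner ℝ n (leviCivita I W x u)

/-- The second fundamental form of `∂D` is bounded below by `c`, as a quadratic form. -/
def SecondFundamentalFormGE (D : Set M) (c : ℝ) : Prop :=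
  ∀ x ∈ frontier D, ∀ u : TangentSpace I x, IsTangentToBoundary I D x u →
    ∀ r : ℝ, IsSecondFundamentalForm I D x u u r → c * ‖u‖ ^ 2 ≤ r

end Boundary

open Classical in
/-- The signed distance from `∂D`: negative inside `D`, positive outside. -/
def signedDistance {M : Type*} [PseudoMetricSpace M] (D : Set M) (x : M) : ℝ :=
  if x ∈ D then -Metric.infDist x (frontier D) else Metric.infDist x (frontier D)

end RiemannianHess

end

/-! Let `f` be a local defining function of `∂Y` and `W` a field tangent to `∂Y`. Then `⟨∇f, W⟩`
vanishes on `∂Y`, and differentiating it in a tangent direction `u`, with inward normal `n =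
-∇f/|∇f|`, gives `𝓘(u, w) = Hess f(u, w) / |∇f|` (`IsSecondFundamentalForm.eq_hessian_div`). For a
function `V` as in (i) this yields `𝓘 ≥ (κ - δ)/(1 - δ)`, where `κ ≤ 0` ensures that a large `|∇V|`
only helps; letting `δ → 0` gives (iii).

Conversely, take for `f` the signed distance. Differentiating `|∇f|² = 1` shows that `∇f` lies in
the kernel of `Hess f`. On `∂Y` the Hessian is therefore `𝓘` in tangent directions and zero in the
normal direction, hence at least `κ` because `κ ≤ 0`. By continuity it is at least any given `κ' <
κ` near `∂Y` (`eventually_hessian_ge`), which is (ii). The signed distance with `κ' = κ - δ` then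
serves as `V` in (i).

The analytic core is the smoothness of the signed distance near `∂Y`. The eikonal equation `|∇V| =
1`, `V = 0` on `∂Y`, is solved by characteristics (`exists_eikonal`): the unit conormals are
transported by the Hamiltonian flow of the cometric, and `V` is the arrival time. Characteristics
have unit speed, so `∂Y` is reached within length `|V|`; no shorter path exists because `|∇V| = 1`
(`abs_sub_le_dist`). Hence `V` is the signed distance (`exists_signedDistance_eventuallyEq`). Smooth
dependence of the flow on initial data comes from the inverse function theorem applied to the
integral equation in a Banach space of continuous curves (`exists_flow_of_contDiff`). -/

namespace RiemannianHess

set_option maxSynthPendingDepth 3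
set_option linter.unusedSectionVars false

universe u

/-! ### Superposition operators on spaces of continuous functions -/

section Nemytskii

open ContinuousLinearMap

variable {X : Type*} [TopologicalSpace X] [CompactSpace X]

/-- A continuous family of linear maps acts pointwise on continuous functions. -/
noncomputable def pointwiseApply (V W : Type*) [NormedAddCommGroup V] [NormedSpace ℝ V]
    [NormedAddCommGroup W] [NormedSpace ℝ W] : C(X, V →L[ℝ] W) →L[ℝ] C(X, V) →L[ℝ] C(X, W) :=
  let B : C(X, V →L[ℝ] W) →ₗ[ℝ] C(X, V) →ₗ[ℝ] C(X, W) :=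
    LinearMap.mk₂ ℝ (fun A h ↦ ⟨fun s ↦ A s (h s), A.continuous.clm_apply h.continuous⟩)
      (fun A B h ↦ by ext; simp) (fun c A h ↦ by ext; simp)
      (fun A h k ↦ by ext; simp) (fun c A h ↦ by ext; simp)
  LinearMap.mkContinuous₂ (𝕜 := ℝ) (𝕜₂ := ℝ) (𝕜₃ := ℝ) (E := C(X, V →L[ℝ] W)) (F := C(X, V))
      (G := C(X, W)) B 1 fun A h ↦ by
    rw [one_mul, ContinuousMap.norm_le _ (by positivity)]
    exact fun s ↦ (A s).le_of_opNorm_le_of_le (A.norm_coe_le_norm s) (h.norm_coe_le_norm s)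

lemma pointwiseApply_apply {V W : Type*} [NormedAddCommGroup V] [NormedSpace ℝ V]
    [NormedAddCommGroup W] [NormedSpace ℝ W] (A : C(X, V →L[ℝ] W)) (h : C(X, V)) (s : X) :
    pointwiseApply V W A h s = A s (h s) := rfl

/-- The derivative of the superposition operator `γ ↦ F ∘ γ` on continuous functions. -/
lemma hasFDerivAt_comp_continuousMap {V W : Type*} [NormedAddCommGroup V] [NormedSpace ℝ V]
    [NormedAddCommGroup W] [NormedSpace ℝ W] {F : V → W} (hF : ContDiff ℝ 1 F) (γ : C(X, V)) :
    HasFDerivAt (fun γ : C(X, V) ↦ (⟨F, hF.continuous⟩ : C(V, W)).comp γ)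
      (pointwiseApply V W
        ((⟨fderiv ℝ F, hF.continuous_fderiv one_ne_zero⟩ : C(V, V →L[ℝ] W)).comp γ)) γ := by
  rw [hasFDerivAt_iff_isLittleO_nhds_zero, Asymptotics.isLittleO_iff]
  intro c hc
  -- The range of `γ` is compact, so `fderiv ℝ F` is uniformly continuous around it. One `δ` then
  -- serves for all `s`, and the mean value inequality gives the estimate in the sup norm.
  have hu := (isCompact_range γ.continuous).uniformContinuousAt_of_continuousAt (fderiv ℝ F)
    (fun a _ ↦ (hF.continuous_fderiv one_ne_zero).continuousAt) (Metric.dist_mem_uniformity hc)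
  obtain ⟨δ, hδ, hδ'⟩ := Metric.mem_uniformity_dist.1 hu
  filter_upwards [Metric.ball_mem_nhds (0 : C(X, V)) hδ] with h hh
  rw [mem_ball_zero_iff] at hh
  rw [ContinuousMap.norm_le _ (by positivity)]
  intro s
  have key := (convex_ball (γ s) δ).norm_image_sub_le_of_norm_fderiv_le' (𝕜 := ℝ) (f := F)
    (φ := fderiv ℝ F (γ s)) (C := c) (x := γ s) (y := γ s + h s)
    (fun x _ ↦ (hF.differentiable one_ne_zero) x)
    (fun x hx ↦ by
      have h1 : dist (γ s) x < δ := by rw [dist_comm]; exact hx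
      have h2 : dist (fderiv ℝ F (γ s)) (fderiv ℝ F x) < c := hδ' h1 (mem_range_self s)
      rw [← dist_eq_norm, dist_comm]
      exact h2.le)
    (Metric.mem_ball_self hδ)
    (by simpa using (h.norm_coe_le_norm s).trans_lt hh)
  have h3 := key.trans (mul_le_mul_of_nonneg_left
    (by simpa using h.norm_coe_le_norm s : ‖γ s + h s - γ s‖ ≤ ‖h‖) hc.le)
  simpa [pointwiseApply_apply] using h3

/-- The superposition operator of a smooth function is smooth. -/
lemma contDiff_comp_continuousMap {V W : Type u} [NormedAddCommGroup V] [NormedSpace ℝ V]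
    [NormedAddCommGroup W] [NormedSpace ℝ W] {F : V → W} (hF : ContDiff ℝ ∞ F) :
    ContDiff ℝ ∞ (fun γ : C(X, V) ↦ (⟨F, hF.continuous⟩ : C(V, W)).comp γ) := by
  refine contDiff_infty.2 fun n ↦ ?_
  -- The derivative is the superposition operator of `fderiv ℝ F`, with target `V →L[ℝ] W` instead
  -- of `W`. The common universe of `V` and `W` keeps the induction hypothesis applicable to this
  -- target.
  induction n generalizing W with
  | zero => exact contDiff_zero.2 (ContinuousMap.continuous_postcomp _)
  | succ n ih =>
    have h1 : ContDiff ℝ 1 F := hF.of_le (by exact_mod_cast le_top)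
    have h2 : ContDiff ℝ ∞ (fderiv ℝ F) := (contDiff_infty_iff_fderiv.1 hF).2
    refine contDiff_succ_iff_hasFDerivAt.2 ⟨fun γ ↦ pointwiseApply (X := X) V W
        ((⟨fderiv ℝ F, h2.continuous⟩ : C(V, V →L[ℝ] W)).comp γ), ?_,
      fun γ ↦ hasFDerivAt_comp_continuousMap h1 γ⟩
    exact (pointwiseApply (X := X) V W).contDiff.comp (ih (W := V →L[ℝ] W) h2)

end Nemytskii

/-! ### Inverse function theorem with a smooth inverse on a whole neighbourhood -/

section InverseFunction

variable {V W : Type*} [NormedAddCommGroup V] [NormedSpace ℝ V] [CompleteSpace V]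
  [NormedAddCommGroup W] [NormedSpace ℝ W]

/-- The inverse function theorem for smooth functions, with a single neighbourhood on which the
inverse is smooth. -/
lemma exists_openPartialHomeomorph_contDiffOn {f : V → W} {U : Set V} (hU : IsOpen U)
    (hf : ContDiffOn ℝ ∞ f U) {a : V} (ha : a ∈ U) (f' : V ≃L[ℝ] W)
    (hf' : HasFDerivAt f (f' : V →L[ℝ] W) a) :
    ∃ e : OpenPartialHomeomorph V W, a ∈ e.source ∧ e.source ⊆ U ∧ ⇑e = f ∧
      ContDiffOn ℝ ∞ e.symm e.target := by
  have hfa : ContDiffAt ℝ ∞ f a := hf.contDiffAt (hU.mem_nhds ha)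
  let e₀ := hfa.toOpenPartialHomeomorph f hf' (by simp)
  have hcont : ContinuousOn (fderiv ℝ f) U := hf.continuousOn_fderiv_of_isOpen hU (by simp)
  -- Invertible operators form an open set, so the domain can be shrunk to points with invertible
  -- derivative. The inverse is then smooth at every point of the target, not only at `f a`.
  have hopen : IsOpen (U ∩ fderiv ℝ f ⁻¹' range ((↑) : (V ≃L[ℝ] W) → V →L[ℝ] W)) :=
    hcont.isOpen_inter_preimage hU ContinuousLinearEquiv.isOpen
  let O := U ∩ fderiv ℝ f ⁻¹' range ((↑) : (V ≃L[ℝ] W) → V →L[ℝ] W)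
  have haO : a ∈ O := ⟨ha, f', hf'.fderiv.symm⟩
  refine ⟨e₀.restrOpen O hopen, ?_, ?_, rfl, ?_⟩
  · exact ⟨hfa.mem_toOpenPartialHomeomorph_source hf' (by simp), haO⟩
  · exact fun x hx ↦ hx.2.1
  · intro y hy
    have hx := (e₀.restrOpen O hopen).map_target hy
    obtain ⟨hxU, g, hg⟩ := hx.2
    refine ((e₀.restrOpen O hopen).contDiffAt_symm hy (f₀' := g) ?_ ?_).contDiffWithinAt
    · rw [hg]
      exact ((hf.differentiableOn (by simp)).differentiableAt (hU.mem_nhds hxU)).hasFDerivAt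
    · exact hf.contDiffAt (hU.mem_nhds hxU)

end InverseFunction

/-! ### Smooth local flows of vector fields -/

section Flow

variable {W : Type*} [NormedAddCommGroup W] [NormedSpace ℝ W] [CompleteSpace W]

/-- The primitive vanishing at `0` of a continuous function on `[-1, 1]`. -/
noncomputable def primitiveCLM (W : Type*) [NormedAddCommGroup W] [NormedSpace ℝ W]
    [CompleteSpace W] : C(Icc (-1 : ℝ) 1, W) →L[ℝ] C(Icc (-1 : ℝ) 1, W) :=
  LinearMap.mkContinuous (σ := RingHom.id ℝ) (E := C(Icc (-1 : ℝ) 1, W))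
    (F := C(Icc (-1 : ℝ) 1, W))
    { toFun γ := ⟨fun s ↦ ∫ r in (0 : ℝ)..s, γ (projIcc (-1) 1 (by norm_num) r),
        (intervalIntegral.continuous_primitive (fun a b ↦
          (γ.continuous.comp continuous_projIcc).intervalIntegrable a b) 0).comp
          continuous_subtype_val⟩
      map_add' γ η := by
        ext s
        exact intervalIntegral.integral_add
          ((γ.continuous.comp continuous_projIcc).intervalIntegrable _ _)
          ((η.continuous.comp continuous_projIcc).intervalIntegrable _ _)
      map_smul' c γ := by
        ext s
        exact intervalIntegral.integral_smul c _ } 1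
    (fun γ ↦ by
      rw [one_mul, ContinuousMap.norm_le _ (norm_nonneg _)]
      intro s
      refine (intervalIntegral.norm_integral_le_of_norm_le_const
        (fun r _ ↦ γ.norm_coe_le_norm _)).trans ?_
      have : |(s : ℝ) - 0| ≤ 1 := by rw [sub_zero]; exact abs_le.2 s.2
      exact mul_le_of_le_one_right (norm_nonneg _) this)

/-- A smooth vector field has a smooth local flow. -/
lemma exists_flow_of_contDiff {F : W → W} (hF : ContDiff ℝ ∞ F) (w₀ : W) :
    ∃ φ : W × ℝ → W, ∃ ε > 0, ContDiffOn ℝ ∞ φ (Metric.ball (w₀, (0 : ℝ)) ε) ∧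
      ∀ w ∈ Metric.ball w₀ ε, φ (w, 0) = w ∧
        ∀ t ∈ Metric.ball (0 : ℝ) ε, HasDerivAt (fun t ↦ φ (w, t)) (F (φ (w, t))) t := by
  -- The symmetric interval makes negative times available by rescaling.
  set K := Icc (-1 : ℝ) 1
  let N : C(K, W) → C(K, W) := fun γ ↦ (⟨F, hF.continuous⟩ : C(W, W)).comp γ
  have hN : ContDiff ℝ ∞ N := contDiff_comp_continuousMap hF
  let c : W →L[ℝ] C(K, W) := ContinuousLinearMap.const ℝ K
  have hc : ∀ w s, c w s = w := fun w s ↦ rfl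
  -- With `p = ((w, t), γ)`, vanishing of the second component is the rescaled integral equation
  -- `γ(s) = w + t ∫₀ˢ F(γ)`, so that `γ(s)` is the solution at time `ts`. At `t = 0` the derivative
  -- is triangular with identity diagonal, hence invertible.
  let Φ : (W × ℝ) × C(K, W) → (W × ℝ) × C(K, W) :=
    fun p ↦ (p.1, p.2 - c p.1.1 - p.1.2 • primitiveCLM W (N p.2))
  have hΦ : ContDiff ℝ ∞ Φ := by
    refine contDiff_fst.prodMk ((contDiff_snd.sub
      (c.contDiff.comp (contDiff_fst.comp contDiff_fst))).sub ?_)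
    exact (contDiff_snd.comp contDiff_fst).smul
      ((primitiveCLM W).contDiff.comp (hN.comp contDiff_snd))
  let a : (W × ℝ) × C(K, W) := ((w₀, 0), c w₀)
  let B : (W × ℝ) →L[ℝ] C(K, W) := c.comp (ContinuousLinearMap.fst ℝ W ℝ) +
    (ContinuousLinearMap.snd ℝ W ℝ).smulRight (primitiveCLM W (N (c w₀)))
  let Φ' : ((W × ℝ) × C(K, W)) ≃L[ℝ] ((W × ℝ) × C(K, W)) :=
    ContinuousLinearEquiv.equivOfInverse
      ((ContinuousLinearMap.fst ℝ _ _).prod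
        (ContinuousLinearMap.snd ℝ _ _ - B.comp (ContinuousLinearMap.fst ℝ _ _)))
      ((ContinuousLinearMap.fst ℝ _ _).prod
        (ContinuousLinearMap.snd ℝ _ _ + B.comp (ContinuousLinearMap.fst ℝ _ _)))
      (fun p ↦ Prod.ext rfl (by simp)) (fun p ↦ Prod.ext rfl (by simp))
  have hΦ' : HasFDerivAt Φ (Φ' : ((W × ℝ) × C(K, W)) →L[ℝ] ((W × ℝ) × C(K, W))) a := by
    have h0 : HasFDerivAt (fun p : (W × ℝ) × C(K, W) ↦ N p.2)
        ((fderiv ℝ N (c w₀)).comp (ContinuousLinearMap.snd ℝ _ _)) a :=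
      HasFDerivAt.comp (g := N) (f := Prod.snd) a
        ((hN.differentiable (by simp)) (c w₀)).hasFDerivAt hasFDerivAt_snd
    have h1 : HasFDerivAt (fun p : (W × ℝ) × C(K, W) ↦ primitiveCLM W (N p.2))
        ((primitiveCLM W).comp ((fderiv ℝ N (c w₀)).comp (ContinuousLinearMap.snd ℝ _ _))) a :=
      HasFDerivAt.comp (g := primitiveCLM W) a (primitiveCLM W).hasFDerivAt h0
    have h2 : HasFDerivAt (fun p : (W × ℝ) × C(K, W) ↦ p.1.2)
        ((ContinuousLinearMap.snd ℝ _ _).comp (ContinuousLinearMap.fst ℝ _ _)) a :=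
      ((ContinuousLinearMap.snd ℝ W ℝ).comp
        (ContinuousLinearMap.fst ℝ (W × ℝ) C(K, W))).hasFDerivAt
    have h3 : HasFDerivAt (fun p : (W × ℝ) × C(K, W) ↦ c p.1.1)
        (c.comp ((ContinuousLinearMap.fst ℝ _ _).comp (ContinuousLinearMap.fst ℝ _ _))) a :=
      (c.comp ((ContinuousLinearMap.fst ℝ W ℝ).comp
        (ContinuousLinearMap.fst ℝ (W × ℝ) C(K, W)))).hasFDerivAt
    have h4 := hasFDerivAt_fst.prodMk ((hasFDerivAt_snd.sub h3).sub (h2.smul h1))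
    refine h4.congr_fderiv ?_
    refine ContinuousLinearMap.ext fun p ↦ Prod.ext rfl ?_
    simp [Φ', B, a, sub_sub]
  obtain ⟨e, hae, -, heΦ, hesymm⟩ := exists_openPartialHomeomorph_contDiffOn isOpen_univ
    hΦ.contDiffOn (mem_univ a) Φ' hΦ'
  have hea : e a = ((w₀, 0), 0) := by
    rw [heΦ]
    simp [Φ, a]
  have hta : ((w₀, (0 : ℝ)), (0 : C(K, W))) ∈ e.target := hea ▸ e.map_source hae
  have hsa : e.symm ((w₀, (0 : ℝ)), (0 : C(K, W))) = a := by rw [← hea, e.left_inv hae]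
  obtain ⟨δ, hδ, hδe⟩ := Metric.isOpen_iff.1 e.open_source a hae
  let ι : W × ℝ → (W × ℝ) × C(K, W) := fun q ↦ (q, 0)
  have hι : ContDiff ℝ ∞ ι := contDiff_id.prodMk contDiff_const
  have hnhds : ι ⁻¹' (e.target ∩ e.symm ⁻¹' Metric.ball a δ) ∈ 𝓝 (w₀, (0 : ℝ)) := by
    refine hι.continuous.continuousAt.preimage_mem_nhds
      ((e.isOpen_inter_preimage_symm Metric.isOpen_ball).mem_nhds ⟨hta, ?_⟩)
    rw [mem_preimage, hsa]
    exact Metric.mem_ball_self hδ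
  obtain ⟨ρ, hρ, hρe⟩ := Metric.mem_nhds_iff.1 hnhds
  let γ : W × ℝ → C(K, W) := fun q ↦ (e.symm (ι q)).2
  have hγ1 : ∀ q ∈ Metric.ball (w₀, (0 : ℝ)) ρ, e.symm (ι q) = (q, γ q) ∧
      γ q - c q.1 - q.2 • primitiveCLM W (N (γ q)) = 0 := by
    intro q hq
    have h1 : Φ (e.symm (ι q)) = ι q := by rw [← heΦ]; exact e.right_inv (hρe hq).1
    have h2 : (e.symm (ι q)).1 = q := congrArg Prod.fst h1
    refine ⟨Prod.ext h2 rfl, ?_⟩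
    have h3 := congrArg Prod.snd h1
    simp only [Φ, h2] at h3
    exact h3
  have hγeq : ∀ q ∈ Metric.ball (w₀, (0 : ℝ)) ρ, ∀ s : K,
      γ q s = q.1 + q.2 • ∫ r in (0 : ℝ)..s, F (γ q (projIcc (-1) 1 (by norm_num) r)) := by
    intro q hq s
    have h := congrArg (fun η : C(K, W) ↦ η s) (hγ1 q hq).2
    have h' : γ q s - q.1 - q.2 • (primitiveCLM W (N (γ q)) s) = 0 := h
    rw [sub_sub, sub_eq_zero] at h'
    exact h'
  have hγball : ∀ q ∈ Metric.ball (w₀, (0 : ℝ)) ρ, ∀ s : K, γ q s ∈ Metric.ball w₀ δ := by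
    intro q hq s
    have h1 : dist (γ q) (c w₀) < δ := by
      have := (hρe hq).2
      rw [mem_preimage, (hγ1 q hq).1] at this
      exact (le_max_right _ _).trans_lt this
    exact (ContinuousMap.dist_apply_le_dist s).trans_lt h1
  have hproj : ∀ s : ℝ, s ∈ Icc (-1 : ℝ) 1 →
      ((projIcc (-1 : ℝ) 1 (by norm_num) s : K) : ℝ) = s := fun s hs ↦ by
    rw [projIcc_of_mem _ hs]
  have hmulmem : ∀ σ ∈ Icc (-1 : ℝ) 1, ∀ s ∈ Icc (-1 : ℝ) 1, σ * s ∈ Icc (-1 : ℝ) 1 := by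
    intro σ hσ s hs
    rw [mem_Icc, ← abs_le] at hσ hs ⊢
    rw [abs_mul]
    exact mul_le_one₀ hσ (abs_nonneg _) hs
  -- The curve `s ↦ γ (w, ε) (σ s)` solves the integral equation for the parameter `σ ε`.
  -- Injectivity of `Φ` on `e.source` identifies it with `γ (w, σ ε)`; the bound by `δ` keeps it
  -- inside this source.
  have hscale : ∀ w ε, (w, ε) ∈ Metric.ball (w₀, (0 : ℝ)) (min ρ δ) → ∀ σ ∈ Icc (-1 : ℝ) 1,
      ∀ s : K, γ (w, σ * ε) s = γ (w, ε) (projIcc (-1) 1 (by norm_num) (σ * s)) := by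
    intro w ε hq σ hσ
    have hq' : (w, σ * ε) ∈ Metric.ball (w₀, (0 : ℝ)) (min ρ δ) := by
      rw [← ball_prod_same] at hq ⊢
      refine ⟨hq.1, ?_⟩
      have h2 := hq.2
      simp only [mem_ball_zero_iff, norm_mul] at h2 ⊢
      refine lt_of_le_of_lt ?_ h2
      exact mul_le_of_le_one_left (norm_nonneg _) (abs_le.2 hσ)
    have hqρ := Metric.ball_subset_ball (min_le_left ρ δ) hq
    have hqρ' := Metric.ball_subset_ball (min_le_left ρ δ) hq'
    let η : C(K, W) := ⟨fun s ↦ γ (w, ε) (projIcc (-1) 1 (by norm_num) (σ * s)),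
      (γ (w, ε)).continuous.comp ((continuous_projIcc (h := by norm_num)).comp (by fun_prop))⟩
    have hη : ((w, σ * ε), η) ∈ e.source := by
      apply hδe
      refine max_lt (lt_of_lt_of_le (Metric.mem_ball.1 hq') (min_le_right _ _)) ?_
      rw [ContinuousMap.dist_lt_iff hδ]
      exact fun s ↦ hγball _ hqρ _
    have hΦη : e ((w, σ * ε), η) = ι (w, σ * ε) := by
      rw [heΦ]
      refine Prod.ext rfl ?_
      ext s
      change η s - w - (σ * ε) • (∫ r in (0 : ℝ)..s,
        F (η (projIcc (-1) 1 (by norm_num) r))) = 0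
      have hI : ∫ r in (0 : ℝ)..s, F (η (projIcc (-1) 1 (by norm_num) r)) =
          ∫ r in (0 : ℝ)..s, F (γ (w, ε) (projIcc (-1) 1 (by norm_num) (σ * r))) := by
        refine intervalIntegral.integral_congr fun r hr ↦ ?_
        have hr' : r ∈ Icc (-1 : ℝ) 1 :=
          (uIcc_subset_Icc (by norm_num) s.2) hr
        change F (γ (w, ε) (projIcc (-1) 1 _ (σ * (projIcc (-1 : ℝ) 1 _ r : K)))) = _
        rw [hproj r hr']
      rw [hI, mul_comm σ ε, mul_smul, intervalIntegral.smul_integral_comp_mul_left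
        (fun r ↦ F (γ (w, ε) (projIcc (-1) 1 (by norm_num) r))) σ, mul_zero, sub_sub, sub_eq_zero]
      change γ (w, ε) (projIcc (-1) 1 _ (σ * s)) = _
      rw [hγeq _ hqρ, hproj _ (hmulmem σ hσ s s.2)]
    have h3 : e.symm (ι (w, σ * ε)) = ((w, σ * ε), η) := by rw [← hΦη, e.left_inv hη]
    intro s
    change (e.symm (ι (w, σ * ε))).2 s = _
    rw [h3]
    rfl
  let one : K := ⟨1, by norm_num, le_rfl⟩
  have hm : 0 < min ρ δ := lt_min hρ hδ
  -- The flow at time `t` is the curve with parameter `(w, t)` evaluated at `s = 1`. With half the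
  -- radius, `(w, min ρ δ / 2)` is still an admissible parameter, and by scaling its single curve
  -- carries all values of the flow from `w`. Time derivatives then follow from the fundamental
  -- theorem of calculus.
  refine ⟨fun q ↦ γ q one, min ρ δ / 2, by positivity, ?_, ?_⟩
  · have h1 : ContDiffOn ℝ ∞ (fun q ↦ e.symm (ι q)) (Metric.ball (w₀, (0 : ℝ)) (min ρ δ / 2)) := by
      refine hesymm.comp hι.contDiffOn fun q hq ↦ ?_
      exact (hρe (Metric.ball_subset_ball ((half_le_self hm.le).trans (min_le_left _ _)) hq)).1
    exact (ContinuousMap.evalCLM ℝ one).contDiff.comp_contDiffOn (contDiff_snd.comp_contDiffOn h1)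
  · intro w hw
    have hbase : ∀ ε, |ε| ≤ min ρ δ / 2 → (w, ε) ∈ Metric.ball (w₀, (0 : ℝ)) (min ρ δ) := by
      intro ε hε
      rw [← ball_prod_same]
      refine ⟨Metric.ball_subset_ball (half_le_self hm.le) hw, ?_⟩
      rw [mem_ball_zero_iff]
      exact lt_of_le_of_lt hε (half_lt_self hm)
    have hε₀ := hbase (min ρ δ / 2) (abs_of_pos (half_pos hm)).le
    have hε₀ρ := Metric.ball_subset_ball (min_le_left ρ δ) hε₀
    have h0 := hbase 0 (by rw [abs_zero]; positivity)
    refine ⟨?_, fun t ht ↦ ?_⟩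
    · have := hγeq _ (Metric.ball_subset_ball (min_le_left ρ δ) h0) one
      simpa using this
    set ε := min ρ δ / 2 with hε
    have hεpos : 0 < ε := half_pos hm
    have hφ : ∀ t ∈ Metric.ball (0 : ℝ) ε,
        γ (w, t) one = γ (w, ε) (projIcc (-1) 1 (by norm_num) (t / ε)) := by
      intro t ht
      have hσ : t / ε ∈ Icc (-1 : ℝ) 1 := by
        rw [mem_Icc, ← abs_le, abs_div, abs_of_pos hεpos, div_le_one hεpos]
        exact (mem_ball_zero_iff.1 ht).le
      have := hscale w ε hε₀ (t / ε) hσ one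
      rwa [div_mul_cancel₀ _ hεpos.ne', mul_one] at this
    let G : ℝ → W := fun r ↦ F (γ (w, ε) (projIcc (-1) 1 (by norm_num) r))
    have hG : Continuous G :=
      hF.continuous.comp ((γ (w, ε)).continuous.comp continuous_projIcc)
    have hφ' : (fun t ↦ γ (w, t) one) =ᶠ[𝓝 t]
        fun t ↦ w + ε • ∫ r in (0 : ℝ)..(t / ε), G r := by
      filter_upwards [Metric.isOpen_ball.mem_nhds ht] with t ht
      have hσ : t / ε ∈ Icc (-1 : ℝ) 1 := by
        rw [mem_Icc, ← abs_le, abs_div, abs_of_pos hεpos, div_le_one hεpos]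
        exact (mem_ball_zero_iff.1 ht).le
      rw [hφ t ht, hγeq _ hε₀ρ, hproj _ hσ]
    have hd : HasDerivAt (fun t ↦ w + ε • ∫ r in (0 : ℝ)..(t / ε), G r)
        (ε • ((1 / ε) • G (t / ε))) t := by
      have h1 : HasDerivAt (fun t : ℝ ↦ t / ε) (1 / ε) t := (hasDerivAt_id t).div_const ε
      have h2 := (hG.integral_hasStrictDerivAt 0 (t / ε)).hasDerivAt
      exact ((h2.scomp t h1).const_smul ε).const_add w
    have h3 := hd.congr_of_eventuallyEq hφ'
    rw [smul_smul, mul_one_div_cancel hεpos.ne', one_smul] at h3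
    change HasDerivAt _ (F (γ (w, t) one)) t
    rw [hφ t ht]
    exact h3

/-- A vector field which is smooth on an open set has a smooth local flow. -/
lemma exists_flow_of_contDiffOn [FiniteDimensional ℝ W] {F : W → W} {U : Set W} (hU : IsOpen U)
    (hF : ContDiffOn ℝ ∞ F U) {w₀ : W} (hw₀ : w₀ ∈ U) :
    ∃ φ : W × ℝ → W, ∃ ε > 0, ContDiffOn ℝ ∞ φ (Metric.ball (w₀, (0 : ℝ)) ε) ∧
      ∀ w ∈ Metric.ball w₀ ε, φ (w, 0) = w ∧ ∀ t ∈ Metric.ball (0 : ℝ) ε,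
        φ (w, t) ∈ U ∧ HasDerivAt (fun t ↦ φ (w, t)) (F (φ (w, t))) t := by
  obtain ⟨r, hr, hrU⟩ := Metric.nhds_basis_closedBall.mem_iff.1 (hU.mem_nhds hw₀)
  -- Multiplying by a cutoff supported in `U` makes the field globally smooth. It is unchanged on
  -- the ball of radius `r / 2`, where short trajectories remain.
  let χ : ContDiffBump w₀ := ⟨r / 2, r, half_pos hr, half_lt_self hr⟩
  have hχF : ContDiff ℝ ∞ (fun w ↦ χ w • F w) := by
    rw [contDiff_iff_contDiffAt]
    intro w
    by_cases hw : w ∈ U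
    · exact χ.contDiff.contDiffAt.smul (hF.contDiffAt (hU.mem_nhds hw))
    · have hw' : w ∉ Metric.closedBall w₀ r := fun h ↦ hw (hrU h)
      refine (contDiffAt_const (c := (0 : W))).congr_of_eventuallyEq ?_
      filter_upwards [Metric.isClosed_closedBall.isOpen_compl.mem_nhds hw'] with x hx
      rw [χ.zero_of_le_dist (not_le.1 fun h ↦ hx h).le, zero_smul]
  obtain ⟨φ, ε, hε, hφ, hφ'⟩ := exists_flow_of_contDiff hχF w₀
  have hc : ContinuousAt φ (w₀, 0) :=
    (hφ.contDiffAt (Metric.ball_mem_nhds _ hε)).continuousAt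
  have h0 : φ (w₀, 0) = w₀ := (hφ' w₀ (Metric.mem_ball_self hε)).1
  obtain ⟨ε', hε', h'⟩ := Metric.mem_nhds_iff.1 (hc.preimage_mem_nhds
    (h0.symm ▸ Metric.closedBall_mem_nhds w₀ (half_pos hr)))
  refine ⟨φ, min ε ε', lt_min hε hε',
    hφ.mono (Metric.ball_subset_ball (min_le_left _ _)), fun w hw ↦ ?_⟩
  obtain ⟨h1, h2⟩ := hφ' w (Metric.ball_subset_ball (min_le_left _ _) hw)
  refine ⟨h1, fun t ht ↦ ?_⟩
  have h3 : φ (w, t) ∈ Metric.closedBall w₀ (r / 2) := by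
    have h5 : (w, t) ∈ Metric.ball (w₀, (0 : ℝ)) ε' := by
      rw [← ball_prod_same]
      exact ⟨Metric.ball_subset_ball (min_le_right _ _) hw,
        Metric.ball_subset_ball (min_le_right _ _) ht⟩
    have h6 := h' h5
    rwa [mem_preimage, h0] at h6
  refine ⟨hrU (Metric.closedBall_subset_closedBall (half_le_self hr.le) h3), ?_⟩
  have h4 := h2 t (Metric.ball_subset_ball (min_le_left _ _) ht)
  rwa [χ.one_of_mem_closedBall h3, one_smul] at h4

end Flow

/-! ### Conservation laws along characteristics -/

section Characteristics

variable {E : Type*} [NormedAddCommGroup E] [NormedSpace ℝ E]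

/-- The Hamiltonian vector field of `(x, ξ) ↦ ½ ξ(K(x) ξ)`, for a cometric `K`. -/
noncomputable def hamiltonianField (K : E → (E →L[ℝ] ℝ) →L[ℝ] E) (q : E × (E →L[ℝ] ℝ)) :
    E × (E →L[ℝ] ℝ) :=
  (K q.1 q.2, -(1 / 2 : ℝ) • q.2.comp ((fderiv ℝ K q.1).flip q.2))

lemma contDiffOn_hamiltonianField {K : E → (E →L[ℝ] ℝ) →L[ℝ] E} {U : Set E} (hU : IsOpen U)
    (hK : ContDiffOn ℝ ∞ K U) : ContDiffOn ℝ ∞ (hamiltonianField K) (U ×ˢ univ) := by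
  have h1 : ContDiffOn ℝ ∞ (fun q : E × (E →L[ℝ] ℝ) ↦ K q.1) (U ×ˢ univ) :=
    hK.comp contDiffOn_fst fun q hq ↦ hq.1
  have hflip : ContDiff ℝ ∞ (fun L : E →L[ℝ] (E →L[ℝ] ℝ) →L[ℝ] E ↦ L.flip) :=
    (ContinuousLinearMap.flipₗᵢ ℝ E (E →L[ℝ] ℝ) E).contDiff
  have h2 : ContDiffOn ℝ ∞ (fun x ↦ (fderiv ℝ K x).flip) U :=
    hflip.comp_contDiffOn (hK.fderiv_of_isOpen hU (m := ∞) (by simp))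
  have h3 : ContDiffOn ℝ ∞ (fun q : E × (E →L[ℝ] ℝ) ↦ (fderiv ℝ K q.1).flip) (U ×ˢ univ) :=
    h2.comp contDiffOn_fst fun q hq ↦ hq.1
  have h4 : ContDiffOn ℝ ∞ (fun q : E × (E →L[ℝ] ℝ) ↦ (fderiv ℝ K q.1).flip q.2) (U ×ˢ univ) :=
    h3.clm_apply contDiffOn_snd
  have h5 : ContDiffOn ℝ ∞ (fun q : E × (E →L[ℝ] ℝ) ↦
      q.2.comp ((fderiv ℝ K q.1).flip q.2)) (U ×ˢ univ) := contDiffOn_snd.clm_comp h4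
  exact (h1.clm_apply contDiffOn_snd).prodMk (h5.const_smul _)

lemma eq_of_hasDerivAt_zero {f : ℝ → ℝ} {a b : ℝ} (hf : ∀ t ∈ uIcc a b, HasDerivAt f 0 t) :
    f b = f a := by
  have h := (convex_uIcc a b).norm_image_sub_le_of_norm_hasDerivWithin_le (C := 0)
    (fun t ht ↦ (hf t ht).hasDerivWithinAt) (fun t _ ↦ norm_zero.le) left_mem_uIcc right_mem_uIcc
  rwa [zero_mul, norm_le_zero_iff, sub_eq_zero] at h

variable {K : E → (E →L[ℝ] ℝ) →L[ℝ] E} {U D : Set E} {X : E → E} {P : E → E →L[ℝ] ℝ}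
  {ℓ : E →L[ℝ] ℝ} {e : E}

/-- The Hamiltonian is constant along characteristics. -/
lemma hamiltonian_eq_one_of_characteristic (hU : IsOpen U) (hK : DifferentiableOn ℝ K U)
    (hsymm : ∀ x ∈ U, ∀ ξ η : E →L[ℝ] ℝ, η (K x ξ) = ξ (K x η))
    (hD : IsOpen D) (hX : DifferentiableOn ℝ X D) (hP : DifferentiableOn ℝ P D)
    (hXU : MapsTo X D U) (hℓ : ℓ e = 1)
    (hXe : ∀ z ∈ D, fderiv ℝ X z e = (hamiltonianField K (X z, P z)).1)
    (hPe : ∀ z ∈ D, fderiv ℝ P z e = (hamiltonianField K (X z, P z)).2)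
    (hline : ∀ z ∈ D, ∀ t ∈ uIcc 0 (ℓ z), z + (t - ℓ z) • e ∈ D)
    (h0 : ∀ z ∈ D, ℓ z = 0 → P z (K (X z) (P z)) = 1) :
    ∀ z ∈ D, P z (K (X z) (P z)) = 1 := by
  intro z hz
  -- Parameters `z` split along `ker ℓ ⊕ ℝ e`: `ℓ z` is the time, and the component in `ker ℓ`
  -- labels the characteristic. Thus `c` runs through the parameters of the characteristic of `z`,
  -- with `c (ℓ z) = z`.
  let c : ℝ → E := fun t ↦ z + (t - ℓ z) • e
  have hc : ∀ t, HasDerivAt c e t := fun t ↦ by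
    simpa [c] using (((hasDerivAt_id t).sub_const (ℓ z)).smul_const e).const_add z
  have key := eq_of_hasDerivAt_zero (f := fun t ↦ P (c t) (K (X (c t)) (P (c t)))) (a := 0)
    (b := ℓ z) fun t ht ↦ by
      have hz' := hline z hz t ht
      have hx : HasDerivAt (fun t ↦ X (c t)) (K (X (c t)) (P (c t))) t := by
        have := ((hX.differentiableAt (hD.mem_nhds hz')).hasFDerivAt).comp_hasDerivAt t (hc t)
        rwa [hXe _ hz'] at this
      have hp : HasDerivAt (fun t ↦ P (c t)) (hamiltonianField K (X (c t), P (c t))).2 t := by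
        have := ((hP.differentiableAt (hD.mem_nhds hz')).hasFDerivAt).comp_hasDerivAt t (hc t)
        rwa [hPe _ hz'] at this
      have hk : HasDerivAt (fun t ↦ K (X (c t)))
          (fderiv ℝ K (X (c t)) (K (X (c t)) (P (c t)))) t :=
        HasFDerivAt.comp_hasDerivAt (l := K) (l' := fderiv ℝ K (X (c t))) t
          (hK.differentiableAt (hU.mem_nhds (hXU hz'))).hasFDerivAt hx
      refine (hp.clm_apply (hk.clm_apply hp)).congr_deriv ?_
      rw [map_add, hsymm _ (hXU hz') (hamiltonianField K (X (c t), P (c t))).2]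
      simp [hamiltonianField]
      ring
  have hcz : c (ℓ z) = z := by simp [c]
  have hc0 : ℓ (c 0) = 0 := by simp [c, hℓ]
  rw [hcz] at key
  rw [key]
  exact h0 _ (hline z hz 0 left_mem_uIcc) hc0

/-- Along characteristics, the momentum is the differential of the arrival time. -/
lemma momentum_comp_fderiv_eq (hU : IsOpen U) (hK : DifferentiableOn ℝ K U)
    (hsymm : ∀ x ∈ U, ∀ ξ η : E →L[ℝ] ℝ, η (K x ξ) = ξ (K x η))
    (hD : IsOpen D) (hX : ContDiffOn ℝ ∞ X D) (hP : DifferentiableOn ℝ P D)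
    (hXU : MapsTo X D U) (hℓ : ℓ e = 1)
    (hXe : ∀ z ∈ D, fderiv ℝ X z e = (hamiltonianField K (X z, P z)).1)
    (hPe : ∀ z ∈ D, fderiv ℝ P z e = (hamiltonianField K (X z, P z)).2)
    (hline : ∀ z ∈ D, ∀ t ∈ uIcc 0 (ℓ z), z + (t - ℓ z) • e ∈ D)
    (hH : ∀ z ∈ D, P z (K (X z) (P z)) = 1)
    (h0 : ∀ z ∈ D, ℓ z = 0 → ∀ h, ℓ h = 0 → P z (fderiv ℝ X z h) = 0) :
    ∀ z ∈ D, (P z).comp (fderiv ℝ X z) = ℓ := by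
  have hXd : DifferentiableOn ℝ X D := hX.differentiableOn (by simp)
  have hker : ∀ z ∈ D, ∀ h, ℓ h = 0 → P z (fderiv ℝ X z h) = 0 := by
    intro z hz h hh
    let c : ℝ → E := fun t ↦ z + (t - ℓ z) • e
    have hc : ∀ t, HasDerivAt c e t := fun t ↦ by
      simpa [c] using (((hasDerivAt_id t).sub_const (ℓ z)).smul_const e).const_add z
    -- By Hamilton's equations and the symmetry of second derivatives, the time derivative of `P(dX
    -- h)` equals the derivative of `½ P(K P)` in the direction `h`. The latter vanishes because the
    -- Hamiltonian is constant by `hH`.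
    have key := eq_of_hasDerivAt_zero (f := fun t ↦ P (c t) (fderiv ℝ X (c t) h)) (a := 0)
      (b := ℓ z) fun t ht ↦ by
        have hz' : c t ∈ D := hline z hz t ht
        have hn := hD.mem_nhds hz'
        have hXf := (hXd.differentiableAt hn).hasFDerivAt
        have hPf := (hP.differentiableAt hn).hasFDerivAt
        have hKf := HasFDerivAt.comp (g := K) (g' := fderiv ℝ K (X (c t))) (c t)
          (hK.differentiableAt (hU.mem_nhds (hXU hz'))).hasFDerivAt hXf
        have hp : HasDerivAt (fun t ↦ P (c t)) (hamiltonianField K (X (c t), P (c t))).2 t := by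
          have := hPf.comp_hasDerivAt t (hc t)
          rwa [hPe _ hz'] at this
        have hX2 : HasFDerivAt (fderiv ℝ X) (fderiv ℝ (fderiv ℝ X) (c t)) (c t) :=
          (((hX.fderiv_of_isOpen hD (m := ∞) (by simp)).differentiableOn
            (by simp)).differentiableAt hn).hasFDerivAt
        have hx : HasDerivAt (fun t ↦ fderiv ℝ X (c t) h)
            (fderiv ℝ (fderiv ℝ X) (c t) e h) t := by
          simpa using (hX2.comp_hasDerivAt t (hc t)).clm_apply (hasDerivAt_const t h)
        have hsm : fderiv ℝ (fderiv ℝ X) (c t) e h = fderiv ℝ (fderiv ℝ X) (c t) h e :=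
          ((hX.contDiffAt hn).isSymmSndFDerivAt (by
            rw [minSmoothness_of_isRCLikeNormedField]
            exact WithTop.coe_le_coe.2 (le_top : (2 : ℕ∞) ≤ ⊤))) e h
        have hd1 := (hKf.clm_apply hPf).congr_of_eventuallyEq
          (Filter.eventuallyEq_of_mem hn fun y hy ↦ hXe y hy)
        have hd2 := hd1.unique (hX2.clm_apply (hasFDerivAt_const e (c t)))
        have hd3 := congrArg (fun L : E →L[ℝ] E ↦ L h) hd2
        have hd4 := ((hPf.clm_apply (hKf.clm_apply hPf)).congr_of_eventuallyEq
          (Filter.eventuallyEq_of_mem (f := fun _ ↦ (1 : ℝ)) hn fun y hy ↦ (hH y hy).symm)).unique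
          (hasFDerivAt_const (1 : ℝ) (c t))
        have hd5 := congrArg (fun L : E →L[ℝ] ℝ ↦ L h) hd4
        simp only [add_apply, ContinuousLinearMap.comp_apply,
          ContinuousLinearMap.flip_apply, Function.comp_apply, zero_apply,
          map_zero, zero_add, map_add] at hd3 hd5
        rw [hsymm _ (hXU hz') (P (c t)) (fderiv ℝ P (c t) h)] at hd5
        refine (hp.clm_apply hx).congr_deriv ?_
        rw [hsm, ← hd3]
        simp [hamiltonianField]
        linarith
    have hcz : c (ℓ z) = z := by simp [c]
    have hc0 : ℓ (c 0) = 0 := by simp [c, hℓ]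
    rw [hcz] at key
    rw [key]
    exact h0 _ (hline z hz 0 left_mem_uIcc) hc0 h hh
  intro z hz
  ext h
  -- It remains to compare both sides on `e`, where `dX e = K P` and the Hamiltonian is one.
  have h1 := hker z hz (h - ℓ h • e) (by simp [hℓ])
  have h2 : P z (fderiv ℝ X z e) = 1 := by rw [hXe z hz]; exact hH z hz
  rw [map_sub, map_sub, map_smul, map_smul, h2, smul_eq_mul, mul_one, sub_eq_zero] at h1
  exact h1

end Characteristics

/-! ### The eikonal equation in coordinates -/

section Eikonal

variable {E : Type*} [NormedAddCommGroup E] [NormedSpace ℝ E] [FiniteDimensional ℝ E]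

/-- Local solution of the eikonal equation `dV(K dV) = 1` with `V = 0` on a noncharacteristic
hypersurface `{f = 0}`, together with its characteristics. -/
theorem exists_eikonal {K : E → (E →L[ℝ] ℝ) →L[ℝ] E} {U : Set E} (hU : IsOpen U)
    (hK : ContDiffOn ℝ ∞ K U)
    (hsymm : ∀ x ∈ U, ∀ ξ η : E →L[ℝ] ℝ, η (K x ξ) = ξ (K x η))
    {f : E → ℝ} (hf : ContDiffOn ℝ ∞ f U) {p : E} (hp : p ∈ U) (hfp : f p = 0)
    (hpos : 0 < fderiv ℝ f p (K p (fderiv ℝ f p))) :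
    ∃ (V : E → ℝ) (N : Set E), IsOpen N ∧ p ∈ N ∧ N ⊆ U ∧ ContDiffOn ℝ ∞ V N ∧
      ∀ x ∈ N, fderiv ℝ V x (K x (fderiv ℝ V x)) = 1 ∧ (V x < 0 ↔ f x < 0) ∧
        (V x = 0 ↔ f x = 0) ∧ ∃ c : ℝ → E, c (V x) = x ∧ V (c 0) = 0 ∧
          ∀ t ∈ uIcc 0 (V x), c t ∈ N ∧ ContDiffAt ℝ ∞ c t ∧
            HasDerivAt c (K (c t) (fderiv ℝ V (c t))) t := by
  -- straightening the hypersurface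
  set ℓ : E →L[ℝ] ℝ := fderiv ℝ f p with hℓdef
  set e : E := (ℓ (K p ℓ))⁻¹ • K p ℓ with hedef
  have hℓe : ℓ e = 1 := by
    rw [hedef, map_smul, smul_eq_mul, inv_mul_cancel₀ hpos.ne']
  -- The correction along `e` is chosen so that `ℓ ∘ G = f` while the derivative of `G` at `p` is
  -- the identity. Hence `G` flattens `{f = 0}` to `ker ℓ`.
  let G : E → E := fun y ↦ (y - p) + (f y - ℓ (y - p)) • e
  have hG : ContDiffOn ℝ ∞ G U :=
    (contDiffOn_id.sub contDiffOn_const).add ((hf.sub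
      (ℓ.contDiff.comp_contDiffOn (contDiffOn_id.sub contDiffOn_const))).smul contDiffOn_const)
  have hdf : ∀ x ∈ U, HasFDerivAt f (fderiv ℝ f x) x := fun x hx ↦
    ((hf.differentiableOn (by simp)).differentiableAt (hU.mem_nhds hx)).hasFDerivAt
  have hGp : HasFDerivAt G ((ContinuousLinearEquiv.refl ℝ E : E ≃L[ℝ] E) : E →L[ℝ] E) p := by
    have h1 : HasFDerivAt (fun y : E ↦ y - p) (ContinuousLinearMap.id ℝ E) p :=
      (hasFDerivAt_id p).sub_const p
    have h2 : HasFDerivAt (fun y : E ↦ ℓ (y - p)) ℓ p := ℓ.hasFDerivAt.comp p h1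
    refine (h1.add (((hdf p hp).sub h2).smul_const e)).congr_fderiv ?_
    ext v
    simp [hℓdef]
  have hG0 : G p = 0 := by simp [G, hfp]
  have hℓG : ∀ y, ℓ (G y) = f y := fun y ↦ by simp [G, hℓe]
  obtain ⟨eG, hpG, hGU, hGe, hS⟩ := exists_openPartialHomeomorph_contDiffOn hU hG hp _ hGp
  have hSU : ∀ b ∈ eG.target, eG.symm b ∈ U := fun b hb ↦ hGU (eG.map_target hb)
  have hGS : ∀ b ∈ eG.target, G (eG.symm b) = b := fun b hb ↦ by rw [← hGe, eG.right_inv hb]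
  have hfS : ∀ b ∈ eG.target, f (eG.symm b) = ℓ b := fun b hb ↦ by rw [← hℓG, hGS b hb]
  have h0t : (0 : E) ∈ eG.target := by rw [← hG0, ← hGe]; exact eG.map_source hpG
  have hS0 : eG.symm 0 = p := by rw [← hG0, ← hGe, eG.left_inv hpG]
  -- the unit conormal
  have hdfs : ContDiffOn ℝ ∞ (fderiv ℝ f) U := hf.fderiv_of_isOpen hU (m := ∞) (by simp)
  let q : E → ℝ := fun x ↦ fderiv ℝ f x (K x (fderiv ℝ f x))
  have hq : ContDiffOn ℝ ∞ q U := hdfs.clm_apply (hK.clm_apply hdfs)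
  let U₁ : Set E := U ∩ q ⁻¹' Ioi 0
  have hU₁ : IsOpen U₁ := hq.continuousOn.isOpen_inter_preimage hU isOpen_Ioi
  let ξ : E → E →L[ℝ] ℝ := fun x ↦ (√(q x))⁻¹ • fderiv ℝ f x
  have hξ : ContDiffOn ℝ ∞ ξ U₁ := by
    have h1 : ContDiffOn ℝ ∞ (fun x ↦ √(q x)) U₁ :=
      (hq.mono inter_subset_left).sqrt fun x hx ↦ (ne_of_gt hx.2)
    exact (h1.inv fun x hx ↦ (Real.sqrt_pos.2 hx.2).ne').smul (hdfs.mono inter_subset_left)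
  have hξ1 : ∀ x ∈ U₁, ξ x (K x (ξ x)) = 1 := by
    intro x hx
    have hx' : 0 < q x := hx.2
    have h2 : ξ x (K x (ξ x)) = (√(q x))⁻¹ * ((√(q x))⁻¹ * q x) := by simp [ξ, q]
    rw [h2, ← mul_assoc, ← mul_inv, Real.mul_self_sqrt hx'.le, inv_mul_cancel₀ hx'.ne']
  -- the flow of the Hamiltonian field
  obtain ⟨φ, ε, hε, hφ, hφ'⟩ := exists_flow_of_contDiffOn (hU.prod isOpen_univ)
    (contDiffOn_hamiltonianField hU hK) (w₀ := (p, ξ p)) ⟨hp, mem_univ _⟩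
  -- Projection onto `ker ℓ` along `e`.
  let pr : E →L[ℝ] E := ContinuousLinearMap.id ℝ E - ℓ.smulRight e
  have hpr : ∀ z, pr z = z - ℓ z • e := fun z ↦ rfl
  let T : Set E := eG.target ∩ eG.symm ⁻¹' U₁
  have hT : IsOpen T := eG.isOpen_inter_preimage_symm hU₁
  let w : E → E × (E →L[ℝ] ℝ) := fun b ↦ (eG.symm b, ξ (eG.symm b))
  have hw : ContDiffOn ℝ ∞ w T :=
    (hS.mono inter_subset_left).prodMk (hξ.comp (hS.mono inter_subset_left) fun b hb ↦ hb.2)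
  let T' : Set E := T ∩ w ⁻¹' Metric.ball (p, ξ p) ε
  have hT' : IsOpen T' := hw.continuousOn.isOpen_inter_preimage hT Metric.isOpen_ball
  let D : Set E := pr ⁻¹' T' ∩ ℓ ⁻¹' Metric.ball 0 ε
  have hD : IsOpen D := (hT'.preimage pr.continuous).inter (Metric.isOpen_ball.preimage ℓ.continuous)
  have hpre : ∀ z (s : ℝ), pr (z + s • e) = pr z := fun z s ↦ by
    simp only [hpr, map_add, map_smul, hℓe, smul_eq_mul, mul_one, add_smul]
    abel
  have hℓse : ∀ z (s : ℝ), ℓ (z + s • e) = ℓ z + s := fun z s ↦ by simp [hℓe]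
  have hline : ∀ z ∈ D, ∀ t ∈ uIcc 0 (ℓ z), z + (t - ℓ z) • e ∈ D := by
    intro z hz t ht
    refine ⟨by rw [mem_preimage, hpre]; exact hz.1, ?_⟩
    rw [mem_preimage, hℓse, add_sub_cancel]
    have h1 := hz.2
    rw [mem_preimage, mem_ball_zero_iff] at h1
    rw [mem_ball_zero_iff]
    refine lt_of_le_of_lt ?_ h1
    have := abs_sub_left_of_mem_uIcc ht
    simpa using this
  -- Position and momentum at time `ℓ z` of the characteristic that starts, with the unit conormal
  -- as momentum, at the hypersurface point labelled by `pr z`.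
  let Z : E → E × (E →L[ℝ] ℝ) := fun z ↦ φ (w (pr z), ℓ z)
  have hZ : ContDiffOn ℝ ∞ Z D := by
    refine hφ.comp ((hw.comp pr.contDiff.contDiffOn fun z hz ↦ hz.1.1).prodMk
      ℓ.contDiff.contDiffOn) fun z hz ↦ ?_
    rw [← ball_prod_same]
    exact ⟨hz.1.2, hz.2⟩
  let X : E → E := fun z ↦ (Z z).1
  let P : E → E →L[ℝ] ℝ := fun z ↦ (Z z).2
  have hX : ContDiffOn ℝ ∞ X D := contDiff_fst.comp_contDiffOn hZ
  have hP : ContDiffOn ℝ ∞ P D := contDiff_snd.comp_contDiffOn hZ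
  have hXU : MapsTo X D U := fun z hz ↦ ((hφ' _ hz.1.2).2 _ hz.2).1.1
  have hXd : ∀ z ∈ D, HasFDerivAt X (fderiv ℝ X z) z := fun z hz ↦
    ((hX.differentiableOn (by simp)).differentiableAt (hD.mem_nhds hz)).hasFDerivAt
  have hPd : ∀ z ∈ D, HasFDerivAt P (fderiv ℝ P z) z := fun z hz ↦
    ((hP.differentiableOn (by simp)).differentiableAt (hD.mem_nhds hz)).hasFDerivAt
  have hmove : ∀ z v : E, HasDerivAt (fun s : ℝ ↦ z + s • v) v 0 := fun z v ↦ by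
    simpa using ((hasDerivAt_id (0 : ℝ)).smul_const v).const_add z
  have hZe : ∀ z ∈ D, HasDerivAt (fun s : ℝ ↦ Z (z + s • e)) (hamiltonianField K (X z, P z)) 0 := by
    intro z hz
    have h1 : HasDerivAt (fun t ↦ φ (w (pr z), t)) (hamiltonianField K (X z, P z)) (ℓ z + 0) := by
      rw [add_zero]
      exact ((hφ' _ hz.1.2).2 _ hz.2).2
    have h2 := HasDerivAt.comp_const_add (ℓ z) 0 h1
    simp only [Z, hpre, hℓse]
    exact h2
  have hXe : ∀ z ∈ D, fderiv ℝ X z e = (hamiltonianField K (X z, P z)).1 := by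
    intro z hz
    have h1 : HasFDerivAt X (fderiv ℝ X z) (z + (0 : ℝ) • e) := by simpa using hXd z hz
    exact (h1.comp_hasDerivAt (0 : ℝ) (hmove z e)).unique
      (HasFDerivAt.comp_hasDerivAt (l := Prod.fst) (0 : ℝ) hasFDerivAt_fst (hZe z hz))
  have hPe : ∀ z ∈ D, fderiv ℝ P z e = (hamiltonianField K (X z, P z)).2 := by
    intro z hz
    have h1 : HasFDerivAt P (fderiv ℝ P z) (z + (0 : ℝ) • e) := by simpa using hPd z hz
    exact (h1.comp_hasDerivAt (0 : ℝ) (hmove z e)).unique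
      (HasFDerivAt.comp_hasDerivAt (l := Prod.snd) (0 : ℝ) hasFDerivAt_snd (hZe z hz))
  have hbase : ∀ z ∈ D, ℓ z = 0 → Z z = w z ∧ z ∈ T := by
    intro z hz h0
    have hprz : pr z = z := by rw [hpr, h0, zero_smul, sub_zero]
    have h1 := (hφ' _ hz.1.2).1
    refine ⟨?_, ?_⟩
    · simp only [Z, h0]
      rw [h1, hprz]
    · have := hz.1.1
      rwa [hprz] at this
  have hH := hamiltonian_eq_one_of_characteristic hU (hK.differentiableOn (by simp)) hsymm hD
    (hX.differentiableOn (by simp)) (hP.differentiableOn (by simp)) hXU hℓe hXe hPe hline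
    (fun z hz h0 ↦ by
      obtain ⟨h1, h2⟩ := hbase z hz h0
      simp only [X, P, h1]
      exact hξ1 _ h2.2)
  have hfX : ∀ z ∈ D, ∀ h, ℓ z = 0 → ℓ h = 0 → ∀ᶠ s : ℝ in 𝓝 0,
      Z (z + s • h) = w (z + s • h) ∧ z + s • h ∈ T := by
    intro z hz h h0 hh
    have hc : ContinuousAt (fun s : ℝ ↦ z + s • h) 0 := by fun_prop
    have hz' : z + (0 : ℝ) • h ∈ D := by simpa using hz
    filter_upwards [hc.preimage_mem_nhds (hD.mem_nhds hz')] with s hs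
    exact hbase _ hs (by simp [h0, hh])
  -- Initial condition for the momentum identity: `f ∘ X` vanishes on `ker ℓ`, and at time zero `P`
  -- is a multiple of `df`, so `P` annihilates `dX h` for `h` in `ker ℓ`.
  have hmom := momentum_comp_fderiv_eq hU (hK.differentiableOn (by simp)) hsymm hD hX
    (hP.differentiableOn (by simp)) hXU hℓe hXe hPe hline hH
    (fun z hz h0 h hh ↦ by
      have h1 : HasFDerivAt X (fderiv ℝ X z) (z + (0 : ℝ) • h) := by simpa using hXd z hz
      have h2 : HasFDerivAt f (fderiv ℝ f (X z)) (X (z + (0 : ℝ) • h)) := by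
        simpa using hdf _ (hXU hz)
      have h3 := h2.comp_hasDerivAt (0 : ℝ) (h1.comp_hasDerivAt (0 : ℝ) (hmove z h))
      have h4 : (fun s : ℝ ↦ f (X (z + s • h))) =ᶠ[𝓝 0] fun _ ↦ 0 := by
        filter_upwards [hfX z hz h h0 hh] with s hs
        simp only [X, hs.1]
        change f (eG.symm _) = 0
        rw [hfS _ hs.2.1]
        simp [h0, hh]
      have h5 := h3.unique ((hasDerivAt_const (0 : ℝ) (0 : ℝ)).congr_of_eventuallyEq h4)
      obtain ⟨h6, h7⟩ := hbase z hz h0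
      have h8 : P z = (√(q (X z)))⁻¹ • fderiv ℝ f (X z) := by simp only [X, P, h6]; rfl
      rw [h8, smul_apply, h5, smul_zero])
  -- invertibility of the characteristic map
  have hpU₁ : p ∈ U₁ := ⟨hp, hpos⟩
  have h0T : (0 : E) ∈ T := ⟨h0t, by rw [mem_preimage, hS0]; exact hpU₁⟩
  have hw0 : w 0 = (p, ξ p) := by simp only [w, hS0]
  have h0D : (0 : E) ∈ D := by
    refine ⟨?_, ?_⟩
    · rw [mem_preimage, map_zero]
      refine ⟨h0T, ?_⟩
      rw [mem_preimage, hw0]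
      exact Metric.mem_ball_self hε
    · rw [mem_preimage, map_zero]
      exact Metric.mem_ball_self hε
  have hZ0 : Z 0 = (p, ξ p) := by rw [(hbase 0 h0D (map_zero ℓ)).1, hw0]
  have hX0 : X 0 = p := by simp only [X, hZ0]
  have hP0 : P 0 = ξ p := by simp only [P, hZ0]
  -- A vector killed by `dX` lies in `ker ℓ` by the momentum identity. There `G ∘ X` is the
  -- identity, so the vector is zero.
  have hinj : Function.Injective (fderiv ℝ X 0 : E →ₗ[ℝ] E) := by
    rw [injective_iff_map_eq_zero]
    intro h hh
    have hh' : fderiv ℝ X 0 h = 0 := hh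
    have hℓh : ℓ h = 0 := by rw [← hmom 0 h0D, ContinuousLinearMap.comp_apply, hh', map_zero]
    have h1 : HasFDerivAt X (fderiv ℝ X 0) ((0 : E) + (0 : ℝ) • h) := by simpa using hXd 0 h0D
    have h2 : HasFDerivAt G ((ContinuousLinearEquiv.refl ℝ E : E ≃L[ℝ] E) : E →L[ℝ] E)
        (X ((0 : E) + (0 : ℝ) • h)) := by simpa [hX0] using hGp
    have h3 := h2.comp_hasDerivAt (0 : ℝ) (h1.comp_hasDerivAt (0 : ℝ) (hmove 0 h))
    have h4 : (fun s : ℝ ↦ G (X (0 + s • h))) =ᶠ[𝓝 0] fun s ↦ 0 + s • h := by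
      filter_upwards [hfX 0 h0D h (map_zero ℓ) hℓh] with s hs
      simp only [X, hs.1]
      exact hGS _ hs.2.1
    have h5 := h3.unique ((hmove 0 h).congr_of_eventuallyEq h4)
    rw [hh'] at h5
    simpa using h5.symm
  let L : E ≃L[ℝ] E := (LinearEquiv.ofInjectiveEndo _ hinj).toContinuousLinearEquiv
  have hL : HasFDerivAt X (L : E →L[ℝ] E) 0 := (hXd 0 h0D).congr_fderiv (by ext v; rfl)
  -- On this set `df` is positive on the velocity `K P`, so `f` increases along characteristics.
  -- This is used below to match the signs of `V` and `f`.
  let D' : Set E := D ∩ (fun z ↦ fderiv ℝ f (X z) (K (X z) (P z))) ⁻¹' Ioi 0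
  have hD' : IsOpen D' := by
    refine ContinuousOn.isOpen_inter_preimage ?_ hD isOpen_Ioi
    exact (hdfs.continuousOn.comp hX.continuousOn hXU).clm_apply
      ((hK.continuousOn.comp hX.continuousOn hXU).clm_apply hP.continuousOn)
  have h0D' : (0 : E) ∈ D' := by
    refine ⟨h0D, ?_⟩
    have h1 : fderiv ℝ f (X 0) (K (X 0) (P 0)) = (√(q p))⁻¹ * q p := by
      rw [hX0, hP0]
      simp [ξ, q]
    rw [mem_preimage, mem_Ioi, h1]
    exact mul_pos (inv_pos.2 (Real.sqrt_pos.2 hpos)) hpos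
  obtain ⟨eX, h0X, hXD', hXcoe, hXs⟩ := exists_openPartialHomeomorph_contDiffOn hD'
    (hX.mono inter_subset_left) h0D' L hL
  -- a box adapted to the characteristics
  obtain ⟨r, hr, hrX⟩ : ∃ r > 0, ∀ z, pr z ∈ Metric.ball (0 : E) r → ℓ z ∈ Metric.ball (0 : ℝ) r →
      z ∈ eX.source := by
    have hc : ContinuousAt (fun b : E × ℝ ↦ b.1 + b.2 • e) (0, 0) := by fun_prop
    have h1 : (0 : E) + (0 : ℝ) • e ∈ eX.source := by simpa using h0X
    obtain ⟨r, hr, h2⟩ := Metric.mem_nhds_iff.1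
      (hc.preimage_mem_nhds (eX.open_source.mem_nhds h1))
    refine ⟨r, hr, fun z hz1 hz2 ↦ ?_⟩
    have h3 : (pr z, ℓ z) ∈ Metric.ball ((0 : E), (0 : ℝ)) r := by
      rw [← ball_prod_same]
      exact ⟨hz1, hz2⟩
    have h4 := h2 h3
    simp only [mem_preimage, hpr, sub_add_cancel] at h4
    exact h4
  -- The box is stable under moving the time coordinate towards zero, so characteristics traced back
  -- to the hypersurface stay in the domain.
  let C : Set E := pr ⁻¹' Metric.ball 0 r ∩ ℓ ⁻¹' Metric.ball 0 r
  have hC : IsOpen C :=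
    (Metric.isOpen_ball.preimage pr.continuous).inter (Metric.isOpen_ball.preimage ℓ.continuous)
  have hCX : C ⊆ eX.source := fun z hz ↦ hrX z hz.1 hz.2
  have hCline : ∀ z ∈ C, ∀ t ∈ uIcc 0 (ℓ z), z + (t - ℓ z) • e ∈ C := by
    intro z hz t ht
    refine ⟨by rw [mem_preimage, hpre]; exact hz.1, ?_⟩
    rw [mem_preimage, hℓse, add_sub_cancel]
    have h1 := hz.2
    rw [mem_preimage, mem_ball_zero_iff] at h1
    rw [mem_ball_zero_iff]
    refine lt_of_le_of_lt ?_ h1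
    have := abs_sub_left_of_mem_uIcc ht
    simpa using this
  let N : Set E := eX.target ∩ eX.symm ⁻¹' C
  have hN : IsOpen N := eX.isOpen_inter_preimage_symm hC
  have hXC : ∀ z ∈ C, X z ∈ N ∧ eX.symm (X z) = z := by
    intro z hz
    have h1 : eX.symm (X z) = z := by rw [← hXcoe, eX.left_inv (hCX hz)]
    refine ⟨⟨?_, ?_⟩, h1⟩
    · rw [← hXcoe]; exact eX.map_source (hCX hz)
    · rw [mem_preimage, h1]; exact hz
  have hXsymm : ∀ x ∈ N, X (eX.symm x) = x := fun x hx ↦ by rw [← hXcoe, eX.right_inv hx.1]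
  -- `V` is the arrival time. The identity `P ∘ dX = ℓ` then says exactly that `dV = P`, and the
  -- eikonal equation is the conservation of the Hamiltonian.
  let V : E → ℝ := fun x ↦ ℓ (eX.symm x)
  have hV : ContDiffOn ℝ ∞ V N := ℓ.contDiff.comp_contDiffOn (hXs.mono inter_subset_left)
  have hdV : ∀ z ∈ C, fderiv ℝ V (X z) = P z := by
    intro z hz
    obtain ⟨h1, h2⟩ := hXC z hz
    have hzD : z ∈ D := (hXD' (hCX hz)).1
    have h3 : HasFDerivAt eX.symm (fderiv ℝ eX.symm (X z)) (X z) :=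
      ((hXs.differentiableOn (by simp)).differentiableAt
        (eX.open_target.mem_nhds h1.1)).hasFDerivAt
    have h4 : HasFDerivAt X (fderiv ℝ X z) (eX.symm (X z)) := by rw [h2]; exact hXd z hzD
    have h5 : (X ∘ eX.symm) =ᶠ[𝓝 (X z)] id :=
      Filter.eventuallyEq_of_mem (hN.mem_nhds h1) fun y hy ↦ hXsymm y hy
    have h6 := (h4.comp (X z) h3).unique ((hasFDerivAt_id (X z)).congr_of_eventuallyEq h5)
    have h7 : HasFDerivAt V (ℓ.comp (fderiv ℝ eX.symm (X z))) (X z) := ℓ.hasFDerivAt.comp (X z) h3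
    rw [h7.fderiv, ← hmom z hzD, ContinuousLinearMap.comp_assoc, h6, ContinuousLinearMap.comp_id]
  have h0C : (0 : E) ∈ C := by
    refine ⟨?_, ?_⟩
    · rw [mem_preimage, map_zero]; exact Metric.mem_ball_self hr
    · rw [mem_preimage, map_zero]; exact Metric.mem_ball_self hr
  refine ⟨V, N, hN, hX0 ▸ (hXC 0 h0C).1, ?_, hV, ?_⟩
  · intro x hx
    rw [← hXsymm x hx]
    exact hXU (hXD' (hCX hx.2)).1
  intro x hx
  obtain ⟨z, hz, rfl⟩ : ∃ z ∈ C, X z = x := ⟨_, hx.2, hXsymm x hx⟩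
  have hVz : V (X z) = ℓ z := by simp only [V, (hXC z hz).2]
  have hzD : z ∈ D := (hXD' (hCX hz)).1
  let c : ℝ → E := fun t ↦ X (z + (t - ℓ z) • e)
  have hct : ∀ t ∈ uIcc 0 (ℓ z), c t ∈ N ∧ ContDiffAt ℝ ∞ c t ∧
      HasDerivAt c (K (c t) (fderiv ℝ V (c t))) t := by
    intro t ht
    have h1 := hCline z hz t ht
    have h2 : z + (t - ℓ z) • e ∈ D := (hXD' (hCX h1)).1
    refine ⟨(hXC _ h1).1, ?_, ?_⟩
    · exact ContDiffAt.comp t (g := X) (f := fun t : ℝ ↦ z + (t - ℓ z) • e)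
        (hX.contDiffAt (hD.mem_nhds h2)) (by fun_prop)
    · have h3 : HasDerivAt (fun t : ℝ ↦ z + (t - ℓ z) • e) e t := by
        simpa using (((hasDerivAt_id t).sub_const (ℓ z)).smul_const e).const_add z
      have h4 := (hXd _ h2).comp_hasDerivAt t h3
      rw [hXe _ h2] at h4
      simp only [c, hdV _ h1]
      exact h4
  have hcz : c (ℓ z) = X z := by simp [c]
  have hz₀ := hCline z hz 0 left_mem_uIcc
  have hfc0 : f (c 0) = 0 := by
    have h0 : ℓ (z + (0 - ℓ z) • e) = 0 := by rw [hℓse]; ring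
    obtain ⟨h1, h2⟩ := hbase _ (hXD' (hCX hz₀)).1 h0
    simp only [c, X, h1]
    change f (eG.symm _) = 0
    rw [hfS _ h2.1, h0]
  have hfc : ∀ t ∈ uIcc 0 (ℓ z), HasDerivAt (fun t ↦ f (c t))
      (fderiv ℝ f (c t) (K (c t) (fderiv ℝ V (c t)))) t := fun t ht ↦
    (hdf _ (hXU (hXD' (hCX (hCline z hz t ht))).1)).comp_hasDerivAt t (hct t ht).2.2
  have hmono : StrictMonoOn (fun t ↦ f (c t)) (uIcc 0 (ℓ z)) := by
    refine strictMonoOn_of_deriv_pos (convex_uIcc _ _)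
      (fun t ht ↦ (hfc t ht).continuousAt.continuousWithinAt) fun t ht ↦ ?_
    have ht' := interior_subset ht
    rw [(hfc t ht').deriv]
    have h1 := hCline z hz t ht'
    simp only [c, hdV _ h1]
    exact (hXD' (hCX h1)).2
  have hneg : ℓ z < 0 → f (X z) < 0 := fun h ↦ by
    have := hmono right_mem_uIcc left_mem_uIcc h
    simp only [hfc0, hcz] at this
    exact this
  have hposz : 0 < ℓ z → 0 < f (X z) := fun h ↦ by
    have := hmono left_mem_uIcc right_mem_uIcc h
    simp only [hfc0, hcz] at this
    exact this
  have hzero : ℓ z = 0 → f (X z) = 0 := fun h ↦ by rw [← hcz, h, hfc0]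
  rw [hVz]
  refine ⟨by rw [hdV z hz]; exact hH z hzD, ?_, ?_, c, hcz, ?_, hct⟩
  · refine ⟨hneg, fun h ↦ ?_⟩
    rcases lt_trichotomy (ℓ z) 0 with h1 | h1 | h1
    · exact h1
    · exact absurd (hzero h1) h.ne
    · exact absurd (hposz h1) h.le.not_gt
  · refine ⟨hzero, fun h ↦ ?_⟩
    rcases lt_trichotomy (ℓ z) 0 with h1 | h1 | h1
    · exact absurd h (hneg h1).ne
    · exact h1
    · exact absurd h (hposz h1).ne'
  · simp only [V, c, (hXC _ hz₀).2, hℓse]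
    ring

end Eikonal

/-! ### Coordinate vector fields and derivatives in a chart -/

section Chart

variable {E : Type*} [NormedAddCommGroup E] [NormedSpace ℝ E] [FiniteDimensional ℝ E]
  {M : Type*} [TopologicalSpace M] [ChartedSpace E M] [IsManifold 𝓘(ℝ, E) ∞ M]

/-- The vector field on the chart domain at `p` with coordinate expression `a`. -/
noncomputable def chartField (p : M) (a : E → E) (x : M) : TangentSpace 𝓘(ℝ, E) x :=
  VectorField.mpullback 𝓘(ℝ, E) 𝓘(ℝ, E) (extChartAt 𝓘(ℝ, E) p) (fun y ↦ (a y : E)) x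

lemma contMDiffAt_extChartAt_of_mem_source {p x : M} (hx : x ∈ (extChartAt 𝓘(ℝ, E) p).source) :
    ContMDiffAt 𝓘(ℝ, E) 𝓘(ℝ, E) ∞ (extChartAt 𝓘(ℝ, E) p) x :=
  contMDiffAt_extChartAt' (by simpa using hx)

lemma contMDiffAt_chartField {p x : M} (hx : x ∈ (extChartAt 𝓘(ℝ, E) p).source) {a : E → E}
    (ha : ContDiffAt ℝ ∞ a (extChartAt 𝓘(ℝ, E) p x)) :
    ContMDiffAt 𝓘(ℝ, E) 𝓘(ℝ, E).tangent ∞ (T% (chartField p a)) x :=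
  ContMDiffAt.mpullback_vectorField_preimage (n := ∞) (contMDiffAt_vectorSpace_iff_contDiffAt.2 ha)
    (contMDiffAt_extChartAt_of_mem_source hx) (isInvertible_mfderiv_extChartAt hx) le_rfl

lemma mdifferentiableAt_chartField_const {p x : M} (hx : x ∈ (extChartAt 𝓘(ℝ, E) p).source)
    (v : E) : MDiffAt (T% (chartField p (fun _ ↦ v))) x :=
  (contMDiffAt_chartField hx contDiffAt_const).mdifferentiableAt (by simp)

/-- The coordinate representation of a tangent vector at a point of the chart domain at `p`. -/
noncomputable def chartCoord (p : M) (x : M) : TangentSpace 𝓘(ℝ, E) x →L[ℝ] E :=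
  mvfderiv 𝓘(ℝ, E) (extChartAt 𝓘(ℝ, E) p) x

lemma chartCoord_chartField {p x : M} (hx : x ∈ (extChartAt 𝓘(ℝ, E) p).source) (a : E → E) :
    chartCoord p x (chartField p a x) = a (extChartAt 𝓘(ℝ, E) p x) :=
  (isInvertible_mfderiv_extChartAt hx).self_apply_inverse _

lemma chartField_chartCoord {p x : M} (hx : x ∈ (extChartAt 𝓘(ℝ, E) p).source)
    (u : TangentSpace 𝓘(ℝ, E) x) : chartField p (fun _ ↦ chartCoord p x u) x = u :=
  (isInvertible_mfderiv_extChartAt hx).inverse_apply_self _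

/-- The Lie bracket is natural under pullback, and constant fields on `E` commute. This removes
bracket terms from the Koszul formula for coordinate fields. -/
lemma mlieBracket_chartField_const {p x : M} (hx : x ∈ (extChartAt 𝓘(ℝ, E) p).source) (v w : E) :
    VectorField.mlieBracket 𝓘(ℝ, E) (chartField p (fun _ ↦ v)) (chartField p (fun _ ↦ w)) x
      = 0 := by
  have h2 : IsManifold 𝓘(ℝ, E) (minSmoothness ℝ 2) M := by
    rw [minSmoothness_of_isRCLikeNormedField]; infer_instance
  have h2E : IsManifold 𝓘(ℝ, E) (minSmoothness ℝ 2) E := inferInstance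
  have h := VectorField.mpullback_mlieBracket (I := 𝓘(ℝ, E)) (I' := 𝓘(ℝ, E)) (n := ∞)
    (f := extChartAt 𝓘(ℝ, E) p) (V := fun _ ↦ (v : E)) (W := fun _ ↦ (w : E)) (x₀ := x)
    ((contMDiffAt_vectorSpace_iff_contDiffAt.2 contDiffAt_const).mdifferentiableAt one_ne_zero)
    ((contMDiffAt_vectorSpace_iff_contDiffAt.2 contDiffAt_const).mdifferentiableAt one_ne_zero)
    (contMDiffAt_extChartAt_of_mem_source hx)
    (by rw [minSmoothness_of_isRCLikeNormedField]; exact WithTop.coe_le_coe.2 le_top)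
  refine h.symm.trans ?_
  have h0 : VectorField.mlieBracket 𝓘(ℝ, E) (fun _ ↦ (v : E)) (fun _ : E ↦ (w : E)) = 0 := by
    refine VectorField.mlieBracketWithin_univ.symm.trans ?_
    refine VectorField.mlieBracketWithin_eq_lieBracketWithin.trans ?_
    ext y
    change fderivWithin ℝ (fun _ : E ↦ w) univ y v - fderivWithin ℝ (fun _ : E ↦ v) univ y w = 0
    simp
  rw [h0, VectorField.mpullback_zero]
  rfl

lemma mvfderiv_eq_fderiv_comp_chartCoord {p x : M} (hx : x ∈ (extChartAt 𝓘(ℝ, E) p).source)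
    {f : E → ℝ} (hf : DifferentiableAt ℝ f (extChartAt 𝓘(ℝ, E) p x)) :
    mvfderiv 𝓘(ℝ, E) (f ∘ extChartAt 𝓘(ℝ, E) p) x
      = (fderiv ℝ f (extChartAt 𝓘(ℝ, E) p x)).comp (chartCoord p x) := by
  have h := mvfderiv_comp (I := 𝓘(ℝ, E)) (I' := 𝓘(ℝ, E)) x (g := f) hf.mdifferentiableAt
    ((contMDiffAt_extChartAt_of_mem_source hx).mdifferentiableAt (by simp))
  rw [h]
  have h2 : mvfderiv 𝓘(ℝ, E) f (extChartAt 𝓘(ℝ, E) p x)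
      = fderiv ℝ f (extChartAt 𝓘(ℝ, E) p x) := by
    have := mfderiv_eq_fderiv (𝕜 := ℝ) (f := f) (x := extChartAt 𝓘(ℝ, E) p x)
    exact this
  rw [h2]
  rfl

lemma contMDiffAt_extChartAt_symm_of_mem_target {p : M} {y : E}
    (hy : y ∈ (extChartAt 𝓘(ℝ, E) p).target) :
    ContMDiffAt 𝓘(ℝ, E) 𝓘(ℝ, E) ∞ (extChartAt 𝓘(ℝ, E) p).symm y :=
  (contMDiffOn_extChartAt_symm p).contMDiffAt ((isOpen_extChartAt_target p).mem_nhds hy)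

/-- Smoothness in the chart at `p`. -/
lemma contDiffAt_comp_extChartAt_symm {F : Type*} [NormedAddCommGroup F] [NormedSpace ℝ F]
    {p : M} {y : E} (hy : y ∈ (extChartAt 𝓘(ℝ, E) p).target) {f : M → F}
    (hf : ContMDiffAt 𝓘(ℝ, E) 𝓘(ℝ, F) ∞ f ((extChartAt 𝓘(ℝ, E) p).symm y)) :
    ContDiffAt ℝ ∞ (f ∘ (extChartAt 𝓘(ℝ, E) p).symm) y :=
  (hf.comp y (contMDiffAt_extChartAt_symm_of_mem_target hy)).contDiffAt

lemma eventuallyEq_comp_extChartAt_symm_comp {F : Type*} {p x : M}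
    (hx : x ∈ (extChartAt 𝓘(ℝ, E) p).source) (f : M → F) :
    (f ∘ (extChartAt 𝓘(ℝ, E) p).symm) ∘ extChartAt 𝓘(ℝ, E) p =ᶠ[𝓝 x] f := by
  filter_upwards [(isOpen_extChartAt_source p).mem_nhds hx] with z hz
  exact congrArg f ((extChartAt 𝓘(ℝ, E) p).left_inv hz)

lemma mvfderiv_congr {F : Type*} [NormedAddCommGroup F] [NormedSpace ℝ F] {f g : M → F} {x : M}
    (h : f =ᶠ[𝓝 x] g) : mvfderiv 𝓘(ℝ, E) f x = mvfderiv 𝓘(ℝ, E) g x := by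
  have := h.mfderiv_eq (I := 𝓘(ℝ, E)) (I' := 𝓘(ℝ, F))
  exact this

lemma mvfderiv_eq_fderiv_chart {p x : M} (hx : x ∈ (extChartAt 𝓘(ℝ, E) p).source)
    {f : M → ℝ} (hf : ContMDiffAt 𝓘(ℝ, E) 𝓘(ℝ, ℝ) ∞ f x) :
    mvfderiv 𝓘(ℝ, E) f x = (fderiv ℝ (f ∘ (extChartAt 𝓘(ℝ, E) p).symm)
      (extChartAt 𝓘(ℝ, E) p x)).comp (chartCoord p x) := by
  rw [← mvfderiv_eq_fderiv_comp_chartCoord hx, mvfderiv_congr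
    (eventuallyEq_comp_extChartAt_symm_comp hx f)]
  refine (contDiffAt_comp_extChartAt_symm ((extChartAt 𝓘(ℝ, E) p).map_source hx) ?_).differentiableAt
    (by simp)
  rwa [(extChartAt 𝓘(ℝ, E) p).left_inv hx]

lemma mvfderiv_chartField {p x : M} (hx : x ∈ (extChartAt 𝓘(ℝ, E) p).source)
    {f : M → ℝ} (hf : ContMDiffAt 𝓘(ℝ, E) 𝓘(ℝ, ℝ) ∞ f x) (v : E) :
    mvfderiv 𝓘(ℝ, E) f x (chartField p (fun _ ↦ v) x)
      = fderiv ℝ (f ∘ (extChartAt 𝓘(ℝ, E) p).symm) (extChartAt 𝓘(ℝ, E) p x) v := by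
  rw [mvfderiv_eq_fderiv_chart hx hf, ContinuousLinearMap.comp_apply, chartCoord_chartField hx]

lemma contMDiffAt_comp_extChartAt {F : Type*} [NormedAddCommGroup F] [NormedSpace ℝ F]
    {p x : M} (hx : x ∈ (extChartAt 𝓘(ℝ, E) p).source) {f : E → F}
    (hf : ContDiffAt ℝ ∞ f (extChartAt 𝓘(ℝ, E) p x)) :
    ContMDiffAt 𝓘(ℝ, E) 𝓘(ℝ, F) ∞ (f ∘ extChartAt 𝓘(ℝ, E) p) x :=
  hf.contMDiffAt.comp x (contMDiffAt_extChartAt_of_mem_source hx)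

lemma mvfderiv_eq_zero_of_isLocalExtr {f : M → ℝ} {x : M} (h : IsLocalExtr f x)
    (hf : ContMDiffAt 𝓘(ℝ, E) 𝓘(ℝ, ℝ) ∞ f x) : mvfderiv 𝓘(ℝ, E) f x = 0 := by
  have hx := mem_extChartAt_source (I := 𝓘(ℝ, E)) x
  have hc : ContinuousAt (extChartAt 𝓘(ℝ, E) x).symm (extChartAt 𝓘(ℝ, E) x x) :=
    continuousAt_extChartAt_symm x
  have h1 : IsLocalExtr (f ∘ (extChartAt 𝓘(ℝ, E) x).symm) (extChartAt 𝓘(ℝ, E) x x) := by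
    have ht : Filter.Tendsto (extChartAt 𝓘(ℝ, E) x).symm (𝓝 (extChartAt 𝓘(ℝ, E) x x)) (𝓝 x) := by
      have := hc.tendsto
      rwa [(extChartAt 𝓘(ℝ, E) x).left_inv hx] at this
    have hxx : f ((extChartAt 𝓘(ℝ, E) x).symm (extChartAt 𝓘(ℝ, E) x x)) = f x := by
      rw [(extChartAt 𝓘(ℝ, E) x).left_inv hx]
    rcases h with h | h
    · left
      filter_upwards [ht.eventually h] with y hy
      simpa only [Function.comp, hxx] using hy
    · right
      filter_upwards [ht.eventually h] with y hy
      simpa only [Function.comp, hxx] using hy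
  rw [mvfderiv_eq_fderiv_chart hx hf, h1.fderiv_eq_zero, ContinuousLinearMap.zero_comp]

end Chart

/-! ### The metric, its inverse and gradients in a chart -/

section ChartMetric

variable {E : Type*} [NormedAddCommGroup E] [NormedSpace ℝ E] [FiniteDimensional ℝ E]
  {M : Type*} [TopologicalSpace M] [ChartedSpace E M] [IsManifold 𝓘(ℝ, E) ∞ M]
  [RiemannianBundle (fun x : M ↦ TangentSpace 𝓘(ℝ, E) x)]

/-- The tangent vector dual to a covector given in the chart at `p`. -/
noncomputable def chartSharp (p x : M) (ξ : E →L[ℝ] ℝ) : TangentSpace 𝓘(ℝ, E) x :=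
  (InnerProductSpace.toDual ℝ (TangentSpace 𝓘(ℝ, E) x)).symm (ξ.comp (chartCoord p x))

lemma inner_chartSharp (p x : M) (ξ : E →L[ℝ] ℝ) (u : TangentSpace 𝓘(ℝ, E) x) :
    inner ℝ (chartSharp p x ξ) u = ξ (chartCoord p x u) := by
  simp [chartSharp]

lemma chartSharp_add (p x : M) (ξ η : E →L[ℝ] ℝ) :
    chartSharp p x (ξ + η) = chartSharp p x ξ + chartSharp p x η :=
  ext_inner_right ℝ fun u ↦ by simp only [inner_add_left, inner_chartSharp, add_apply]

lemma chartSharp_smul (p x : M) (c : ℝ) (ξ : E →L[ℝ] ℝ) :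
    chartSharp p x (c • ξ) = c • chartSharp p x ξ :=
  ext_inner_right ℝ fun u ↦ by
    simp only [real_inner_smul_left, inner_chartSharp, smul_apply, smul_eq_mul]

/-- The inverse metric in the chart at `p`. -/
noncomputable def cometric (p : M) (y : E) : (E →L[ℝ] ℝ) →L[ℝ] E :=
  LinearMap.toContinuousLinearMap
    { toFun ξ := chartCoord p ((extChartAt 𝓘(ℝ, E) p).symm y)
        (chartSharp p ((extChartAt 𝓘(ℝ, E) p).symm y) ξ)
      map_add' ξ η := by rw [chartSharp_add, map_add]
      map_smul' c ξ := by rw [chartSharp_smul, map_smul, RingHom.id_apply] }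

lemma cometric_apply (p : M) (y : E) (ξ : E →L[ℝ] ℝ) :
    cometric p y ξ = chartCoord p ((extChartAt 𝓘(ℝ, E) p).symm y)
        (chartSharp p ((extChartAt 𝓘(ℝ, E) p).symm y) ξ) := rfl

lemma apply_cometric (p : M) (y : E) (ξ η : E →L[ℝ] ℝ) :
    η (cometric p y ξ) = inner ℝ (chartSharp p ((extChartAt 𝓘(ℝ, E) p).symm y) η)
      (chartSharp p ((extChartAt 𝓘(ℝ, E) p).symm y) ξ) := by
  rw [inner_chartSharp, cometric_apply]

lemma cometric_symm (p : M) (y : E) (ξ η : E →L[ℝ] ℝ) :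
    η (cometric p y ξ) = ξ (cometric p y η) := by
  rw [apply_cometric, apply_cometric, real_inner_comm]

variable (E) in
/-- The inclusion of coordinate vectors into the tangent space. -/
noncomputable def chartLift (p x : M) : E →L[ℝ] TangentSpace 𝓘(ℝ, E) x :=
  (mvfderiv 𝓘(ℝ, E) (extChartAt 𝓘(ℝ, E) p) x).inverse

/-- The metric in the chart at `p`. -/
noncomputable def gramForm (p : M) (y : E) : E →L[ℝ] E →L[ℝ] ℝ :=
  LinearMap.toContinuousLinearMap
    { toFun v := (innerSL ℝ (chartLift E p ((extChartAt 𝓘(ℝ, E) p).symm y) v)).comp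
        (chartLift E p ((extChartAt 𝓘(ℝ, E) p).symm y))
      map_add' v w := by rw [map_add, map_add]; rfl
      map_smul' c v := by rw [map_smul, map_smul]; rfl }

lemma gramForm_apply (p : M) (y v w : E) :
    gramForm p y v w = inner ℝ (chartField p (fun _ ↦ v) ((extChartAt 𝓘(ℝ, E) p).symm y))
      (chartField p (fun _ ↦ w) ((extChartAt 𝓘(ℝ, E) p).symm y)) := rfl

lemma cometric_comp_gramForm {p : M} {y : E} (hy : y ∈ (extChartAt 𝓘(ℝ, E) p).target) (v : E) :
    cometric p y (gramForm p y v) = v := by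
  have hx := (extChartAt 𝓘(ℝ, E) p).map_target hy
  have : chartSharp p ((extChartAt 𝓘(ℝ, E) p).symm y) (gramForm p y v)
      = chartField p (fun _ ↦ v) ((extChartAt 𝓘(ℝ, E) p).symm y) := by
    refine ext_inner_right ℝ fun u ↦ ?_
    rw [inner_chartSharp, gramForm_apply, chartField_chartCoord hx]
  rw [cometric_apply, this, chartCoord_chartField hx]

lemma gramForm_comp_cometric {p : M} {y : E} (hy : y ∈ (extChartAt 𝓘(ℝ, E) p).target)
    (ξ : E →L[ℝ] ℝ) : gramForm p y (cometric p y ξ) = ξ := by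
  have hx := (extChartAt 𝓘(ℝ, E) p).map_target hy
  ext w
  rw [gramForm_apply, cometric_apply, chartField_chartCoord hx, inner_chartSharp,
    chartCoord_chartField hx]

variable [IsContMDiffRiemannianBundle 𝓘(ℝ, E) ∞ E (fun x : M ↦ TangentSpace 𝓘(ℝ, E) x)]

lemma contMDiffAt_inner {X Y : Π x : M, TangentSpace 𝓘(ℝ, E) x} {x : M}
    (hX : ContMDiffAt 𝓘(ℝ, E) 𝓘(ℝ, E).tangent ∞ (T% X) x)
    (hY : ContMDiffAt 𝓘(ℝ, E) 𝓘(ℝ, E).tangent ∞ (T% Y) x) :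
    ContMDiffAt 𝓘(ℝ, E) 𝓘(ℝ, ℝ) ∞ (fun y ↦ (inner ℝ (X y) (Y y) : ℝ)) x :=
  ContMDiffAt.inner_bundle (F := E) (E := fun x : M ↦ TangentSpace 𝓘(ℝ, E) x) (b := fun y ↦ y)
    hX hY

lemma contDiffOn_gramForm (p : M) :
    ContDiffOn ℝ ∞ (gramForm (E := E) p) (extChartAt 𝓘(ℝ, E) p).target := by
  refine contDiffOn_clm_apply.2 fun v ↦ contDiffOn_clm_apply.2 fun w y hy ↦ ?_
  have hx := (extChartAt 𝓘(ℝ, E) p).map_target hy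
  exact (contDiffAt_comp_extChartAt_symm hy (contMDiffAt_inner
    (contMDiffAt_chartField hx contDiffAt_const)
    (contMDiffAt_chartField hx contDiffAt_const))).contDiffWithinAt

/-- The cometric is the inverse of the Gram form, which is smooth because its entries are inner
products of coordinate fields; inversion of operators is smooth. -/
lemma contDiffOn_cometric (p : M) :
    ContDiffOn ℝ ∞ (cometric (E := E) p) (extChartAt 𝓘(ℝ, E) p).target := by
  intro y hy
  let e : ∀ y ∈ (extChartAt 𝓘(ℝ, E) p).target, E ≃L[ℝ] (E →L[ℝ] ℝ) := fun y hy ↦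
    ContinuousLinearEquiv.equivOfInverse (gramForm p y) (cometric p y)
      (cometric_comp_gramForm hy) (gramForm_comp_cometric hy)
  have hinv : ∀ z ∈ (extChartAt 𝓘(ℝ, E) p).target,
      ContinuousLinearMap.inverse (gramForm p z) = cometric p z := fun z hz ↦
    ContinuousLinearMap.inverse_equiv (e z hz)
  have h1 : ContDiffAt ℝ ∞ (gramForm p) y :=
    (contDiffOn_gramForm p).contDiffAt ((isOpen_extChartAt_target p).mem_nhds hy)
  have h2 : ContDiffAt ℝ ∞ (ContinuousLinearMap.inverse : (E →L[ℝ] E →L[ℝ] ℝ) → _)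
      (gramForm p y) := contDiffAt_map_inverse (e y hy)
  refine ((h2.comp y h1).congr_of_eventuallyEq ?_).contDiffWithinAt
  filter_upwards [(isOpen_extChartAt_target p).mem_nhds hy] with z hz
  exact (hinv z hz).symm

lemma inner_gradient (f : M → ℝ) (x : M) (u : TangentSpace 𝓘(ℝ, E) x) :
    inner ℝ (gradient 𝓘(ℝ, E) f x) u = mvfderiv 𝓘(ℝ, E) f x u := by
  simp [gradient]

lemma gradient_congr {f g : M → ℝ} {x : M} (h : f =ᶠ[𝓝 x] g) :
    gradient 𝓘(ℝ, E) f x = gradient 𝓘(ℝ, E) g x := by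
  rw [gradient, gradient, mvfderiv_congr h]

lemma gradient_eq_chartSharp {p x : M} (hx : x ∈ (extChartAt 𝓘(ℝ, E) p).source)
    {f : M → ℝ} (hf : ContMDiffAt 𝓘(ℝ, E) 𝓘(ℝ, ℝ) ∞ f x) :
    gradient 𝓘(ℝ, E) f x = chartSharp p x
      (fderiv ℝ (f ∘ (extChartAt 𝓘(ℝ, E) p).symm) (extChartAt 𝓘(ℝ, E) p x)) := by
  rw [gradient, mvfderiv_eq_fderiv_chart hx hf, chartSharp]

lemma chartField_cometric {p x : M} (hx : x ∈ (extChartAt 𝓘(ℝ, E) p).source) (ξ : E →L[ℝ] ℝ) :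
    chartField p (fun _ ↦ cometric p (extChartAt 𝓘(ℝ, E) p x) ξ) x = chartSharp p x ξ := by
  rw [cometric_apply, (extChartAt 𝓘(ℝ, E) p).left_inv hx, chartField_chartCoord hx]

lemma gradient_eq_chartField {p x : M} (hx : x ∈ (extChartAt 𝓘(ℝ, E) p).source)
    {f : M → ℝ} (hf : ContMDiffAt 𝓘(ℝ, E) 𝓘(ℝ, ℝ) ∞ f x) :
    gradient 𝓘(ℝ, E) f x = chartField p
      (fun y ↦ cometric p y (fderiv ℝ (f ∘ (extChartAt 𝓘(ℝ, E) p).symm) y)) x := by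
  rw [gradient_eq_chartSharp hx hf, ← chartField_cometric hx]
  rfl

lemma norm_gradient_sq {p x : M} (hx : x ∈ (extChartAt 𝓘(ℝ, E) p).source)
    {f : M → ℝ} (hf : ContMDiffAt 𝓘(ℝ, E) 𝓘(ℝ, ℝ) ∞ f x) :
    ‖gradient 𝓘(ℝ, E) f x‖ ^ 2 =
      fderiv ℝ (f ∘ (extChartAt 𝓘(ℝ, E) p).symm) (extChartAt 𝓘(ℝ, E) p x)
        (cometric p (extChartAt 𝓘(ℝ, E) p x)
          (fderiv ℝ (f ∘ (extChartAt 𝓘(ℝ, E) p).symm) (extChartAt 𝓘(ℝ, E) p x))) := by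
  rw [apply_cometric, (extChartAt 𝓘(ℝ, E) p).left_inv hx, gradient_eq_chartSharp hx hf,
    real_inner_self_eq_norm_sq]

/-- In coordinates the gradient is the cometric applied to the differential. Smoothness of `f` is
assumed near `x` because this formula has to hold on a neighbourhood. -/
lemma contMDiffAt_gradient {f : M → ℝ} {x : M}
    (hf : ∀ᶠ z in 𝓝 x, ContMDiffAt 𝓘(ℝ, E) 𝓘(ℝ, ℝ) ∞ f z) :
    ContMDiffAt 𝓘(ℝ, E) 𝓘(ℝ, E).tangent ∞ (T% (gradient 𝓘(ℝ, E) f)) x := by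
  have hx := mem_extChartAt_source (I := 𝓘(ℝ, E)) x
  have hy := (extChartAt 𝓘(ℝ, E) x).map_source hx
  have hfy : ContDiffAt ℝ ∞ (f ∘ (extChartAt 𝓘(ℝ, E) x).symm) (extChartAt 𝓘(ℝ, E) x x) :=
    contDiffAt_comp_extChartAt_symm hy (by
      rw [(extChartAt 𝓘(ℝ, E) x).left_inv hx]; exact hf.self_of_nhds)
  have h1 : ContDiffAt ℝ ∞ (fun y ↦ cometric x y
      (fderiv ℝ (f ∘ (extChartAt 𝓘(ℝ, E) x).symm) y)) (extChartAt 𝓘(ℝ, E) x x) :=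
    ((contDiffOn_cometric x).contDiffAt ((isOpen_extChartAt_target x).mem_nhds hy)).clm_apply
      (hfy.fderiv_right (m := ∞) (by simp))
  refine (contMDiffAt_chartField hx h1).congr_of_eventuallyEq ?_
  filter_upwards [(isOpen_extChartAt_source (I := 𝓘(ℝ, E)) x).mem_nhds hx,
    hf] with z hz hfz
  rw [gradient_eq_chartField hz hfz]

end ChartMetric

/-! ### Growth of functions along paths, and velocities in a chart -/

section Length

variable {E : Type*} [NormedAddCommGroup E] [NormedSpace ℝ E] [FiniteDimensional ℝ E]
  {M : Type*} [TopologicalSpace M] [ChartedSpace E M] [IsManifold 𝓘(ℝ, E) ∞ M]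
  [RiemannianBundle (fun x : M ↦ TangentSpace 𝓘(ℝ, E) x)]
  [IsContMDiffRiemannianBundle 𝓘(ℝ, E) ∞ E (fun x : M ↦ TangentSpace 𝓘(ℝ, E) x)]

lemma gradient_eq_zero_iff {f : M → ℝ} {x : M} :
    gradient 𝓘(ℝ, E) f x = 0 ↔ mvfderiv 𝓘(ℝ, E) f x = 0 := by
  simp [gradient]

lemma norm_mvfderiv_apply_le (f : M → ℝ) (x : M) (u : TangentSpace 𝓘(ℝ, E) x) :
    |mvfderiv 𝓘(ℝ, E) f x u| ≤ ‖gradient 𝓘(ℝ, E) f x‖ * ‖u‖ := by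
  rw [← inner_gradient]
  exact abs_real_inner_le_norm _ _

/-- A function with gradient of norm at most one grows along a path at most by its length. -/
lemma enorm_sub_le_pathELength {f : M → ℝ} {U : Set M}
    (hf : ∀ x ∈ U, ContMDiffAt 𝓘(ℝ, E) 𝓘(ℝ, ℝ) ∞ f x)
    (hgrad : ∀ x ∈ U, ‖gradient 𝓘(ℝ, E) f x‖ ≤ 1) {γ : ℝ → M} {a b : ℝ} (hab : a ≤ b)
    (hγ : ContMDiff 𝓘(ℝ, ℝ) 𝓘(ℝ, E) 1 γ) (hγU : ∀ t ∈ Icc a b, γ t ∈ U) :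
    ‖f (γ b) - f (γ a)‖ₑ ≤ Manifold.pathELength 𝓘(ℝ, E) γ a b := by
  have hsm : ∀ t ∈ Icc a b, ContMDiffAt 𝓘(ℝ, ℝ) 𝓘(ℝ, ℝ) 1 (f ∘ γ) t := fun t ht ↦
    ((hf (γ t) (hγU t ht)).of_le (by simp)).comp t (hγ t)
  have hC : ContDiffOn ℝ 1 (f ∘ γ) (Icc a b) := fun t ht ↦
    (hsm t ht).contDiffAt.contDiffWithinAt
  refine (enorm_sub_le_lintegral_deriv_of_contDiffOn_Icc hC hab).trans ?_
  rw [Manifold.pathELength_eq_lintegral_mfderiv_Icc]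
  refine MeasureTheory.setLIntegral_mono' measurableSet_Icc fun t ht ↦ ?_
  have h1 : deriv (f ∘ γ) t = mvfderiv 𝓘(ℝ, E) f (γ t) (mfderiv 𝓘(ℝ, ℝ) 𝓘(ℝ, E) γ t (1 : ℝ)) := by
    have := mvfderiv_comp (I := 𝓘(ℝ, E)) (I' := 𝓘(ℝ, ℝ)) t
      ((hf (γ t) (hγU t ht)).mdifferentiableAt (by simp)) (hγ.mdifferentiableAt (by simp))
    have h2 : mvfderiv 𝓘(ℝ, ℝ) (f ∘ γ) t = fderiv ℝ (f ∘ γ) t :=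
      mfderiv_eq_fderiv (𝕜 := ℝ) (f := f ∘ γ) (x := t)
    rw [← fderiv_apply_one_eq_deriv, ← h2, this]
    rfl
  rw [h1, enorm_le_iff_norm_le, Real.norm_eq_abs]
  refine (norm_mvfderiv_apply_le _ _ _).trans ?_
  exact mul_le_of_le_one_left (norm_nonneg _) (hgrad _ (hγU t ht))

/-- The velocity of a curve given in the chart at `p`. -/
lemma mfderiv_extChartAt_symm_comp {p : M} {c : ℝ → E} {t : ℝ} {c' : E}
    (hc : ContDiffAt ℝ ∞ c t) (hc' : HasDerivAt c c' t)
    (ht : c t ∈ (extChartAt 𝓘(ℝ, E) p).target) :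
    mfderiv 𝓘(ℝ, ℝ) 𝓘(ℝ, E) ((extChartAt 𝓘(ℝ, E) p).symm ∘ c) t (1 : ℝ)
      = chartField p (fun _ ↦ c') ((extChartAt 𝓘(ℝ, E) p).symm (c t)) := by
  have hx := (extChartAt 𝓘(ℝ, E) p).map_target ht
  have h1 : MDifferentiableAt 𝓘(ℝ, ℝ) 𝓘(ℝ, E) ((extChartAt 𝓘(ℝ, E) p).symm ∘ c) t :=
    (((contMDiffAt_extChartAt_symm_of_mem_target ht).comp t hc.contMDiffAt).mdifferentiableAt
      (by simp))
  have h2 := mfderiv_comp (I := 𝓘(ℝ, ℝ)) (I' := 𝓘(ℝ, E)) (I'' := 𝓘(ℝ, E)) t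
    (g := extChartAt 𝓘(ℝ, E) p) (f := (extChartAt 𝓘(ℝ, E) p).symm ∘ c)
    ((contMDiffAt_extChartAt_of_mem_source hx).mdifferentiableAt (by simp)) h1
  have h3 : extChartAt 𝓘(ℝ, E) p ∘ (extChartAt 𝓘(ℝ, E) p).symm ∘ c =ᶠ[𝓝 t] c := by
    filter_upwards [hc.continuousAt.preimage_mem_nhds ((isOpen_extChartAt_target p).mem_nhds ht)]
      with s hs
    exact (extChartAt 𝓘(ℝ, E) p).right_inv hs
  have h4 : chartCoord p ((extChartAt 𝓘(ℝ, E) p).symm (c t))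
      (mfderiv 𝓘(ℝ, ℝ) 𝓘(ℝ, E) ((extChartAt 𝓘(ℝ, E) p).symm ∘ c) t (1 : ℝ)) = c' := by
    have h5 : mfderiv 𝓘(ℝ, ℝ) 𝓘(ℝ, E) (extChartAt 𝓘(ℝ, E) p ∘ (extChartAt 𝓘(ℝ, E) p).symm ∘ c) t
        = fderiv ℝ c t := (h3.mfderiv_eq).trans mfderiv_eq_fderiv
    have h6 : fderiv ℝ c t 1 = c' := by rw [fderiv_apply_one_eq_deriv, hc'.deriv]
    rw [← h6, ← h5, h2]
    rfl
  refine (chartField_chartCoord hx _).symm.trans ?_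
  rw [← h4]

end Length

/-! ### Comparison with the Riemannian distance -/

section Distance

variable {E : Type*} [NormedAddCommGroup E] [NormedSpace ℝ E] [FiniteDimensional ℝ E]
  {M : Type*} [MetricSpace M] [ChartedSpace E M] [IsManifold 𝓘(ℝ, E) ∞ M]
  [RiemannianBundle (fun x : M ↦ TangentSpace 𝓘(ℝ, E) x)]
  [IsContMDiffRiemannianBundle 𝓘(ℝ, E) ∞ E (fun x : M ↦ TangentSpace 𝓘(ℝ, E) x)]
  [IsRiemannianManifold 𝓘(ℝ, E) M]

/-- Some path from `x` to `y` has length below any `s > dist x y`. If `s < r`, it cannot leave the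
ball of radius `r`, so a gradient bound on that ball suffices. -/
lemma abs_sub_le_dist {f : M → ℝ} {x y : M} {r : ℝ}
    (hf : ∀ z ∈ Metric.ball x r, ContMDiffAt 𝓘(ℝ, E) 𝓘(ℝ, ℝ) ∞ f z)
    (hgrad : ∀ z ∈ Metric.ball x r, ‖gradient 𝓘(ℝ, E) f z‖ ≤ 1) (hxy : dist x y < r) :
    |f y - f x| ≤ dist x y := by
  refine le_of_forall_gt_imp_ge_of_dense fun s hs ↦ ?_
  wlog hsr : s < r generalizing s
  · exact (this ((dist x y + r) / 2) (by linarith) (by linarith)).trans (by linarith)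
  have hs0 : 0 < s := dist_nonneg.trans_lt hs
  have h1 : Manifold.riemannianEDist 𝓘(ℝ, E) x y < ENNReal.ofReal s := by
    rw [← IsRiemannianManifold.out (I := 𝓘(ℝ, E)), edist_dist]
    exact (ENNReal.ofReal_lt_ofReal_iff hs0).2 hs
  obtain ⟨γ, h0, hγ1, hγ, hlen, -⟩ :=
    Manifold.exists_lt_locally_constant_of_riemannianEDist_lt h1 (zero_lt_one (α := ℝ))
  have hmem : ∀ t ∈ Icc (0 : ℝ) 1, γ t ∈ Metric.ball x r := fun t ht ↦ by
    have h2 : edist x (γ t) < ENNReal.ofReal s := by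
      rw [IsRiemannianManifold.out (I := 𝓘(ℝ, E))]
      refine (Manifold.riemannianEDist_le_pathELength hγ.contMDiffOn h0 rfl ht.1).trans_lt ?_
      exact (Manifold.pathELength_mono le_rfl ht.2).trans_lt hlen
    rw [edist_dist, ENNReal.ofReal_lt_ofReal_iff hs0] at h2
    rw [Metric.mem_ball, dist_comm]
    exact h2.trans hsr
  have h3 := (enorm_sub_le_pathELength hf hgrad zero_le_one hγ hmem).trans hlen.le
  rw [h0, hγ1, Real.enorm_eq_ofReal_abs, ENNReal.ofReal_le_ofReal_iff hs0.le] at h3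
  exact h3

lemma norm_chartField_cometric_eq_one {p x : M} (hx : x ∈ (extChartAt 𝓘(ℝ, E) p).source)
    {ξ : E →L[ℝ] ℝ} (h : ξ (cometric p (extChartAt 𝓘(ℝ, E) p x) ξ) = 1) :
    ‖chartField p (fun _ ↦ cometric p (extChartAt 𝓘(ℝ, E) p x) ξ) x‖ = 1 := by
  rw [apply_cometric, (extChartAt 𝓘(ℝ, E) p).left_inv hx, real_inner_self_eq_norm_sq] at h
  rw [chartField_cometric hx]
  nlinarith [norm_nonneg (chartSharp p x ξ)]

/-- The velocity is the metric dual of a covector of norm one, so the curve has unit speed and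
length `b - a`. -/
lemma dist_le_of_unit_speed {p : M} {c : ℝ → E} {a b : ℝ} (hab : a ≤ b)
    (ht : ∀ t ∈ Icc a b, c t ∈ (extChartAt 𝓘(ℝ, E) p).target)
    (hc : ∀ t ∈ Icc a b, ContDiffAt ℝ ∞ c t) {ξ : ℝ → E →L[ℝ] ℝ}
    (hc' : ∀ t ∈ Icc a b, HasDerivAt c (cometric p (c t) (ξ t)) t)
    (hξ : ∀ t ∈ Icc a b, ξ t (cometric p (c t) (ξ t)) = 1) :
    dist ((extChartAt 𝓘(ℝ, E) p).symm (c a)) ((extChartAt 𝓘(ℝ, E) p).symm (c b)) ≤ b - a := by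
  have hγ : ContMDiffOn 𝓘(ℝ, ℝ) 𝓘(ℝ, E) 1 ((extChartAt 𝓘(ℝ, E) p).symm ∘ c) (Icc a b) :=
    fun t h ↦ (((contMDiffAt_extChartAt_symm_of_mem_target (ht t h)).comp t
      (hc t h).contMDiffAt).of_le (by simp)).contMDiffWithinAt
  have h1 := Manifold.riemannianEDist_le_pathELength hγ rfl rfl hab
  rw [← IsRiemannianManifold.out (I := 𝓘(ℝ, E)),
    Manifold.pathELength_eq_lintegral_mfderiv_Icc] at h1
  have h2 : ∫⁻ t in Icc a b, ‖mfderiv 𝓘(ℝ, ℝ) 𝓘(ℝ, E) ((extChartAt 𝓘(ℝ, E) p).symm ∘ c) t (1 : ℝ)‖ₑ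
      ≤ ∫⁻ t in Icc a b, 1 := by
    refine MeasureTheory.setLIntegral_mono' measurableSet_Icc fun t h ↦ ?_
    rw [mfderiv_extChartAt_symm_comp (hc t h) (hc' t h) (ht t h)]
    have := norm_chartField_cometric_eq_one ((extChartAt 𝓘(ℝ, E) p).map_target (ht t h))
      (ξ := ξ t) (by rw [(extChartAt 𝓘(ℝ, E) p).right_inv (ht t h)]; exact hξ t h)
    rw [(extChartAt 𝓘(ℝ, E) p).right_inv (ht t h)] at this
    rw [← enorm_norm, this]
    simp
  have h3 := h1.trans h2
  rw [MeasureTheory.lintegral_one, MeasureTheory.Measure.restrict_apply_univ, Real.volume_Icc,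
    edist_dist, ENNReal.ofReal_le_ofReal_iff (by linarith)] at h3
  exact h3

end Distance

/-! ### Sublevel sets near regular points -/

section Topology

variable {E : Type*} [NormedAddCommGroup E] [NormedSpace ℝ E] [FiniteDimensional ℝ E]
  {M : Type*} [TopologicalSpace M] [ChartedSpace E M] [IsManifold 𝓘(ℝ, E) ∞ M]

/-- Otherwise `x` would be a local minimum of `f`, forcing its differential to vanish. -/
lemma exists_neg_of_mvfderiv_ne_zero {f : M → ℝ} {x : M}
    (hf : ContMDiffAt 𝓘(ℝ, E) 𝓘(ℝ, ℝ) ∞ f x) (hx : f x = 0) (hdf : mvfderiv 𝓘(ℝ, E) f x ≠ 0) :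
    x ∈ closure {y | f y < 0} := by
  by_contra h
  refine hdf (mvfderiv_eq_zero_of_isLocalExtr (Or.inl ?_) hf)
  filter_upwards [isClosed_closure.isOpen_compl.mem_nhds h] with y hy
  rw [hx]
  exact not_lt.1 fun h2 ↦ hy (subset_closure h2)

lemma exists_pos_of_mvfderiv_ne_zero {f : M → ℝ} {x : M}
    (hf : ContMDiffAt 𝓘(ℝ, E) 𝓘(ℝ, ℝ) ∞ f x) (hx : f x = 0) (hdf : mvfderiv 𝓘(ℝ, E) f x ≠ 0) :
    x ∈ closure {y | 0 < f y} := by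
  by_contra h
  refine hdf (mvfderiv_eq_zero_of_isLocalExtr (Or.inr ?_) hf)
  filter_upwards [isClosed_closure.isOpen_compl.mem_nhds h] with y hy
  rw [hx]
  exact not_lt.1 fun h2 ↦ hy (subset_closure h2)

/-- For a regular closed set, a regular defining function of the interior on an open set also
determines the set and its boundary. -/
lemma mem_iff_le_zero_of_regular {Y : Set M} (hYc : IsClosed Y) (hY : Y ⊆ closure (interior Y))
    {f : M → ℝ} {N : Set M} (hN : IsOpen N)
    (hf : ∀ x ∈ N, ContMDiffAt 𝓘(ℝ, E) 𝓘(ℝ, ℝ) ∞ f x)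
    (hdf : ∀ x ∈ N, f x = 0 → mvfderiv 𝓘(ℝ, E) f x ≠ 0)
    (hint : ∀ x ∈ N, x ∈ interior Y ↔ f x < 0) {x : M} (hx : x ∈ N) :
    (x ∈ Y ↔ f x ≤ 0) ∧ (x ∈ frontier Y ↔ f x = 0) := by
  have h1 : x ∈ Y ↔ f x ≤ 0 := by
    constructor
    · intro hxY
      by_contra! hpos
      have h2 : N ∩ f ⁻¹' Ioi 0 ∈ 𝓝 x := Filter.inter_mem (hN.mem_nhds hx)
        ((hf x hx).continuousAt.preimage_mem_nhds (Ioi_mem_nhds hpos))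
      obtain ⟨z, ⟨hzN, hz⟩, hzi⟩ := mem_closure_iff_nhds.1 (hY hxY) _ h2
      exact lt_asymm hz ((hint z hzN).1 hzi)
    · intro hle
      rcases hle.lt_or_eq with h | h
      · exact interior_subset ((hint x hx).2 h)
      · have h3 := exists_neg_of_mvfderiv_ne_zero (hf x hx) h (hdf x hx h)
        rw [← hYc.closure_eq, mem_closure_iff_nhds]
        intro t ht
        obtain ⟨z, ⟨hzt, hzN⟩, hz⟩ := mem_closure_iff_nhds.1 h3 _
          (Filter.inter_mem ht (hN.mem_nhds hx))
        exact ⟨z, hzt, interior_subset ((hint z hzN).2 hz)⟩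
  refine ⟨h1, ?_⟩
  rw [hYc.frontier_eq, mem_sdiff, h1, hint x hx, not_lt]
  exact ⟨fun h ↦ le_antisymm h.1 h.2, fun h ↦ ⟨h.le, h.ge⟩⟩

end Topology

/-! ### Smoothness of the signed distance -/

section SignedDistance

variable {E : Type*} [NormedAddCommGroup E] [NormedSpace ℝ E] [FiniteDimensional ℝ E]
  {M : Type*} [MetricSpace M] [ChartedSpace E M] [IsManifold 𝓘(ℝ, E) ∞ M]
  [RiemannianBundle (fun x : M ↦ TangentSpace 𝓘(ℝ, E) x)]
  [IsContMDiffRiemannianBundle 𝓘(ℝ, E) ∞ E (fun x : M ↦ TangentSpace 𝓘(ℝ, E) x)]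
  [IsRiemannianManifold 𝓘(ℝ, E) M]

/-- Local solution of the eikonal equation with given zero set: it is the distance to a point of
the zero set that can be reached inside the domain. -/
lemma exists_unit_gradient {f : M → ℝ} {U : Set M} (hU : IsOpen U) {p : M} (hp : p ∈ U)
    (hf : ContMDiffOn 𝓘(ℝ, E) 𝓘(ℝ, ℝ) ∞ f U) (hfp : f p = 0) (hdf : mvfderiv 𝓘(ℝ, E) f p ≠ 0) :
    ∃ (V : M → ℝ) (N : Set M), IsOpen N ∧ p ∈ N ∧ N ⊆ U ∧
      ∀ x ∈ N, ContMDiffAt 𝓘(ℝ, E) 𝓘(ℝ, ℝ) ∞ V x ∧ ‖gradient 𝓘(ℝ, E) V x‖ = 1 ∧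
        (V x < 0 ↔ f x < 0) ∧ (V x = 0 ↔ f x = 0) ∧ ∃ q ∈ N, V q = 0 ∧ dist x q ≤ |V x| := by
  set φ := extChartAt 𝓘(ℝ, E) p with hφ
  have hps : p ∈ φ.source := mem_extChartAt_source p
  have hfAt : ∀ x ∈ U, ContMDiffAt 𝓘(ℝ, E) 𝓘(ℝ, ℝ) ∞ f x := fun x hx ↦
    hf.contMDiffAt (hU.mem_nhds hx)
  set O : Set E := φ.target ∩ φ.symm ⁻¹' U with hO
  have hOo : IsOpen O := (continuousOn_extChartAt_symm p).isOpen_inter_preimage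
    (isOpen_extChartAt_target p) hU
  have hφp : φ p ∈ O := ⟨φ.map_source hps, by rw [mem_preimage, φ.left_inv hps]; exact hp⟩
  have hfO : ContDiffOn ℝ ∞ (f ∘ φ.symm) O := fun y hy ↦
    (contDiffAt_comp_extChartAt_symm hy.1 (hfAt _ hy.2)).contDiffWithinAt
  have hpos : 0 < fderiv ℝ (f ∘ φ.symm) (φ p) (cometric p (φ p) (fderiv ℝ (f ∘ φ.symm) (φ p))) := by
    rw [← norm_gradient_sq hps (hfAt p hp)]
    have : gradient 𝓘(ℝ, E) f p ≠ 0 := fun h ↦ hdf (gradient_eq_zero_iff.1 h)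
    positivity
  obtain ⟨v, N, hNo, hpN, hNO, hv, hN⟩ := exists_eikonal hOo
    ((contDiffOn_cometric p).mono inter_subset_left) (fun y _ ξ η ↦ cometric_symm p y ξ η) hfO hφp
    (by simp [φ.left_inv hps, hfp]) hpos
  have hmem : ∀ y ∈ N, φ.symm y ∈ φ.source ∩ φ ⁻¹' N := fun y hy ↦
    ⟨φ.map_target (hNO hy).1, by rw [mem_preimage, φ.right_inv (hNO hy).1]; exact hy⟩
  have hvAt : ∀ y ∈ N, ContDiffAt ℝ ∞ v y := fun y hy ↦ hv.contDiffAt (hNo.mem_nhds hy)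
  have hvφ : ∀ y ∈ N, (v ∘ φ) ∘ φ.symm =ᶠ[𝓝 y] v := fun y hy ↦ by
    filter_upwards [hNo.mem_nhds hy] with z hz
    exact congrArg v (φ.right_inv (hNO hz).1)
  refine ⟨v ∘ φ, φ.source ∩ φ ⁻¹' N, (continuousOn_extChartAt p).isOpen_inter_preimage
    (isOpen_extChartAt_source p) hNo, ⟨hps, hpN⟩, ?_, ?_⟩
  · rintro x ⟨hx, hxN⟩
    have := (hNO hxN).2
    rwa [mem_preimage, φ.left_inv hx] at this
  rintro x ⟨hx, hxN⟩
  obtain ⟨h1, h2, h3, c, hc1, hc0, hc⟩ := hN (φ x) hxN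
  have hsm : ContMDiffAt 𝓘(ℝ, E) 𝓘(ℝ, ℝ) ∞ (v ∘ φ) x := contMDiffAt_comp_extChartAt hx (hvAt _ hxN)
  simp only [Function.comp_apply, φ.left_inv hx] at h2 h3
  refine ⟨hsm, ?_, h2, h3, φ.symm (c 0), hmem _ (hc 0 left_mem_uIcc).1, ?_, ?_⟩
  · have := norm_gradient_sq hx hsm
    rw [(hvφ _ hxN).fderiv_eq, h1] at this
    nlinarith [norm_nonneg (gradient 𝓘(ℝ, E) (v ∘ φ) x)]
  · simpa [φ.right_inv (hNO (hc 0 left_mem_uIcc).1).1] using hc0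
  · have hcx : φ.symm (c (v (φ x))) = x := by rw [hc1, φ.left_inv hx]
    rcases le_total 0 (v (φ x)) with h | h
    · rw [uIcc_of_le h] at hc
      have := dist_le_of_unit_speed (p := p) h (fun t ht ↦ (hNO (hc t ht).1).1)
        (fun t ht ↦ (hc t ht).2.1) (fun t ht ↦ (hc t ht).2.2)
        (fun t ht ↦ (hN _ (hc t ht).1).1)
      rw [hcx, dist_comm, sub_zero] at this
      rwa [← abs_of_nonneg h] at this
    · rw [uIcc_of_ge h] at hc
      have := dist_le_of_unit_speed (p := p) h (fun t ht ↦ (hNO (hc t ht).1).1)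
        (fun t ht ↦ (hc t ht).2.1) (fun t ht ↦ (hc t ht).2.2)
        (fun t ht ↦ (hN _ (hc t ht).1).1)
      rw [hcx, zero_sub] at this
      rwa [← abs_of_nonpos h] at this

/-- Near a regular boundary point, the signed distance is smooth with gradient of norm one. -/
theorem exists_signedDistance_eventuallyEq {Y : Set M} (hYc : IsClosed Y)
    (hY : Y ⊆ closure (interior Y)) {p : M} {f : M → ℝ}
    (hf : IsLocalDefiningFunction 𝓘(ℝ, E) Y p f) :
    ∃ N : Set M, IsOpen N ∧ p ∈ N ∧ ∀ x ∈ N,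
      ContMDiffAt 𝓘(ℝ, E) 𝓘(ℝ, ℝ) ∞ (signedDistance Y) x ∧
      ‖gradient 𝓘(ℝ, E) (signedDistance Y) x‖ = 1 ∧
      (x ∈ interior Y ↔ signedDistance Y x < 0) := by
  obtain ⟨hfp, hdf, U, hU, hpU, hfU, hint⟩ := hf
  obtain ⟨V, N, hNo, hpN, hNU, hN⟩ := exists_unit_gradient hU hpU hfU hfp hdf
  have hreg : ∀ x ∈ N, (x ∈ Y ↔ V x ≤ 0) ∧ (x ∈ frontier Y ↔ V x = 0) := fun x hx ↦
    mem_iff_le_zero_of_regular hYc hY hNo (fun x hx ↦ (hN x hx).1)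
      (fun x hx _ h ↦ by
        have := (hN x hx).2.1
        rw [gradient_eq_zero_iff.2 h] at this
        simp at this)
      (fun x hx ↦ by rw [hint x (hNU hx), (hN x hx).2.2.1]) hx
  obtain ⟨r, hr, hrN⟩ := Metric.isOpen_iff.1 hNo p hpN
  have hV0 : V p = 0 := (hN p hpN).2.2.2.1.2 hfp
  have hpF : p ∈ frontier Y := (hreg p hpN).2.2 hV0
  -- The radius `r / 2` ensures that the ball of radius `r / 2` about `x` still lies in `N`, where
  -- `V` has unit gradient and vanishes on the boundary.
  have hdist : ∀ x ∈ Metric.ball p (r / 2), ∀ q ∈ frontier Y, dist x q < r / 2 →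
      |V x| ≤ dist x q := fun x hx q hq hxq ↦ by
    have hsub : Metric.ball x (r / 2) ⊆ N := fun z hz ↦ hrN (by
      rw [Metric.mem_ball] at *
      linarith [dist_triangle z x p])
    have := abs_sub_le_dist (fun z hz ↦ (hN z (hsub hz)).1) (fun z hz ↦ (hN z (hsub hz)).2.1.le) hxq
    rwa [(hreg q (hsub (by rwa [Metric.mem_ball, dist_comm]))).2.1 hq, zero_sub, abs_neg] at this
  have hinf : ∀ x ∈ Metric.ball p (r / 2), Metric.infDist x (frontier Y) = |V x| := fun x hx ↦ by
    have hxN : x ∈ N := hrN (Metric.ball_subset_ball (by linarith) hx)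
    refine le_antisymm ?_ ?_
    · obtain ⟨q, hqN, hq0, hq⟩ := (hN x hxN).2.2.2.2
      exact (Metric.infDist_le_dist_of_mem ((hreg q hqN).2.2 hq0)).trans hq
    · rw [Metric.le_infDist ⟨p, hpF⟩]
      intro q hq
      rcases lt_or_ge (dist x q) (r / 2) with h | h
      · exact hdist x hx q hq h
      -- Boundary points at distance at least `r / 2` are no closer to `x` than `p`, for which the
      -- bound is known.
      · exact (hdist x hx p hpF hx).trans (hx.le.trans h)
  have hsd : ∀ x ∈ Metric.ball p (r / 2), signedDistance Y x = V x := fun x hx ↦ by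
    have hxN : x ∈ N := hrN (Metric.ball_subset_ball (by linarith) hx)
    have h1 := (hreg x hxN).1
    rw [signedDistance, hinf x hx]
    split_ifs with h
    · rw [abs_of_nonpos (h1.1 h), neg_neg]
    · exact abs_of_nonneg (not_le.1 fun h' ↦ h (h1.2 h')).le
  refine ⟨Metric.ball p (r / 2), Metric.isOpen_ball, Metric.mem_ball_self (by linarith),
    fun x hx ↦ ?_⟩
  have hxN : x ∈ N := hrN (Metric.ball_subset_ball (by linarith) hx)
  have hev : signedDistance Y =ᶠ[𝓝 x] V := by
    filter_upwards [Metric.isOpen_ball.mem_nhds hx] with z hz using hsd z hz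
  refine ⟨(hN x hxN).1.congr_of_eventuallyEq hev, ?_, ?_⟩
  · rw [gradient_congr hev]; exact (hN x hxN).2.1
  · rw [hint x (hNU hxN), hsd x hx, (hN x hxN).2.2.1]

end SignedDistance

/-! ### Symmetry, kernel and continuity of the Hessian -/

section Hessian

variable {E : Type*} [NormedAddCommGroup E] [NormedSpace ℝ E] [FiniteDimensional ℝ E]
  {M : Type*} [TopologicalSpace M] [ChartedSpace E M] [IsManifold 𝓘(ℝ, E) ∞ M]
  [RiemannianBundle (fun x : M ↦ TangentSpace 𝓘(ℝ, E) x)]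
  [IsContMDiffRiemannianBundle 𝓘(ℝ, E) ∞ E (fun x : M ↦ TangentSpace 𝓘(ℝ, E) x)]

lemma hessian_eq_koszul {f : M → ℝ} {x : M} {X Z : Π x : M, TangentSpace 𝓘(ℝ, E) x}
    (hf : MDiffAt (T% (gradient 𝓘(ℝ, E) f)) x) (hX : MDiffAt (T% X) x) (hZ : MDiffAt (T% Z) x) :
    hessian 𝓘(ℝ, E) f x (X x) (Z x) = 1 / 2 * koszul 𝓘(ℝ, E) (gradient 𝓘(ℝ, E) f) X Z x :=
  inner_leviCivitaFun 𝓘(ℝ, E) hX hf hZ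

lemma hessian_add_left (f : M → ℝ) (x : M) (u v w : TangentSpace 𝓘(ℝ, E) x) :
    hessian 𝓘(ℝ, E) f x (u + v) w = hessian 𝓘(ℝ, E) f x u w + hessian 𝓘(ℝ, E) f x v w := by
  simp only [hessian, map_add, inner_add_left]

lemma hessian_add_right (f : M → ℝ) (x : M) (u v w : TangentSpace 𝓘(ℝ, E) x) :
    hessian 𝓘(ℝ, E) f x u (v + w) = hessian 𝓘(ℝ, E) f x u v + hessian 𝓘(ℝ, E) f x u w := by
  simp only [hessian, inner_add_right]

lemma hessian_smul_left (f : M → ℝ) (x : M) (c : ℝ) (u w : TangentSpace 𝓘(ℝ, E) x) :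
    hessian 𝓘(ℝ, E) f x (c • u) w = c * hessian 𝓘(ℝ, E) f x u w := by
  simp only [hessian, map_smul, real_inner_smul_left]

lemma hessian_smul_right (f : M → ℝ) (x : M) (c : ℝ) (u w : TangentSpace 𝓘(ℝ, E) x) :
    hessian 𝓘(ℝ, E) f x u (c • w) = c * hessian 𝓘(ℝ, E) f x u w := by
  simp only [hessian, real_inner_smul_right]

lemma eventually_contMDiffAt_chartField {p x : M} (hx : x ∈ (extChartAt 𝓘(ℝ, E) p).source) (v : E) :
    ∀ᶠ z in 𝓝 x, ContMDiffAt 𝓘(ℝ, E) 𝓘(ℝ, E).tangent ∞ (T% (chartField p (fun _ ↦ v))) z := by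
  filter_upwards [(isOpen_extChartAt_source (I := 𝓘(ℝ, E)) p).mem_nhds hx] with z hz
    using contMDiffAt_chartField hz contDiffAt_const

lemma mdifferentiableAt_gradient {f : M → ℝ} {x : M}
    (hf : ∀ᶠ z in 𝓝 x, ContMDiffAt 𝓘(ℝ, E) 𝓘(ℝ, ℝ) ∞ f z) :
    MDiffAt (T% (gradient 𝓘(ℝ, E) f)) x :=
  (contMDiffAt_gradient hf).mdifferentiableAt (by simp)

/-- The derivative of `df(X_w)` along a coordinate field is a second derivative. -/
lemma mvfderiv_inner_gradient_chartField {f : M → ℝ} {x : M}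
    (hf : ∀ᶠ z in 𝓝 x, ContMDiffAt 𝓘(ℝ, E) 𝓘(ℝ, ℝ) ∞ f z) (v w : E) :
    mvfderiv 𝓘(ℝ, E) (fun y ↦ (inner ℝ (gradient 𝓘(ℝ, E) f y) (chartField x (fun _ ↦ w) y) : ℝ)) x
      (chartField x (fun _ ↦ v) x)
      = fderiv ℝ (fderiv ℝ (f ∘ (extChartAt 𝓘(ℝ, E) x).symm)) (extChartAt 𝓘(ℝ, E) x x) v w := by
  have hx := mem_extChartAt_source (I := 𝓘(ℝ, E)) x
  have hF : ContDiffAt ℝ ∞ (f ∘ (extChartAt 𝓘(ℝ, E) x).symm) (extChartAt 𝓘(ℝ, E) x x) :=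
    contDiffAt_comp_extChartAt_symm ((extChartAt 𝓘(ℝ, E) x).map_source hx) (by
      rw [(extChartAt 𝓘(ℝ, E) x).left_inv hx]; exact hf.self_of_nhds)
  have hdF := (hF.fderiv_right (m := ∞) (by simp)).differentiableAt (by simp)
  have h1 : (fun y ↦ (inner ℝ (gradient 𝓘(ℝ, E) f y) (chartField x (fun _ ↦ w) y) : ℝ))
      =ᶠ[𝓝 x] (fun y ↦ fderiv ℝ (f ∘ (extChartAt 𝓘(ℝ, E) x).symm) y w) ∘ extChartAt 𝓘(ℝ, E) x := by
    filter_upwards [(isOpen_extChartAt_source (I := 𝓘(ℝ, E)) x).mem_nhds hx, hf] with z hz hfz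
    rw [inner_gradient, mvfderiv_chartField hz hfz]
    rfl
  rw [mvfderiv_congr h1, mvfderiv_eq_fderiv_comp_chartCoord hx
    (hdF.clm_apply (differentiableAt_const w)), ContinuousLinearMap.comp_apply,
    chartCoord_chartField hx, fderiv_clm_apply hdF (differentiableAt_const w)]
  simp

/-- For coordinate fields `X`, `Z`, the Koszul expressions of the two sides differ by `2 (X(Zf) -
Z(Xf))`, which vanishes by the symmetry of second derivatives in the chart. -/
lemma hessian_symm {f : M → ℝ} {x : M}
    (hf : ∀ᶠ z in 𝓝 x, ContMDiffAt 𝓘(ℝ, E) 𝓘(ℝ, ℝ) ∞ f z) (u w : TangentSpace 𝓘(ℝ, E) x) :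
    hessian 𝓘(ℝ, E) f x u w = hessian 𝓘(ℝ, E) f x w u := by
  have hx := mem_extChartAt_source (I := 𝓘(ℝ, E)) x
  rw [← chartField_chartCoord hx u, ← chartField_chartCoord hx w]
  generalize chartCoord x x u = a
  generalize chartCoord x x w = b
  have hY := mdifferentiableAt_gradient hf
  have hF : ContDiffAt ℝ ∞ (f ∘ (extChartAt 𝓘(ℝ, E) x).symm) (extChartAt 𝓘(ℝ, E) x x) :=
    contDiffAt_comp_extChartAt_symm ((extChartAt 𝓘(ℝ, E) x).map_source hx) (by
      rw [(extChartAt 𝓘(ℝ, E) x).left_inv hx]; exact hf.self_of_nhds)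
  have hs := hF.isSymmSndFDerivAt (by
    rw [minSmoothness_of_isRCLikeNormedField]
    exact WithTop.coe_le_coe.2 (le_top : (2 : ℕ∞) ≤ ⊤)) a b
  rw [← mvfderiv_inner_gradient_chartField hf, ← mvfderiv_inner_gradient_chartField hf] at hs
  rw [hessian_eq_koszul hY (mdifferentiableAt_chartField_const hx a)
    (mdifferentiableAt_chartField_const hx b), hessian_eq_koszul hY
    (mdifferentiableAt_chartField_const hx b) (mdifferentiableAt_chartField_const hx a)]
  set X := chartField x (fun _ ↦ a)
  set Z := chartField x (fun _ ↦ b)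
  set Y := gradient 𝓘(ℝ, E) f
  have e1 : (fun y ↦ (inner ℝ (X y) (Y y) : ℝ)) = fun y ↦ inner ℝ (Y y) (X y) :=
    funext fun y ↦ real_inner_comm _ _
  have e2 : (fun y ↦ (inner ℝ (Z y) (Y y) : ℝ)) = fun y ↦ inner ℝ (Y y) (Z y) :=
    funext fun y ↦ real_inner_comm _ _
  have e3 : (fun y ↦ (inner ℝ (Z y) (X y) : ℝ)) = fun y ↦ inner ℝ (X y) (Z y) :=
    funext fun y ↦ real_inner_comm _ _
  have b1 : VectorField.mlieBracket 𝓘(ℝ, E) X Z x = 0 := mlieBracket_chartField_const hx a b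
  have b2 : VectorField.mlieBracket 𝓘(ℝ, E) Z X x = 0 := mlieBracket_chartField_const hx b a
  have b3 := VectorField.mlieBracket_swap_apply (I := 𝓘(ℝ, E)) (V := X) (W := Y) (x := x)
  have b4 := VectorField.mlieBracket_swap_apply (I := 𝓘(ℝ, E)) (V := Z) (W := Y) (x := x)
  simp only [koszul, e1, e2, e3, b1, b2, b3, b4, inner_neg_left, inner_zero_left]
  rw [hs]
  ring

/-- The gradient of a function with gradient of norm one is in the kernel of its Hessian. -/
lemma hessian_gradient_right {f : M → ℝ} {x : M}
    (hf : ∀ᶠ z in 𝓝 x, ContMDiffAt 𝓘(ℝ, E) 𝓘(ℝ, ℝ) ∞ f z)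
    (hgrad : ∀ᶠ z in 𝓝 x, ‖gradient 𝓘(ℝ, E) f z‖ = 1) (u : TangentSpace 𝓘(ℝ, E) x) :
    hessian 𝓘(ℝ, E) f x u (gradient 𝓘(ℝ, E) f x) = 0 := by
  have hx := mem_extChartAt_source (I := 𝓘(ℝ, E)) x
  have hY := mdifferentiableAt_gradient hf
  have h := mvfderiv_inner_eq_leviCivita 𝓘(ℝ, E)
    (mdifferentiableAt_chartField_const hx (chartCoord x x u)) hY hY
  have h1 : (fun y ↦ (inner ℝ (gradient 𝓘(ℝ, E) f y) (gradient 𝓘(ℝ, E) f y) : ℝ))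
      =ᶠ[𝓝 x] fun _ ↦ 1 := by
    filter_upwards [hgrad] with z hz
    rw [real_inner_self_eq_norm_sq, hz, one_pow]
  rw [mvfderiv_congr h1, mvfderiv_const, chartField_chartCoord hx, zero_apply] at h
  rw [real_inner_comm] at h
  rw [real_inner_comm] at h
  rw [hessian]
  have h2 := real_inner_comm (gradient 𝓘(ℝ, E) f x) (leviCivita 𝓘(ℝ, E) (gradient 𝓘(ℝ, E) f) x u)
  linarith

/-- The gradient is in the kernel on both sides by symmetry, so only the component orthogonal to it
contributes. -/
lemma hessian_self_eq_of_unit_gradient {f : M → ℝ} {x : M}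
    (hf : ∀ᶠ z in 𝓝 x, ContMDiffAt 𝓘(ℝ, E) 𝓘(ℝ, ℝ) ∞ f z)
    (hgrad : ∀ᶠ z in 𝓝 x, ‖gradient 𝓘(ℝ, E) f z‖ = 1) (u : TangentSpace 𝓘(ℝ, E) x) (c : ℝ) :
    hessian 𝓘(ℝ, E) f x (u + c • gradient 𝓘(ℝ, E) f x) (u + c • gradient 𝓘(ℝ, E) f x)
      = hessian 𝓘(ℝ, E) f x u u := by
  rw [hessian_add_right, hessian_smul_right, hessian_gradient_right hf hgrad, mul_zero, add_zero,
    hessian_add_left, hessian_smul_left, hessian_symm hf (gradient 𝓘(ℝ, E) f x),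
    hessian_gradient_right hf hgrad, mul_zero, add_zero]

lemma contMDiffAt_mvfderiv_apply {g : M → ℝ} {A : Π x : M, TangentSpace 𝓘(ℝ, E) x} {x : M}
    (hg : ∀ᶠ z in 𝓝 x, ContMDiffAt 𝓘(ℝ, E) 𝓘(ℝ, ℝ) ∞ g z)
    (hA : ContMDiffAt 𝓘(ℝ, E) 𝓘(ℝ, E).tangent ∞ (T% A) x) :
    ContMDiffAt 𝓘(ℝ, E) 𝓘(ℝ, ℝ) ∞ (fun y ↦ mvfderiv 𝓘(ℝ, E) g y (A y)) x := by
  simp only [← inner_gradient]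
  exact contMDiffAt_inner (contMDiffAt_gradient hg) hA

lemma contMDiffAt_mlieBracket {X Y : Π x : M, TangentSpace 𝓘(ℝ, E) x} {x : M}
    (hX : ContMDiffAt 𝓘(ℝ, E) 𝓘(ℝ, E).tangent ∞ (T% X) x)
    (hY : ContMDiffAt 𝓘(ℝ, E) 𝓘(ℝ, E).tangent ∞ (T% Y) x) :
    ContMDiffAt 𝓘(ℝ, E) 𝓘(ℝ, E).tangent ∞ (T% (VectorField.mlieBracket 𝓘(ℝ, E) X Y)) x := by
  have h : IsManifold 𝓘(ℝ, E) (((⊤ : ℕ∞) : WithTop ℕ∞) + 1) M := by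
    simpa using ‹IsManifold 𝓘(ℝ, E) ∞ M›
  have h2 : IsManifold 𝓘(ℝ, E) (minSmoothness ℝ 2) M := by
    rw [minSmoothness_of_isRCLikeNormedField]; infer_instance
  have h3 : IsManifold 𝓘(ℝ, E) (minSmoothness ℝ 3) M := by
    rw [minSmoothness_of_isRCLikeNormedField]; infer_instance
  exact ContMDiffAt.mlieBracket_vectorField (m := ⊤) (n := ⊤) hX hY
    (by rw [minSmoothness_of_isRCLikeNormedField]; simp)

/-- Through the Koszul formula this gives continuity of the Hessian on coordinate fields. -/
lemma contMDiffAt_koszul {X Y Z : Π x : M, TangentSpace 𝓘(ℝ, E) x} {x : M}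
    (hX : ∀ᶠ z in 𝓝 x, ContMDiffAt 𝓘(ℝ, E) 𝓘(ℝ, E).tangent ∞ (T% X) z)
    (hY : ∀ᶠ z in 𝓝 x, ContMDiffAt 𝓘(ℝ, E) 𝓘(ℝ, E).tangent ∞ (T% Y) z)
    (hZ : ∀ᶠ z in 𝓝 x, ContMDiffAt 𝓘(ℝ, E) 𝓘(ℝ, E).tangent ∞ (T% Z) z) :
    ContMDiffAt 𝓘(ℝ, E) 𝓘(ℝ, ℝ) ∞ (koszul 𝓘(ℝ, E) Y X Z) x := by
  have hX' := hX.self_of_nhds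
  have hY' := hY.self_of_nhds
  have hZ' := hZ.self_of_nhds
  refine ((((((contMDiffAt_mvfderiv_apply ?_ hX').add (contMDiffAt_mvfderiv_apply ?_ hY')).sub
    (contMDiffAt_mvfderiv_apply ?_ hZ')).add
    (contMDiffAt_inner (contMDiffAt_mlieBracket hX' hY') hZ')).sub
    (contMDiffAt_inner (contMDiffAt_mlieBracket hX' hZ') hY')).sub
    (contMDiffAt_inner (contMDiffAt_mlieBracket hY' hZ') hX'))
  · filter_upwards [hY, hZ] with z h1 h2 using contMDiffAt_inner h1 h2
  · filter_upwards [hX, hZ] with z h1 h2 using contMDiffAt_inner h1 h2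
  · filter_upwards [hX, hY] with z h1 h2 using contMDiffAt_inner h1 h2

lemma continuousAt_hessian_chartField {f : M → ℝ} {p x : M}
    (hx : x ∈ (extChartAt 𝓘(ℝ, E) p).source)
    (hf : ∀ᶠ z in 𝓝 x, ContMDiffAt 𝓘(ℝ, E) 𝓘(ℝ, ℝ) ∞ f z) (v w : E) :
    ContinuousAt (fun y ↦ hessian 𝓘(ℝ, E) f y (chartField p (fun _ ↦ v) y)
      (chartField p (fun _ ↦ w) y)) x := by
  have hf' := hf.eventually_nhds
  have h := (contMDiffAt_koszul (eventually_contMDiffAt_chartField hx v)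
    (hf'.mono fun z hz ↦ contMDiffAt_gradient hz)
    (eventually_contMDiffAt_chartField hx w)).continuousAt
  refine (h.const_mul (1 / 2)).congr ?_
  filter_upwards [(isOpen_extChartAt_source (I := 𝓘(ℝ, E)) p).mem_nhds hx, hf'] with z hz hfz
  exact (hessian_eq_koszul (mdifferentiableAt_gradient hfz)
    (mdifferentiableAt_chartField_const hz v) (mdifferentiableAt_chartField_const hz w)).symm

/-- The coordinate expression of the bilinear form `Hess f - c ⟨·,·⟩`. -/
noncomputable def hessianForm (p : M) (f : M → ℝ) (c : ℝ) (x : M) : E →L[ℝ] E →L[ℝ] ℝ :=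
  let A : E →L[ℝ] TangentSpace 𝓘(ℝ, E) x :=
    (leviCivita 𝓘(ℝ, E) (gradient 𝓘(ℝ, E) f) x - c • ContinuousLinearMap.id ℝ _).comp
      (chartLift E p x)
  LinearMap.toContinuousLinearMap
    { toFun v := (innerSL ℝ (A v)).comp (chartLift E p x)
      map_add' v w := by rw [map_add, map_add]; rfl
      map_smul' a v := by rw [map_smul, map_smul]; rfl }

lemma hessianForm_apply (p : M) (f : M → ℝ) (c : ℝ) (x : M) (v w : E) :
    hessianForm p f c x v w = hessian 𝓘(ℝ, E) f x (chartField p (fun _ ↦ v) x)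
      (chartField p (fun _ ↦ w) x)
      - c * inner ℝ (chartField p (fun _ ↦ v) x) (chartField p (fun _ ↦ w) x) := by
  rw [hessian, ← real_inner_smul_left, ← inner_sub_left]
  rfl

/-- By compactness of the unit sphere, positivity at `p` holds with a margin `m`; a perturbation of
operator norm below `m` cannot destroy nonnegativity. -/
lemma eventually_nonneg_of_pos {T : Type*} [TopologicalSpace T] {B : T → E →L[ℝ] E →L[ℝ] ℝ} {p : T}
    (hB : ContinuousAt B p) (hpos : ∀ v ≠ 0, 0 < B p v v) : ∀ᶠ x in 𝓝 p, ∀ v, 0 ≤ B x v v := by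
  obtain ⟨m, hm, hBm⟩ : ∃ m > 0, ∀ v ∈ Metric.sphere (0 : E) 1, m ≤ B p v v := by
    rcases (Metric.sphere (0 : E) 1).eq_empty_or_nonempty with h | h
    · exact ⟨1, one_pos, by simp [h]⟩
    · obtain ⟨v, hv, hmin⟩ := (isCompact_sphere (0 : E) 1).exists_isMinOn h
        (f := fun v ↦ B p v v) (by fun_prop)
      refine ⟨B p v v, hpos v ?_, fun w hw ↦ hmin hw⟩
      rintro rfl
      simp at hv
  filter_upwards [hB.eventually (Metric.ball_mem_nhds (B p) hm)] with x hx v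
  rcases eq_or_ne v 0 with rfl | hv
  · simp
  have hv' : 0 < ‖v‖ := norm_pos_iff.2 hv
  have h1 : m * ‖v‖ ^ 2 ≤ B p v v := by
    have := hBm (‖v‖⁻¹ • v) (by simp [norm_smul, hv'.ne'])
    simp only [map_smul, smul_apply, smul_eq_mul] at this
    have h2 := mul_le_mul_of_nonneg_right this (sq_nonneg ‖v‖)
    have h3 : ‖v‖⁻¹ * (‖v‖⁻¹ * B p v v) * ‖v‖ ^ 2 = B p v v := by field_simp
    rwa [h3] at h2
  have h2 : |(B x - B p) v v| ≤ m * ‖v‖ ^ 2 := by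
    refine ((B x - B p).le_opNorm₂ v v).trans ?_
    rw [mul_assoc, ← sq]
    exact mul_le_mul_of_nonneg_right ((dist_eq_norm (B x) (B p)) ▸ hx.le) (sq_nonneg _)
  have h3 := (abs_le.1 h2).1
  simp only [sub_apply] at h3
  linarith

/-- A strict lower bound of the Hessian at a point persists near this point. -/
lemma eventually_hessian_ge {f : M → ℝ} {p : M} {c c' : ℝ} (hc : c' < c)
    (hf : ∀ᶠ z in 𝓝 p, ContMDiffAt 𝓘(ℝ, E) 𝓘(ℝ, ℝ) ∞ f z)
    (h : ∀ u : TangentSpace 𝓘(ℝ, E) p, c * ‖u‖ ^ 2 ≤ hessian 𝓘(ℝ, E) f p u u) :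
    ∀ᶠ x in 𝓝 p, ∀ u : TangentSpace 𝓘(ℝ, E) x, c' * ‖u‖ ^ 2 ≤ hessian 𝓘(ℝ, E) f x u u := by
  have hp := mem_extChartAt_source (I := 𝓘(ℝ, E)) p
  obtain ⟨U, hU, hUo, hpU⟩ := eventually_nhds_iff.1
    (hf.eventually_nhds.and ((isOpen_extChartAt_source (I := 𝓘(ℝ, E)) p).mem_nhds hp))
  have hcont : ContinuousOn (hessianForm (E := E) p f c') U := by
    refine continuousOn_clm_apply.2 fun v ↦ continuousOn_clm_apply.2 fun w x hx ↦ ?_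
    refine ContinuousAt.continuousWithinAt ?_
    simp only [hessianForm_apply]
    exact (continuousAt_hessian_chartField (hU x hx).2 (hU x hx).1 v w).sub
      ((contMDiffAt_inner (contMDiffAt_chartField (hU x hx).2 contDiffAt_const)
        (contMDiffAt_chartField (hU x hx).2 contDiffAt_const)).continuousAt.const_mul _)
  -- The gap `c' < c` makes `Hess f - c' ⟨·,·⟩` positive definite at `p`, an open condition.
  have hpos : ∀ v : E, v ≠ 0 → 0 < hessianForm p f c' p v v := fun v hv ↦ by
    rw [hessianForm_apply, real_inner_self_eq_norm_sq]
    have h1 := h (chartField p (fun _ ↦ v) p)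
    have h2 : 0 < ‖chartField p (fun _ ↦ v) p‖ := by
      refine norm_pos_iff.2 fun h0 ↦ hv ?_
      have := chartCoord_chartField hp (fun _ ↦ v)
      rw [h0, map_zero] at this
      exact this.symm
    nlinarith [mul_pos (sub_pos.2 hc) (pow_pos h2 2)]
  filter_upwards [eventually_nonneg_of_pos (hcont.continuousAt (hUo.mem_nhds hpU)) hpos,
    hUo.mem_nhds hpU] with x hx hxU u
  have h1 := hx (chartCoord p x u)
  rw [hessianForm_apply, chartField_chartCoord (hU x hxU).2, real_inner_self_eq_norm_sq] at h1
  linarith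

end Hessian

/-! ### Independence of the choice of defining function -/

section DefiningFunction

variable {E : Type*} [NormedAddCommGroup E] [NormedSpace ℝ E] [FiniteDimensional ℝ E]
  {M : Type*} [TopologicalSpace M] [ChartedSpace E M] [IsManifold 𝓘(ℝ, E) ∞ M]

lemma IsLocalDefiningFunction.eventually_contMDiffAt {D : Set M} {x : M} {f : M → ℝ}
    (hf : IsLocalDefiningFunction 𝓘(ℝ, E) D x f) :
    ∀ᶠ z in 𝓝 x, ContMDiffAt 𝓘(ℝ, E) 𝓘(ℝ, ℝ) ∞ f z := by
  obtain ⟨-, -, U, hU, hxU, hfU, -⟩ := hf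
  filter_upwards [hU.mem_nhds hxU] with z hz using hfU.contMDiffAt (hU.mem_nhds hz)

lemma IsLocalDefiningFunction.eventually_mem_interior_iff {D : Set M} {x : M} {f : M → ℝ}
    (hf : IsLocalDefiningFunction 𝓘(ℝ, E) D x f) :
    ∀ᶠ z in 𝓝 x, (z ∈ interior D ↔ f z < 0) := by
  obtain ⟨-, -, U, hU, hxU, -, hint⟩ := hf
  filter_upwards [hU.mem_nhds hxU] with z hz using hint z hz

lemma eventually_neg_of_hasDerivAt {h : ℝ → ℝ} {h' : ℝ} (hd : HasDerivAt h h' 0) (h0 : h 0 = 0)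
    (hneg : h' < 0) : ∀ᶠ t in 𝓝[>] (0 : ℝ), h t < 0 := by
  filter_upwards [hd.tendsto_slope_zero_right.eventually (gt_mem_nhds hneg),
    self_mem_nhdsWithin] with t ht hpos
  rw [zero_add, h0, sub_zero, smul_eq_mul] at ht
  have hpos' : 0 < t⁻¹ := inv_pos.2 hpos
  by_contra! hle
  exact absurd ht (not_lt.2 (mul_nonneg hpos'.le hle))

lemma hasDerivAt_comp_extChartAt_symm_line {f : M → ℝ} {x : M}
    (hf : ContMDiffAt 𝓘(ℝ, E) 𝓘(ℝ, ℝ) ∞ f x) (u : TangentSpace 𝓘(ℝ, E) x) :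
    HasDerivAt (fun t : ℝ ↦ f ((extChartAt 𝓘(ℝ, E) x).symm
      (extChartAt 𝓘(ℝ, E) x x + t • chartCoord x x u))) (mvfderiv 𝓘(ℝ, E) f x u) 0 := by
  have hx := mem_extChartAt_source (I := 𝓘(ℝ, E)) x
  have hF : ContDiffAt ℝ ∞ (f ∘ (extChartAt 𝓘(ℝ, E) x).symm) (extChartAt 𝓘(ℝ, E) x x) :=
    contDiffAt_comp_extChartAt_symm ((extChartAt 𝓘(ℝ, E) x).map_source hx) (by
      rwa [(extChartAt 𝓘(ℝ, E) x).left_inv hx])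
  rw [mvfderiv_eq_fderiv_chart hx hf, ContinuousLinearMap.comp_apply]
  exact (hF.differentiableAt (by simp)).hasFDerivAt.hasLineDerivAt _

/-- Directions pointing strictly inside for one defining function do not point strictly outside
for another one. -/
lemma IsLocalDefiningFunction.mvfderiv_nonpos {D : Set M} {x : M} {f g : M → ℝ}
    (hf : IsLocalDefiningFunction 𝓘(ℝ, E) D x f) (hg : IsLocalDefiningFunction 𝓘(ℝ, E) D x g)
    {u : TangentSpace 𝓘(ℝ, E) x} (hu : mvfderiv 𝓘(ℝ, E) f x u < 0) :
    mvfderiv 𝓘(ℝ, E) g x u ≤ 0 := by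
  have hx := mem_extChartAt_source (I := 𝓘(ℝ, E)) x
  by_contra! hpos
  have hzero : (extChartAt 𝓘(ℝ, E) x).symm (extChartAt 𝓘(ℝ, E) x x + (0 : ℝ) • chartCoord x x u)
      = x := by
    rw [zero_smul, add_zero, (extChartAt 𝓘(ℝ, E) x).left_inv hx]
  have h1 := eventually_neg_of_hasDerivAt
    (hasDerivAt_comp_extChartAt_symm_line hf.eventually_contMDiffAt.self_of_nhds u)
    (by rw [hzero]; exact hf.1) hu
  have h2 := eventually_neg_of_hasDerivAt
    (hasDerivAt_comp_extChartAt_symm_line hg.eventually_contMDiffAt.self_of_nhds u).fun_neg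
    (by rw [hzero, hg.1, neg_zero]) (neg_lt_zero.2 hpos)
  have hcont : ContinuousAt (fun t : ℝ ↦ (extChartAt 𝓘(ℝ, E) x).symm
      (extChartAt 𝓘(ℝ, E) x x + t • chartCoord x x u)) 0 := by
    refine ContinuousAt.comp (g := (extChartAt 𝓘(ℝ, E) x).symm) ?_ (by fun_prop)
    rw [zero_smul, add_zero]
    exact continuousAt_extChartAt_symm x
  have h3 := hcont.tendsto.mono_left (nhdsWithin_le_nhds (s := Ioi 0))
  rw [hzero] at h3
  obtain ⟨t, ht1, ht2, ht3, ht4⟩ := (h1.and (h2.and ((h3.eventually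
    hf.eventually_mem_interior_iff).and (h3.eventually hg.eventually_mem_interior_iff)))).exists
  have := ht4.1 (ht3.2 ht1)
  linarith

/-- If `df(w) < 0`, then `df(w + t u) < 0` for every `t`, so `dg(w) + t dg(u) ≤ 0` for all real `t`,
which forces `dg(u) = 0`. -/
lemma IsLocalDefiningFunction.mvfderiv_eq_zero {D : Set M} {x : M} {f g : M → ℝ}
    (hf : IsLocalDefiningFunction 𝓘(ℝ, E) D x f) (hg : IsLocalDefiningFunction 𝓘(ℝ, E) D x g)
    {u : TangentSpace 𝓘(ℝ, E) x} (hu : mvfderiv 𝓘(ℝ, E) f x u = 0) :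
    mvfderiv 𝓘(ℝ, E) g x u = 0 := by
  obtain ⟨w, hw⟩ : ∃ w, mvfderiv 𝓘(ℝ, E) f x w < 0 := by
    obtain ⟨w, hw⟩ := DFunLike.ne_iff.1 hf.2.1
    rcases lt_or_gt_of_ne hw with h | h
    · exact ⟨w, h⟩
    · exact ⟨-w, by rw [map_neg]; exact neg_lt_zero.2 h⟩
  have key : ∀ t : ℝ, mvfderiv 𝓘(ℝ, E) g x w + t * mvfderiv 𝓘(ℝ, E) g x u ≤ 0 := fun t ↦ by
    have := hf.mvfderiv_nonpos hg (u := w + t • u) (by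
      rw [map_add, map_smul, hu, smul_zero, add_zero]; exact hw)
    rwa [map_add, map_smul, smul_eq_mul] at this
  by_contra hne
  have h := key ((1 - mvfderiv 𝓘(ℝ, E) g x w) / mvfderiv 𝓘(ℝ, E) g x u)
  rw [div_mul_cancel₀ _ hne] at h
  linarith

lemma IsLocalDefiningFunction.mvfderiv_neg {D : Set M} {x : M} {f g : M → ℝ}
    (hf : IsLocalDefiningFunction 𝓘(ℝ, E) D x f) (hg : IsLocalDefiningFunction 𝓘(ℝ, E) D x g)
    {u : TangentSpace 𝓘(ℝ, E) x} (hu : mvfderiv 𝓘(ℝ, E) f x u < 0) :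
    mvfderiv 𝓘(ℝ, E) g x u < 0 :=
  (hf.mvfderiv_nonpos hg hu).lt_of_ne fun h ↦ hu.ne (hg.mvfderiv_eq_zero hf h)

/-- All defining functions have the same kernel at `x`, so testing a single one suffices. -/
lemma IsLocalDefiningFunction.isTangentToBoundary_iff {D : Set M} {x : M} {f : M → ℝ}
    (hf : IsLocalDefiningFunction 𝓘(ℝ, E) D x f) {u : TangentSpace 𝓘(ℝ, E) x} :
    IsTangentToBoundary 𝓘(ℝ, E) D x u ↔ mvfderiv 𝓘(ℝ, E) f x u = 0 :=
  ⟨fun h ↦ h f hf, fun h _ hg ↦ hf.mvfderiv_eq_zero hg h⟩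

/-- An open set with smooth boundary is the interior of its closure. -/
lemma HasSmoothBoundary.interior_closure {Ω : Set M} (hΩ : IsOpen Ω)
    (h : HasSmoothBoundary 𝓘(ℝ, E) Ω) : interior (closure Ω) = Ω := by
  refine Subset.antisymm (fun x hx ↦ ?_) (interior_maximal subset_closure hΩ)
  by_contra hxΩ
  have hxF : x ∈ frontier Ω := by
    rw [hΩ.frontier_eq]
    exact ⟨interior_subset hx, hxΩ⟩
  obtain ⟨f, hf⟩ := h x hxF
  have hsm := hf.eventually_contMDiffAt
  -- Arbitrarily close to `x` there are points with `f > 0`. One inside the interior of the closure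
  -- is a limit of points of `Ω`, where `f < 0`: a contradiction.
  have h1 := exists_pos_of_mvfderiv_ne_zero hsm.self_of_nhds hf.1 hf.2.1
  obtain ⟨z, ⟨hz1, hz2, hz3⟩, hz⟩ := mem_closure_iff_nhds.1 h1 _
    (Filter.inter_mem (mem_interior_iff_mem_nhds.1 hx)
      (hsm.and hf.eventually_mem_interior_iff.eventually_nhds))
  obtain ⟨y, ⟨hy1, hy2⟩, hy⟩ := mem_closure_iff_nhds.1 hz1 _
    (Filter.inter_mem (hz2.continuousAt.preimage_mem_nhds (Ioi_mem_nhds hz)) hz3)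
  rw [hΩ.interior_eq] at hy2
  exact lt_asymm hy1 (hy2.1 hy)

lemma HasSmoothBoundary.frontier_closure {Ω : Set M} (hΩ : IsOpen Ω)
    (h : HasSmoothBoundary 𝓘(ℝ, E) Ω) : frontier (closure Ω) = frontier Ω := by
  rw [frontier, closure_closure, h.interior_closure hΩ, hΩ.frontier_eq]

lemma HasSmoothBoundary.closure {Ω : Set M} (hΩ : IsOpen Ω)
    (h : HasSmoothBoundary 𝓘(ℝ, E) Ω) : HasSmoothBoundary 𝓘(ℝ, E) (closure Ω) := by
  intro x hx
  rw [h.frontier_closure hΩ] at hx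
  obtain ⟨f, h1, h2, U, h3, h4, h5, h6⟩ := h x hx
  refine ⟨f, h1, h2, U, h3, h4, h5, fun y hy ↦ ?_⟩
  rw [h.interior_closure hΩ, ← h6 y hy, hΩ.interior_eq]

/-- A function that vanishes on the regular level set `{f = 0}` has zero derivative in the
directions tangent to it. -/
lemma mvfderiv_eq_zero_of_vanishes {f g : M → ℝ} {x : M}
    (hf : ContMDiffAt 𝓘(ℝ, E) 𝓘(ℝ, ℝ) ∞ f x) (hg : ContMDiffAt 𝓘(ℝ, E) 𝓘(ℝ, ℝ) ∞ g x)
    (hfx : f x = 0) (hdf : mvfderiv 𝓘(ℝ, E) f x ≠ 0) (h : ∀ᶠ z in 𝓝 x, f z = 0 → g z = 0)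
    {u : TangentSpace 𝓘(ℝ, E) x} (hu : mvfderiv 𝓘(ℝ, E) f x u = 0) :
    mvfderiv 𝓘(ℝ, E) g x u = 0 := by
  have hx := mem_extChartAt_source (I := 𝓘(ℝ, E)) x
  have hy := (extChartAt 𝓘(ℝ, E) x).map_source hx
  have hF : ContDiffAt ℝ ∞ (f ∘ (extChartAt 𝓘(ℝ, E) x).symm) (extChartAt 𝓘(ℝ, E) x x) :=
    contDiffAt_comp_extChartAt_symm hy (by rwa [(extChartAt 𝓘(ℝ, E) x).left_inv hx])
  have hG : ContDiffAt ℝ ∞ (g ∘ (extChartAt 𝓘(ℝ, E) x).symm) (extChartAt 𝓘(ℝ, E) x x) :=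
    contDiffAt_comp_extChartAt_symm hy (by rwa [(extChartAt 𝓘(ℝ, E) x).left_inv hx])
  have ht : Filter.Tendsto (extChartAt 𝓘(ℝ, E) x).symm (𝓝 (extChartAt 𝓘(ℝ, E) x x)) (𝓝 x) := by
    have := (continuousAt_extChartAt_symm (I := 𝓘(ℝ, E)) x).tendsto
    rwa [(extChartAt 𝓘(ℝ, E) x).left_inv hx] at this
  -- Being zero on the level set, `g` trivially has a constrained extremum there, so Lagrange
  -- multipliers give a relation `a df + b dg = 0`. Regularity of `f` excludes `b = 0`.
  have hextr : IsLocalExtrOn (g ∘ (extChartAt 𝓘(ℝ, E) x).symm)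
      {z | (f ∘ (extChartAt 𝓘(ℝ, E) x).symm) z
        = (f ∘ (extChartAt 𝓘(ℝ, E) x).symm) (extChartAt 𝓘(ℝ, E) x x)}
      (extChartAt 𝓘(ℝ, E) x x) := by
    left
    filter_upwards [mem_nhdsWithin_of_mem_nhds (ht.eventually h), self_mem_nhdsWithin] with z hz hzf
    have e : (extChartAt 𝓘(ℝ, E) x).symm (extChartAt 𝓘(ℝ, E) x x) = x :=
      (extChartAt 𝓘(ℝ, E) x).left_inv hx
    rw [Function.comp_apply, Function.comp_apply, e, hfx] at hzf
    rw [Function.comp_apply, Function.comp_apply, e, hz hzf, h.self_of_nhds hfx]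
  obtain ⟨a, b, hab, hlin⟩ := hextr.exists_multipliers_of_hasStrictFDerivAt_1d
    (hF.hasStrictFDerivAt (by simp)) (hG.hasStrictFDerivAt (by simp))
  rw [mvfderiv_eq_fderiv_chart hx hf] at hdf hu
  rw [mvfderiv_eq_fderiv_chart hx hg]
  rw [ContinuousLinearMap.comp_apply] at hu ⊢
  have hb : b ≠ 0 := by
    rintro rfl
    have ha : a ≠ 0 := by simpa using hab
    rw [zero_smul, add_zero] at hlin
    refine hdf ?_
    rw [(smul_eq_zero.1 hlin).resolve_left ha, ContinuousLinearMap.zero_comp]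
  have := DFunLike.congr_fun hlin (chartCoord x x u)
  rw [add_apply, smul_apply, smul_apply, hu, smul_zero, zero_add, smul_eq_mul, zero_apply] at this
  exact (mul_eq_zero.1 this).resolve_left hb

end DefiningFunction

/-! ### The second fundamental form as a normalized Hessian -/

section SecondFundamentalForm

variable {E : Type*} [NormedAddCommGroup E] [NormedSpace ℝ E] [FiniteDimensional ℝ E]
  {M : Type*} [TopologicalSpace M] [ChartedSpace E M] [IsManifold 𝓘(ℝ, E) ∞ M]
  [RiemannianBundle (fun x : M ↦ TangentSpace 𝓘(ℝ, E) x)]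

lemma IsLocalDefiningFunction.norm_gradient_pos {D : Set M} {x : M} {f : M → ℝ}
    (hf : IsLocalDefiningFunction 𝓘(ℝ, E) D x f) : 0 < ‖gradient 𝓘(ℝ, E) f x‖ :=
  norm_pos_iff.2 fun h ↦ hf.2.1 (by simpa [gradient] using h)

variable [IsContMDiffRiemannianBundle 𝓘(ℝ, E) ∞ E (fun x : M ↦ TangentSpace 𝓘(ℝ, E) x)]

/-- The part of `n` orthogonal to `∇f` is tangent to the boundary, hence orthogonal to `n` as well,
hence zero. The sign comes from `df(n) < 0`. -/
lemma IsLocalDefiningFunction.eq_inwardUnitNormal {D : Set M} {x : M} {f : M → ℝ}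
    (hf : IsLocalDefiningFunction 𝓘(ℝ, E) D x f) {n : TangentSpace 𝓘(ℝ, E) x}
    (hn : IsInwardUnitNormal 𝓘(ℝ, E) D x n) :
    n = -(‖gradient 𝓘(ℝ, E) f x‖⁻¹ • gradient 𝓘(ℝ, E) f x) := by
  obtain ⟨hn1, hn2, hn3⟩ := hn
  have hpos := hf.norm_gradient_pos
  have hneg := hn3 f hf
  rw [← inner_gradient] at hneg
  set G := gradient 𝓘(ℝ, E) f x with hG
  set a := inner ℝ G n / ‖G‖ ^ 2 with ha
  have hGG : inner ℝ G G = ‖G‖ ^ 2 := real_inner_self_eq_norm_sq G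
  have h1 : inner ℝ G (n - a • G) = 0 := by
    rw [inner_sub_right, real_inner_smul_right, hGG, ha]
    field_simp
    ring
  have h2 : inner ℝ n (n - a • G) = 0 := hn2 _ (hf.isTangentToBoundary_iff.2 (by
    rw [← inner_gradient]; exact h1))
  have h3 : n - a • G = 0 := by
    rw [← inner_self_eq_zero (𝕜 := ℝ), inner_sub_left, h2, real_inner_smul_left, h1]
    simp
  have h4 : n = a • G := sub_eq_zero.1 h3
  have ha0 : a < 0 := div_neg_of_neg_of_pos hneg (by positivity)
  have h5 : -a * ‖G‖ = 1 := by
    rw [← hn1, h4, norm_smul, Real.norm_eq_abs, abs_of_neg ha0]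
  have h6 : a = -‖G‖⁻¹ := by
    field_simp
    linarith
  rw [h4, h6, neg_smul]

lemma IsLocalDefiningFunction.isInwardUnitNormal {D : Set M} {x : M} {f : M → ℝ}
    (hf : IsLocalDefiningFunction 𝓘(ℝ, E) D x f) :
    IsInwardUnitNormal 𝓘(ℝ, E) D x (-(‖gradient 𝓘(ℝ, E) f x‖⁻¹ • gradient 𝓘(ℝ, E) f x)) := by
  have hpos := hf.norm_gradient_pos
  refine ⟨?_, fun u hu ↦ ?_, fun g hg ↦ hf.mvfderiv_neg hg ?_⟩
  · rw [norm_neg, norm_smul, norm_inv, norm_norm, inv_mul_cancel₀ hpos.ne']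
  · rw [inner_neg_left, real_inner_smul_left, inner_gradient, hf.isTangentToBoundary_iff.1 hu,
      mul_zero, neg_zero]
  · rw [← inner_gradient, inner_neg_right, real_inner_smul_right, real_inner_self_eq_norm_sq]
    exact neg_lt_zero.2 (by positivity)

lemma continuousAt_norm_gradient {f : M → ℝ} {x : M}
    (hf : ∀ᶠ z in 𝓝 x, ContMDiffAt 𝓘(ℝ, E) 𝓘(ℝ, ℝ) ∞ f z) :
    ContinuousAt (fun z ↦ ‖gradient 𝓘(ℝ, E) f z‖) x := by
  have h := (contMDiffAt_inner (contMDiffAt_gradient hf) (contMDiffAt_gradient hf)).continuousAt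
  refine (Real.continuous_sqrt.continuousAt.comp h).congr (Filter.Eventually.of_forall fun z ↦ ?_)
  rw [Function.comp_apply, real_inner_self_eq_norm_sq, Real.sqrt_sq (norm_nonneg _)]

/-- The gradient stays nonzero near `x`. One function thus tests tangency of a field at all nearby
boundary points. -/
lemma IsLocalDefiningFunction.eventually_mem_frontier_iff {Y : Set M} (hYc : IsClosed Y)
    (hY : Y ⊆ closure (interior Y)) {x : M} {f : M → ℝ}
    (hf : IsLocalDefiningFunction 𝓘(ℝ, E) Y x f) :
    ∀ᶠ z in 𝓝 x, (z ∈ frontier Y ↔ f z = 0) ∧ (f z = 0 →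
      IsLocalDefiningFunction 𝓘(ℝ, E) Y z f) := by
  have h1 := (continuousAt_norm_gradient hf.eventually_contMDiffAt).eventually
    (lt_mem_nhds hf.norm_gradient_pos)
  obtain ⟨N, hN, hNo, hxN⟩ := eventually_nhds_iff.1
    (hf.eventually_contMDiffAt.and (h1.and hf.eventually_mem_interior_iff))
  have hdf : ∀ z ∈ N, mvfderiv 𝓘(ℝ, E) f z ≠ 0 := fun z hz h0 ↦ by
    have h2 := (hN z hz).2.1
    rw [gradient_eq_zero_iff.2 h0, norm_zero] at h2
    exact lt_irrefl _ h2
  filter_upwards [hNo.mem_nhds hxN] with z hz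
  exact ⟨(mem_iff_le_zero_of_regular hYc hY hNo (fun y hy ↦ (hN y hy).1)
    (fun y hy _ ↦ hdf y hy) (fun y hy ↦ (hN y hy).2.2) hz).2, fun h0 ↦ ⟨h0, hdf z hz, N, hNo, hz,
    fun y hy ↦ (hN y hy).1.contMDiffWithinAt, fun y hy ↦ (hN y hy).2.2⟩⟩

/-- The second fundamental form is the Hessian of a defining function divided by the norm of its
gradient. -/
lemma IsSecondFundamentalForm.eq_hessian_div {Y : Set M} (hYc : IsClosed Y)
    (hY : Y ⊆ closure (interior Y)) {x : M} {f : M → ℝ}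
    (hf : IsLocalDefiningFunction 𝓘(ℝ, E) Y x f) {u w : TangentSpace 𝓘(ℝ, E) x}
    (hu : IsTangentToBoundary 𝓘(ℝ, E) Y x u) {r : ℝ}
    (hr : IsSecondFundamentalForm 𝓘(ℝ, E) Y x u w r) :
    r = hessian 𝓘(ℝ, E) f x u w / ‖gradient 𝓘(ℝ, E) f x‖ := by
  obtain ⟨n, W, hn, ⟨hWx, U, hU, hxU, hWU, hWt⟩, rfl⟩ := hr
  have hx := mem_extChartAt_source (I := 𝓘(ℝ, E)) x
  have hsm := hf.eventually_contMDiffAt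
  have hW : ContMDiffAt 𝓘(ℝ, E) 𝓘(ℝ, E).tangent ∞ (T% W) x := hWU.contMDiffAt (hU.mem_nhds hxU)
  have hg : ContMDiffAt 𝓘(ℝ, E) 𝓘(ℝ, ℝ) ∞
      (fun y ↦ (inner ℝ (gradient 𝓘(ℝ, E) f y) (W y) : ℝ)) x :=
    contMDiffAt_inner (contMDiffAt_gradient hsm) hW
  have hvan : mvfderiv 𝓘(ℝ, E) (fun y ↦ (inner ℝ (gradient 𝓘(ℝ, E) f y) (W y) : ℝ)) x u = 0 := by
    refine mvfderiv_eq_zero_of_vanishes hsm.self_of_nhds hg hf.1 hf.2.1 ?_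
      (hf.isTangentToBoundary_iff.1 hu)
    filter_upwards [hf.eventually_mem_frontier_iff hYc hY, hU.mem_nhds hxU] with z hz hzU h0
    rw [inner_gradient]
    exact hWt z ⟨hzU, hz.1.2 h0⟩ f (hz.2 h0)
  -- Metric compatibility turns the vanishing derivative into `⟨∇_u ∇f, w⟩ = -⟨∇f, ∇_u W⟩`.
  have h := mvfderiv_inner_eq_leviCivita 𝓘(ℝ, E)
    (mdifferentiableAt_chartField_const hx (chartCoord x x u)) (mdifferentiableAt_gradient hsm)
    (hW.mdifferentiableAt (by simp))
  rw [chartField_chartCoord hx, hvan, hWx] at h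
  rw [hf.eq_inwardUnitNormal hn, inner_neg_left, real_inner_smul_left, hessian,
    eq_neg_of_add_eq_zero_left h.symm]
  ring

/-- Tangent vectors extend to tangent fields. -/
lemma exists_isTangentExtension {Y : Set M} (hYc : IsClosed Y)
    (hY : Y ⊆ closure (interior Y)) {x : M} {f : M → ℝ}
    (hf : IsLocalDefiningFunction 𝓘(ℝ, E) Y x f)
    (hgrad : ∀ᶠ z in 𝓝 x, ‖gradient 𝓘(ℝ, E) f z‖ = 1) {u : TangentSpace 𝓘(ℝ, E) x}
    (hu : IsTangentToBoundary 𝓘(ℝ, E) Y x u) :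
    ∃ W, IsTangentExtension 𝓘(ℝ, E) Y x u W := by
  have hx := mem_extChartAt_source (I := 𝓘(ℝ, E)) x
  set X := chartField x (fun _ ↦ chartCoord x x u) with hX
  have hXx : X x = u := chartField_chartCoord hx u
  obtain ⟨N, hN, hNo, hxN⟩ := eventually_nhds_iff.1
    (hf.eventually_contMDiffAt.eventually_nhds.and (hgrad.and
    ((hf.eventually_mem_frontier_iff hYc hY).and
    ((isOpen_extChartAt_source (I := 𝓘(ℝ, E)) x).mem_nhds hx))))
  -- The coordinate field extending `u`, with its normal component removed; no normalization is
  -- needed as `|∇f| = 1`.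
  refine ⟨X - (fun y ↦ (inner ℝ (gradient 𝓘(ℝ, E) f y) (X y) : ℝ)) • gradient 𝓘(ℝ, E) f, ?_,
    N, hNo, hxN, fun z hz ↦ ?_, fun z hz ↦ ?_⟩
  · change X x - (inner ℝ (gradient 𝓘(ℝ, E) f x) (X x) : ℝ) • gradient 𝓘(ℝ, E) f x = u
    rw [hXx, inner_gradient, hf.isTangentToBoundary_iff.1 hu, zero_smul, sub_zero]
  · have h1 : ContMDiffAt 𝓘(ℝ, E) 𝓘(ℝ, E).tangent ∞ (T% X) z :=
      contMDiffAt_chartField (hN z hz).2.2.2 contDiffAt_const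
    have h2 := contMDiffAt_gradient (hN z hz).1
    exact (h1.sub_section ((contMDiffAt_inner h2 h1).smul_section h2)).contMDiffWithinAt
  · obtain ⟨h1, h2, h3, -⟩ := hN z hz.1
    rw [(h3.2 (h3.1.1 hz.2)).isTangentToBoundary_iff, ← inner_gradient]
    change inner ℝ (gradient 𝓘(ℝ, E) f z)
      (X z - (inner ℝ (gradient 𝓘(ℝ, E) f z) (X z) : ℝ) • gradient 𝓘(ℝ, E) f z) = 0
    rw [inner_sub_right, real_inner_smul_right, real_inner_self_eq_norm_sq, h2]
    ring

/-- `SecondFundamentalFormGE` quantifies over all values `r` of the form, so extracting an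
inequality from it requires that a value exists. -/
lemma exists_isSecondFundamentalForm {Y : Set M} (hYc : IsClosed Y)
    (hY : Y ⊆ closure (interior Y)) {x : M} {f : M → ℝ}
    (hf : IsLocalDefiningFunction 𝓘(ℝ, E) Y x f)
    (hgrad : ∀ᶠ z in 𝓝 x, ‖gradient 𝓘(ℝ, E) f z‖ = 1) (u : TangentSpace 𝓘(ℝ, E) x)
    {w : TangentSpace 𝓘(ℝ, E) x} (hw : IsTangentToBoundary 𝓘(ℝ, E) Y x w) :
    ∃ r, IsSecondFundamentalForm 𝓘(ℝ, E) Y x u w r := by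
  obtain ⟨W, hW⟩ := exists_isTangentExtension hYc hY hf hgrad hw
  exact ⟨_, _, W, hf.isInwardUnitNormal, hW, rfl⟩

end SecondFundamentalForm

/-! ### Sublevel descriptions yield defining functions -/

section Main

variable {E : Type*} [NormedAddCommGroup E] [NormedSpace ℝ E] [FiniteDimensional ℝ E]
  {M : Type*} [TopologicalSpace M] [ChartedSpace E M] [IsManifold 𝓘(ℝ, E) ∞ M]
  [RiemannianBundle (fun x : M ↦ TangentSpace 𝓘(ℝ, E) x)]
  [IsContMDiffRiemannianBundle 𝓘(ℝ, E) ∞ E (fun x : M ↦ TangentSpace 𝓘(ℝ, E) x)]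

/-- A function with sublevel set `Y` and nonvanishing gradient near the boundary is a local
defining function of `Y` at its boundary points. -/
lemma isLocalDefiningFunction_of_eq_sublevel {Y : Set M} {V : M → ℝ}
    (hV : Y = {x | V x ≤ 0}) {U : Set M} (hU : IsOpen U)
    (hVU : ContMDiffOn 𝓘(ℝ, E) 𝓘(ℝ, ℝ) ∞ V U) (hgrad : ∀ x ∈ U, gradient 𝓘(ℝ, E) V x ≠ 0)
    {x : M} (hxU : x ∈ U) (hx : x ∈ frontier Y) : IsLocalDefiningFunction 𝓘(ℝ, E) Y x V := by
  have hsm : ∀ z ∈ U, ContMDiffAt 𝓘(ℝ, E) 𝓘(ℝ, ℝ) ∞ V z := fun z hz ↦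
    hVU.contMDiffAt (hU.mem_nhds hz)
  have hdV : ∀ z ∈ U, mvfderiv 𝓘(ℝ, E) V z ≠ 0 := fun z hz h ↦
    hgrad z hz (gradient_eq_zero_iff.2 h)
  have hint : ∀ z ∈ U, z ∈ interior Y ↔ V z < 0 := fun z hz ↦ by
    rw [mem_interior_iff_mem_nhds]
    constructor
    · intro hzY
      have hz0 : V z ≤ 0 := by
        have := mem_of_mem_nhds hzY
        rwa [hV] at this
      -- A zero of `V` in the interior of `Y` would be a local maximum, contradicting the
      -- nonvanishing differential.
      refine hz0.lt_of_ne fun h0 ↦ hdV z hz (mvfderiv_eq_zero_of_isLocalExtr (Or.inr ?_) (hsm z hz))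
      filter_upwards [hzY] with y hy
      rw [hV] at hy
      rw [h0]
      exact hy
    · intro hneg
      filter_upwards [(hsm z hz).continuousAt.eventually (gt_mem_nhds hneg)] with y hy
      rw [hV]
      exact hy.le
  refine ⟨le_antisymm ?_ ?_, hdV x hxU, U, hU, hxU, hVU, hint⟩
  · by_contra! hpos
    have h1 : ∀ᶠ y in 𝓝 x, y ∉ Y := by
      filter_upwards [(hsm x hxU).continuousAt.eventually (lt_mem_nhds hpos)] with y hy
      rw [hV]
      exact not_le.2 hy
    obtain ⟨y, hy1, hy2⟩ := mem_closure_iff_nhds.1 (frontier_subset_closure hx) _ h1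
    exact hy1 hy2
  · by_contra! hneg
    exact hx.2 ((hint x hxU).2 hneg)

end Main

/-! ### The implications between the three conditions -/

section Equivalence

variable {E : Type*} [NormedAddCommGroup E] [NormedSpace ℝ E] [FiniteDimensional ℝ E]
  {M : Type*} [MetricSpace M] [ChartedSpace E M] [IsManifold 𝓘(ℝ, E) ∞ M]
  [RiemannianBundle (fun x : M ↦ TangentSpace 𝓘(ℝ, E) x)]
  [IsContMDiffRiemannianBundle 𝓘(ℝ, E) ∞ E (fun x : M ↦ TangentSpace 𝓘(ℝ, E) x)]

/-- Dividing the Hessian bound by `|∇V|` gives `𝓘 ≥ (κ - δ)/(1 - δ)`, and `δ` tends to zero from the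
right. -/
lemma secondFundamentalFormGE_of_hessianGE {Y : Set M} (hYc : IsClosed Y)
    (hY : Y ⊆ closure (interior Y)) {κ : ℝ} (hκ : κ ≤ 0)
    (h : ∀ δ : ℝ, 0 < δ → ∃ V : M → ℝ, Y = {x | V x ≤ 0} ∧
      ∃ U : Set M, IsOpen U ∧ frontier Y ⊆ U ∧ ContMDiffOn 𝓘(ℝ, E) 𝓘(ℝ, ℝ) ∞ V U ∧
        HessianGE 𝓘(ℝ, E) V (κ - δ) U ∧ ∀ x ∈ U, 1 - δ ≤ ‖gradient 𝓘(ℝ, E) V x‖) :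
    SecondFundamentalFormGE 𝓘(ℝ, E) Y κ := by
  intro x hx u hu r hr
  have key : ∀ δ ∈ Ioo (0 : ℝ) 1, (κ - δ) / (1 - δ) * ‖u‖ ^ 2 ≤ r := fun δ hδ ↦ by
    obtain ⟨V, hV, U, hU, hFU, hVU, hess, hgrad⟩ := h δ hδ.1
    have h1δ : 0 < 1 - δ := sub_pos.2 hδ.2
    have hxU := hFU hx
    have hdef := isLocalDefiningFunction_of_eq_sublevel hV hU hVU
      (fun z hz h0 ↦ by
        have := hgrad z hz
        rw [h0, norm_zero] at this
        linarith) hxU hx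
    have h1 := hess x hxU u
    have h2 := hgrad x hxU
    rw [hr.eq_hessian_div hYc hY hdef hu, div_mul_eq_mul_div,
      div_le_div_iff₀ h1δ (h1δ.trans_le h2)]
    -- The sign of `κ` enters here: for a nonpositive numerator, `1 - δ ≤ |∇V|` yields a lower bound
    -- of the quotient.
    have h3 : (κ - δ) * ‖u‖ ^ 2 ≤ 0 :=
      mul_nonpos_of_nonpos_of_nonneg (by linarith [hδ.1]) (sq_nonneg _)
    exact (mul_le_mul_of_nonpos_left h2 h3).trans (mul_le_mul_of_nonneg_right h1 h1δ.le)
  have hlim : Filter.Tendsto (fun δ : ℝ ↦ (κ - δ) / (1 - δ) * ‖u‖ ^ 2) (𝓝[>] 0)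
      (𝓝 (κ * ‖u‖ ^ 2)) := by
    have hc : ContinuousAt (fun δ : ℝ ↦ (κ - δ) / (1 - δ) * ‖u‖ ^ 2) 0 :=
      ((continuousAt_const.sub continuousAt_id).div (continuousAt_const.sub continuousAt_id)
        (by simp)).mul continuousAt_const
    have := hc.tendsto.mono_left (nhdsWithin_le_nhds (s := Ioi 0))
    simpa using this
  refine le_of_tendsto hlim ?_
  filter_upwards [Ioo_mem_nhdsGT (zero_lt_one (α := ℝ))] with δ hδ using key δ hδ

/-- On the boundary, a lower bound of the second fundamental form bounds the Hessian of the
signed distance in all directions. -/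
lemma hessian_ge_of_secondFundamentalFormGE {Y : Set M} (hYc : IsClosed Y)
    (hY : Y ⊆ closure (interior Y)) {κ : ℝ} (hκ : κ ≤ 0)
    (h : SecondFundamentalFormGE 𝓘(ℝ, E) Y κ) {x : M} (hx : x ∈ frontier Y) {f : M → ℝ}
    (hf : IsLocalDefiningFunction 𝓘(ℝ, E) Y x f)
    (hgrad : ∀ᶠ z in 𝓝 x, ‖gradient 𝓘(ℝ, E) f z‖ = 1) (v : TangentSpace 𝓘(ℝ, E) x) :
    κ * ‖v‖ ^ 2 ≤ hessian 𝓘(ℝ, E) f x v v := by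
  set G := gradient 𝓘(ℝ, E) f x with hG
  have hG1 : ‖G‖ = 1 := hgrad.self_of_nhds
  set a : ℝ := inner ℝ G v with ha
  set u := v - a • G with hu
  have hGu : inner ℝ G u = (0 : ℝ) := by
    rw [hu, inner_sub_right, real_inner_smul_right, real_inner_self_eq_norm_sq, hG1]
    ring
  have huT : IsTangentToBoundary 𝓘(ℝ, E) Y x u :=
    hf.isTangentToBoundary_iff.2 (by rw [← inner_gradient]; exact hGu)
  obtain ⟨r, hr⟩ := exists_isSecondFundamentalForm hYc hY hf hgrad u huT
  have h1 := h x hx u huT r hr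
  rw [hr.eq_hessian_div hYc hY hf huT, ← hG, hG1, div_one] at h1
  have hv : v = u + a • G := by rw [hu, sub_add_cancel]
  have hnorm : ‖v‖ ^ 2 = ‖u‖ ^ 2 + a ^ 2 := by
    rw [hv, ← real_inner_self_eq_norm_sq (u + a • G), inner_add_left, inner_add_right,
      inner_add_right, real_inner_smul_left, real_inner_smul_right, real_inner_smul_left,
      real_inner_smul_right, real_inner_self_eq_norm_sq, real_inner_self_eq_norm_sq,
      hGu, (real_inner_comm G u).trans hGu, hG1]
    ring
  rw [hnorm]
  conv_rhs => rw [hv]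
  rw [hessian_self_eq_of_unit_gradient hf.eventually_contMDiffAt hgrad]
  -- The normal component adds `κ a² ≤ 0` on the left and nothing to the Hessian.
  nlinarith [sq_nonneg a]

variable [IsRiemannianManifold 𝓘(ℝ, E) M]

lemma isLocalDefiningFunction_signedDistance {Y : Set M} (hYc : IsClosed Y)
    (hY : Y ⊆ closure (interior Y)) {p : M} {f : M → ℝ}
    (hf : IsLocalDefiningFunction 𝓘(ℝ, E) Y p f) (hp : p ∈ frontier Y) :
    IsLocalDefiningFunction 𝓘(ℝ, E) Y p (signedDistance Y) ∧
      ∀ᶠ z in 𝓝 p, ‖gradient 𝓘(ℝ, E) (signedDistance Y) z‖ = 1 := by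
  obtain ⟨N, hNo, hpN, hN⟩ := exists_signedDistance_eventuallyEq hYc hY hf
  refine ⟨⟨?_, fun h0 ↦ ?_, N, hNo, hpN, fun z hz ↦ (hN z hz).1.contMDiffWithinAt,
    fun z hz ↦ (hN z hz).2.2⟩, ?_⟩
  · simp [signedDistance, Metric.infDist_zero_of_mem hp]
  · have := (hN p hpN).2.1
    rw [gradient_eq_zero_iff.2 h0] at this
    simp at this
  · filter_upwards [hNo.mem_nhds hpN] with z hz using (hN z hz).2.1

/-- Nonemptiness of the boundary matters: `Metric.infDist` to the empty set is zero, so the sublevel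
set would be the whole space. -/
lemma eq_setOf_signedDistance_le {Y : Set M} (hYc : IsClosed Y) (hF : (frontier Y).Nonempty) :
    Y = {x | signedDistance Y x ≤ 0} := by
  ext x
  change x ∈ Y ↔ signedDistance Y x ≤ 0
  rw [signedDistance]
  split_ifs with h
  · simp [h, Metric.infDist_nonneg]
  · simp only [h, false_iff, not_le]
    exact (isClosed_frontier.notMem_iff_infDist_pos hF).1 fun hx ↦ h (hYc.frontier_subset hx)

end Equivalence

end RiemannianHess

/-! ### The main theorem -/

theorem mainTheorem9
    {E : Type*} [NormedAddCommGroup E] [NormedSpace ℝ E] [FiniteDimensional ℝ E]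
    {M : Type*} [MetricSpace M] [ChartedSpace E M] [IsManifold 𝓘(ℝ, E) ∞ M]
    [RiemannianBundle (fun x : M ↦ TangentSpace 𝓘(ℝ, E) x)]
    [IsContMDiffRiemannianBundle 𝓘(ℝ, E) ∞ E (fun x : M ↦ TangentSpace 𝓘(ℝ, E) x)]
    [IsRiemannianManifold 𝓘(ℝ, E) M]
    (Ω : Set M) (hΩ : IsOpen Ω) (hΩb : Bornology.IsBounded Ω)
    (hΩs : RiemannianHess.HasSmoothBoundary 𝓘(ℝ, E) Ω)
    (Y : Set M) (hY : Y = closure Ω) (κ : ℝ) (hκ : κ ≤ 0) :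
    List.TFAE [
      ∀ δ : ℝ, 0 < δ → ∃ V : M → ℝ, Y = {x | V x ≤ 0} ∧
        ∃ U : Set M, IsOpen U ∧ frontier Y ⊆ U ∧ ContMDiffOn 𝓘(ℝ, E) 𝓘(ℝ, ℝ) ∞ V U ∧
          RiemannianHess.HessianGE 𝓘(ℝ, E) V (κ - δ) U ∧
          ∀ x ∈ U, 1 - δ ≤ ‖RiemannianHess.gradient 𝓘(ℝ, E) V x‖,
      ∀ κ' : ℝ, κ' < κ →
        ∃ U : Set M, IsOpen U ∧ frontier Y ⊆ U ∧
          ContMDiffOn 𝓘(ℝ, E) 𝓘(ℝ, ℝ) ∞ (RiemannianHess.signedDistance Y) U ∧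
          RiemannianHess.HessianGE 𝓘(ℝ, E) (RiemannianHess.signedDistance Y) κ' U,
      RiemannianHess.SecondFundamentalFormGE 𝓘(ℝ, E) Y κ] := by
  have hYc : IsClosed Y := hY ▸ isClosed_closure
  have hYreg : Y ⊆ closure (interior Y) := by rw [hY, hΩs.interior_closure hΩ]
  have hYs : RiemannianHess.HasSmoothBoundary 𝓘(ℝ, E) Y := hY ▸ hΩs.closure hΩ
  have hsd : ∀ p ∈ frontier Y,
      RiemannianHess.IsLocalDefiningFunction 𝓘(ℝ, E) Y p (RiemannianHess.signedDistance Y) ∧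
      ∀ᶠ z in 𝓝 p,
        ‖RiemannianHess.gradient 𝓘(ℝ, E) (RiemannianHess.signedDistance Y) z‖ = 1 := fun p hp ↦ by
    obtain ⟨f, hf⟩ := hYs p hp
    exact RiemannianHess.isLocalDefiningFunction_signedDistance hYc hYreg hf hp
  tfae_have 1 → 3 := RiemannianHess.secondFundamentalFormGE_of_hessianGE hYc hYreg hκ
  tfae_have 3 → 2 := by
    intro h κ' hκ'
    -- Both requirements are pointwise, so the interior of the set where they hold is the largest
    -- candidate. It contains `∂Y` because they hold near each boundary point.
    refine ⟨interior {x | ContMDiffAt 𝓘(ℝ, E) 𝓘(ℝ, ℝ) ∞ (RiemannianHess.signedDistance Y) x ∧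
      ∀ u : TangentSpace 𝓘(ℝ, E) x, κ' * ‖u‖ ^ 2 ≤
        RiemannianHess.hessian 𝓘(ℝ, E) (RiemannianHess.signedDistance Y) x u u}, isOpen_interior,
      fun p hp ↦ ?_, fun x hx ↦ (interior_subset hx).1.contMDiffWithinAt,
      fun x hx ↦ (interior_subset hx).2⟩
    obtain ⟨hf, hgrad⟩ := hsd p hp
    exact mem_interior_iff_mem_nhds.2 (hf.eventually_contMDiffAt.and
      (RiemannianHess.eventually_hessian_ge hκ' hf.eventually_contMDiffAt
        (RiemannianHess.hessian_ge_of_secondFundamentalFormGE hYc hYreg hκ h hp hf hgrad)))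
  tfae_have 2 → 1 := by
    intro h δ hδ
    rcases (frontier Y).eq_empty_or_nonempty with hF | hF
    · classical
      -- Without boundary the signed distance is identically zero and fails to describe `Y`. Any
      -- function with the right sublevel set works, since `U` may be empty.
      refine ⟨fun x ↦ if x ∈ Y then -1 else 1, ?_, ∅, isOpen_empty, hF.subset, ?_, ?_, ?_⟩
      · ext x
        change x ∈ Y ↔ (if x ∈ Y then (-1 : ℝ) else 1) ≤ 0
        split_ifs with hx <;> simp [hx]
      · exact fun x hx ↦ hx.elim
      · exact fun x hx ↦ hx.elim
      · exact fun x hx ↦ hx.elim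
    · obtain ⟨U, hU, hFU, hsm, hess⟩ := h (κ - δ) (by linarith)
      refine ⟨RiemannianHess.signedDistance Y, RiemannianHess.eq_setOf_signedDistance_le hYc hF,
        U ∩ interior {x | 1 - δ ≤
          ‖RiemannianHess.gradient 𝓘(ℝ, E) (RiemannianHess.signedDistance Y) x‖},
        hU.inter isOpen_interior, fun p hp ↦ ⟨hFU hp, ?_⟩, hsm.mono inter_subset_left,
        fun x hx ↦ hess x hx.1, fun x hx ↦ ?_⟩
      swap
      · have := interior_subset hx.2
        exact this
      refine mem_interior_iff_mem_nhds.2 ?_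
      -- The gradient has norm one near `p`, which exceeds `1 - δ`.
      filter_upwards [(hsd p hp).2] with z hz
      rw [hz]
      linarith
  tfae_finish
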